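/- **Theorem (Anosov's averaging theorem).** Let $\mathcal M$ be a smooth finite-dimensional Riemannian manifold (Hausdorff, second countable, without boundary), let $\varepsilon_0>0$, and let $Z(\cdot,\varepsilon)$, $\varepsilon\in[0,\varepsilon_0]$, be a family of vector fields on $\mathcal M$ such that $Z$ and $\partial Z/\partial\varepsilon$ are $\mathcal C^1$ on $\mathcal M\times[0,\varepsilon_0]$. Let $z_\varepsilon(t,z)$ be the (possibly only locally defined) flow of $dz/dt=Z(z,\varepsilon)$. Assume: * *Smooth integrals.* $h=(h_1,\dots,h_m):\mathcal M\to\mathbb R^m$ is $\mathcal C^2$, $Dh(z)$ has rank $m$ at every point $z\in\mathcal M$, and $h(z_0(t,z))=h(z)$ for all $t$ and $z$ for which $z_0(t,z)$ is defined. * *Compactness.* $\mathcal U\subset\mathbb R^m$ is an open ball such that for every $c\in\mathcal U$ the level set $\mathcal M_c=\{h=c\}$ is compact and nonempty. * *Preservation of smooth measures.* There is a $\mathcal C^1$ function $g:\mathcal M\to\mathbb R_{>0}$ such that for every $c\in\mathcal U$ the flow $z_0(t)|_{\mathcal M_c}$ preserves the measure $\mu_c$ on $\mathcal M_c$ that has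 density $g|_{\mathcal M_c}$ with respect to the Riemannian volume of the submanifold $\mathcal M_c$ (with the induced metric). * *Ergodicity.* For Lebesgue almost every $c\in\mathcal U$, $(z_0(\cdot)|_{\mathcal M_c},\mu_c)$ is ergodic. Put $H(z,0)=Dh(z)\,\frac{\partial Z}{\partial\varepsilon}(z,0)$ and, for $c\in\mathcal U$, $$\bar H(c)=\frac1{\mu_c(\mathcal M_c)}\int_{\mathcal M_c}H(z,0)\,d\mu_c(z).$$ Let $h_\varepsilon(t,z)=h(z_\varepsilon(t,z))$ and let $\bar h(\tau,z)$ be the solution of $d\bar h/d\tau=\bar H(\bar h)$, $\bar h(0,z)=h(z)$. Fix a compact set $\mathcal V\subset\mathcal U$ and, for $z\in h^{-1}(\mathcal U)$, let $$T_\varepsilon(z)=\inf\{\tau\ge0:\ \bar h(\tau,z)\notin\mathcal V\ \text{ or }\ h_\varepsilon(\tau/\varepsilon,z)\notin\mathcal V\}$$ with $\inf\emptyset=\infty$ (up to this time both paths are defined). Let $P$ denote Riemannian volume on $\mathcal M$. Then for every $T>0$ and every $\delta>0$, $$P\Bigl(\bigl\{z\in h^{-1}(\mathcal U):\ \sup_{0\le\tau\le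 T\wedge T_\varepsilon(z)}\bigl|h_\varepsilon(\tau/\varepsilon,z)-\bar h(\tau,z)\bigr|\ge\delta\bigr\}\Bigr)\longrightarrow0\qquad\text{as }\varepsilon\to0^+ .$$ -/

import Mathlib

open Set Filter Topology MeasureTheory
open scoped Manifold ContDiff ENNReal

namespace Averaging

/-- The flow of a vector field `X` on a manifold: `flowMap X t x` is the value at time `t` of the
solution of `dγ/dt = X(γ)`, `γ(0) = x`, whenever that solution exists on the interval between
`0` and `t` (it is then unique for a `C¹` field on a Hausdorff manifold).  Where no such
solution exists, the value `x` is a placeholder. -/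
noncomputable def flowMap {k : ℕ} {N : Type*} [TopologicalSpace N]
    [ChartedSpace (EuclideanSpace ℝ (Fin k)) N]
    (X : (x : N) → TangentSpace (𝓡 k) x) (t : ℝ) (x : N) : N :=
  open Classical in
  if hx : ∃ γ : ℝ → N, γ 0 = x ∧ IsMIntegralCurveOn γ X (uIcc 0 t) then hx.choose t else x

section Volume

variable {n : ℕ} {M : Type*} [TopologicalSpace M] [ChartedSpace (EuclideanSpace ℝ (Fin n)) M]

/-- A local parametrization of a `d`-dimensional submanifold `S` of `M`: an injective `C¹`
immersion, of an open subset of `ℝᵈ` into `M`, with values in `S`. -/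
structure LocalParam (n : ℕ) {M : Type*} [TopologicalSpace M]
    [ChartedSpace (EuclideanSpace ℝ (Fin n)) M] (S : Set M) (d : ℕ) where
  dom : Set (EuclideanSpace ℝ (Fin d))
  toFun : EuclideanSpace ℝ (Fin d) → M
  isOpen_dom : IsOpen dom
  contMDiffOn : ContMDiffOn (𝓡 d) (𝓡 n) 1 toFun dom
  injOn : InjOn toFun dom
  immersion : ∀ x ∈ dom, Function.Injective (mfderiv (𝓡 d) (𝓡 n) toFun x)
  mapsTo : MapsTo toFun dom S

variable [IsManifold (𝓡 n) ∞ M]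

/-- The Riemannian volume element `√det(⟨∂ᵢφ, ∂ⱼφ⟩)` of a parametrization `φ`. -/
noncomputable def LocalParam.volumeElement
    (g : Bundle.ContMDiffRiemannianMetric (𝓡 n) ∞ (EuclideanSpace ℝ (Fin n))
      (fun x : M => TangentSpace (𝓡 n) x))
    {S : Set M} {d : ℕ} (p : LocalParam n S d) (x : EuclideanSpace ℝ (Fin d)) : ℝ :=
  √(Matrix.det (Matrix.of fun i j : Fin d =>
    g.inner (p.toFun x)
      (mfderiv (𝓡 d) (𝓡 n) p.toFun x (EuclideanSpace.single i (1 : ℝ)))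
      (mfderiv (𝓡 d) (𝓡 n) p.toFun x (EuclideanSpace.single j (1 : ℝ)))))

/-- The Riemannian volume of the image of a parametrization, as a measure on `M`: the image
under `φ` of the measure `√det(⟨∂ᵢφ, ∂ⱼφ⟩) dx` on the domain of `φ`. -/
noncomputable def LocalParam.measure [MeasurableSpace M]
    (g : Bundle.ContMDiffRiemannianMetric (𝓡 n) ∞ (EuclideanSpace ℝ (Fin n))
      (fun x : M => TangentSpace (𝓡 n) x))
    {S : Set M} {d : ℕ} (p : LocalParam n S d) : Measure M :=
  ((volume.restrict p.dom).withDensity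
    (fun x => ENNReal.ofReal (p.volumeElement g x))).map p.toFun

/-- The `d`-dimensional Riemannian volume of a `d`-dimensional submanifold `S` of the Riemannian
manifold `(M, g)`, for the metric induced by `g`, as a measure on `M` that is carried by `S`.
The measures given by two parametrizations agree on the intersection of the images, and their
least upper bound is the measure obtained by glueing them together. -/
noncomputable def riemannianVolumeOn [MeasurableSpace M]
    (g : Bundle.ContMDiffRiemannianMetric (𝓡 n) ∞ (EuclideanSpace ℝ (Fin n))
      (fun x : M => TangentSpace (𝓡 n) x))
    (S : Set M) (d : ℕ) : Measure M :=
  ⨆ p : LocalParam n S d, p.measure g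

/-- The Riemannian volume of `(M, g)`. -/
noncomputable def riemannianVolume [MeasurableSpace M]
    (g : Bundle.ContMDiffRiemannianMetric (𝓡 n) ∞ (EuclideanSpace ℝ (Fin n))
      (fun x : M => TangentSpace (𝓡 n) x)) : Measure M :=
  riemannianVolumeOn g univ n

/-- The measure `μ_c` on the level set `{h = c}` whose density with respect to the Riemannian
volume of the level set, a submanifold of codimension `m`, is the restriction of `ρ`. -/
noncomputable def fiberMeasure [MeasurableSpace M]
    (g : Bundle.ContMDiffRiemannianMetric (𝓡 n) ∞ (EuclideanSpace ℝ (Fin n))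
      (fun x : M => TangentSpace (𝓡 n) x))
    {m : ℕ} (h : M → EuclideanSpace ℝ (Fin m)) (ρ : M → ℝ) (c : EuclideanSpace ℝ (Fin m)) :
    Measure M :=
  (riemannianVolumeOn g (h ⁻¹' {c}) (n - m)).withDensity (fun x => ENNReal.ofReal (ρ x))

end Volume

/-- The maps `φ t` leave the measure `μ` invariant. -/
def Preserves {M : Type*} [MeasurableSpace M] (φ : ℝ → M → M) (μ : Measure M) : Prop :=
  ∀ t : ℝ, ∀ A : Set M, MeasurableSet A → μ (φ t ⁻¹' A) = μ A

/-- Ergodicity of the flow `φ` on the invariant set `S` with respect to an invariant measure `μ`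
that is carried by `S`: an invariant measurable set is null or conull. -/
def IsErgodicOn {M : Type*} [MeasurableSpace M] (φ : ℝ → M → M) (S : Set M) (μ : Measure M) :
    Prop :=
  ∀ A : Set M, MeasurableSet A → (∀ t : ℝ, ∀ x ∈ S, φ t x ∈ A ↔ x ∈ A) → μ A = 0 ∨ μ Aᶜ = 0

section Averaged

variable {n : ℕ} {M : Type*} [TopologicalSpace M] [ChartedSpace (EuclideanSpace ℝ (Fin n)) M]

/-- The derivative `∂Z/∂ε` of a family `Z ε`, `ε ∈ [0, ε₀]`, of vector fields (one-sided at the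
end points). -/
noncomputable def paramDeriv (ε₀ : ℝ) (Z : ℝ → (x : M) → TangentSpace (𝓡 n) x) (ε : ℝ) (x : M) :
    TangentSpace (𝓡 n) x :=
  derivWithin (fun e => Z e x) (Icc 0 ε₀) ε

/-- `H(z, 0)`: the Lie derivative of `h` along `∂Z/∂ε` at `ε = 0`. -/
noncomputable def slowDrift (ε₀ : ℝ) (Z : ℝ → (x : M) → TangentSpace (𝓡 n) x)
    {m : ℕ} (h : M → EuclideanSpace ℝ (Fin m)) (x : M) : EuclideanSpace ℝ (Fin m) :=
  mfderiv (𝓡 n) (𝓡 m) h x (paramDeriv ε₀ Z 0 x)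

/-- The averaged vector field: the mean of `H(·, 0)` over the level set `{h = c}` with respect to
the (normalized) measure `μ_c`. -/
noncomputable def averagedField [IsManifold (𝓡 n) ∞ M] [MeasurableSpace M]
    (g : Bundle.ContMDiffRiemannianMetric (𝓡 n) ∞ (EuclideanSpace ℝ (Fin n))
      (fun x : M => TangentSpace (𝓡 n) x))
    (ε₀ : ℝ) (Z : ℝ → (x : M) → TangentSpace (𝓡 n) x)
    {m : ℕ} (h : M → EuclideanSpace ℝ (Fin m)) (ρ : M → ℝ) (c : EuclideanSpace ℝ (Fin m)) :
    EuclideanSpace ℝ (Fin m) :=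
  ⨍ z, slowDrift ε₀ Z h z ∂(fiberMeasure g h ρ c)

/-- The averaged motion `h̄(τ, z)`: the solution of `dh̄/dτ = H̄(h̄)`, `h̄(0) = h(z)`. -/
noncomputable def averagedPath [IsManifold (𝓡 n) ∞ M] [MeasurableSpace M]
    (g : Bundle.ContMDiffRiemannianMetric (𝓡 n) ∞ (EuclideanSpace ℝ (Fin n))
      (fun x : M => TangentSpace (𝓡 n) x))
    (ε₀ : ℝ) (Z : ℝ → (x : M) → TangentSpace (𝓡 n) x)
    {m : ℕ} (h : M → EuclideanSpace ℝ (Fin m)) (ρ : M → ℝ) (z : M) (τ : ℝ) :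
    EuclideanSpace ℝ (Fin m) :=
  flowMap (N := EuclideanSpace ℝ (Fin m)) (averagedField g ε₀ Z h ρ) τ (h z)

/-- The actual motion of the slow variables in the slow time `τ`:
`h_ε(τ/ε, z) = h(z_ε(τ/ε, z))`. -/
noncomputable def slowPath (Z : ℝ → (x : M) → TangentSpace (𝓡 n) x)
    {m : ℕ} (h : M → EuclideanSpace ℝ (Fin m)) (ε : ℝ) (z : M) (τ : ℝ) :
    EuclideanSpace ℝ (Fin m) :=
  h (flowMap (Z ε) (τ / ε) z)

end Averaged

/-- The stopping time `inf {τ ≥ 0 : a(τ) ∉ V or b(τ) ∉ V}`, equal to `∞` if there is no such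
`τ`. -/
noncomputable def stoppingTime {F : Type*} (V : Set F) (a b : ℝ → F) : EReal :=
  ⨅ τ ∈ {τ : ℝ | 0 ≤ τ ∧ (a τ ∉ V ∨ b τ ∉ V)}, (τ : EReal)

/-- The supremum of `|b(τ) - a(τ)|` over the `τ ≥ 0` that satisfy `τ ≤ S`. -/
noncomputable def supDeviation {F : Type*} [PseudoEMetricSpace F] (S : EReal) (a b : ℝ → F) :
    ℝ≥0∞ :=
  ⨆ τ ∈ {τ : ℝ | 0 ≤ τ ∧ (τ : EReal) ≤ S}, edist (b τ) (a τ)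

end Averaging

/-! In the slow time `τ = εt` the path `h_ε` has velocity `H(z,0) + o(1)`, evaluated along the
orbit. A Gronwall argument (`exists_norm_sub_lt_of_averaged`) reduces the theorem to the fluctuation
`F = H(·,0) - H̄ ∘ h`, which has mean zero on every level set: it suffices that `ε ∫₀^{t/ε}
F(z_ε(u)) du` is small for all `t ≤ T` for which the orbit stays over `V`, outside a set of initial
points of small volume.

Divide the time `T/ε` into about `T/(εN)` blocks of a fixed length `N`. Let `μ = ∫ μ_c dc`. For the
unperturbed flow, the mean ergodic theorem on almost every level set and dominated convergence in
`c` make the `L¹(μ)` norm of `N⁻¹ ∫₀^N F` small for large `N`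
(`tendsto_lintegral_totalMeasure_orbitIntegral`). With `N` fixed, continuity in `ε` carries this
over to the perturbed flow. The integral over the `k`-th block is the one over the first block,
evaluated at the point `z_ε(kN)`; hence it remains to know that the flow up to time `T/ε` multiplies
`μ` by a bounded factor only. Markov's inequality for the sum of the norms of all block integrals
then bounds the exceptional set, and because this sum dominates the partial integrals for all `t` at
once, the supremum over `t` costs nothing.

The bounded factor is the dynamical core (`exists_local_distortion`). The unperturbed flow preserves
`μ`, so `φ_ε^{-s} E` has the same measure as `θ(E)` for `θ = φ_0^s φ_ε^{-s}`. In a chart, `θ` has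
Lipschitz constant `1 + O(εs)` and moves points by `O(εs)`, so it increases the measure by a factor
of at most `exp(Cεs)`. Iteration up to time `T/ε` gives `exp(CT)`. Differentiability of the flow in
the initial point is not needed.

Three preparations make this possible. Charts in which `h` is a projection turn `μ` into a positive
continuous density; hence `μ` dominates Riemannian volume on compact sets, and averages over level
sets are Lipschitz in `c`. Compactness of the single level sets does not by itself make `h` proper,
but ergodicity does: otherwise nearby level sets would split into two open invariant pieces
(`exists_precompact_preimage_nhds`). Properness permits multiplying `Z` by a cut-off function of
`h`, which yields complete flows; on each level set the unperturbed one changes only by a constant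
factor in speed, so invariance survives everywhere and ergodicity survives where the cut-off equals
one. -/

namespace Averaging

/-! ### Gram determinants -/

section GramDeterminant

variable {n : ℕ} {M : Type*} [TopologicalSpace M] [ChartedSpace (EuclideanSpace ℝ (Fin n)) M]
  [IsManifold (𝓡 n) ∞ M]

/-- The pull-back of the metric at `x` by a linear map into the tangent space at `x`. -/
noncomputable def pullbackForm
    (g : Bundle.ContMDiffRiemannianMetric (𝓡 n) ∞ (EuclideanSpace ℝ (Fin n))
      (fun x : M => TangentSpace (𝓡 n) x)) (x : M) {F : Type*} [AddCommGroup F] [Module ℝ F]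
    (L : F →ₗ[ℝ] TangentSpace (𝓡 n) x) : LinearMap.BilinForm ℝ F :=
  LinearMap.mk₂ ℝ (fun v w => g.inner x (L v) (L w)) (by simp) (by simp) (by simp) (by simp)

theorem pullbackForm_apply
    (g : Bundle.ContMDiffRiemannianMetric (𝓡 n) ∞ (EuclideanSpace ℝ (Fin n))
      (fun x : M => TangentSpace (𝓡 n) x)) (x : M) {F : Type*} [AddCommGroup F] [Module ℝ F]
    (L : F →ₗ[ℝ] TangentSpace (𝓡 n) x) (v w : F) :
    pullbackForm g x L v w = g.inner x (L v) (L w) := rfl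

/-- The Gram determinant of a linear map from a Euclidean space into a tangent space. -/
noncomputable def gramDet
    (g : Bundle.ContMDiffRiemannianMetric (𝓡 n) ∞ (EuclideanSpace ℝ (Fin n))
      (fun x : M => TangentSpace (𝓡 n) x)) (x : M) {d : ℕ}
    (L : EuclideanSpace ℝ (Fin d) →ₗ[ℝ] TangentSpace (𝓡 n) x) : ℝ :=
  Matrix.det (Matrix.of fun i j : Fin d =>
    g.inner x (L (EuclideanSpace.single i (1 : ℝ))) (L (EuclideanSpace.single j (1 : ℝ))))

theorem gramDet_eq
    (g : Bundle.ContMDiffRiemannianMetric (𝓡 n) ∞ (EuclideanSpace ℝ (Fin n))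
      (fun x : M => TangentSpace (𝓡 n) x)) (x : M) {d : ℕ}
    (L : EuclideanSpace ℝ (Fin d) →ₗ[ℝ] TangentSpace (𝓡 n) x) :
    gramDet g x L = (LinearMap.BilinForm.toMatrix (EuclideanSpace.basisFun (Fin d) ℝ).toBasis
      (pullbackForm g x L)).det := by
  unfold gramDet
  congr 1

/-- The Gram matrix `G` of `L` becomes `Aᵀ G A`. This is the transformation rule behind the
independence of the volume from the parametrization. -/
theorem gramDet_comp
    (g : Bundle.ContMDiffRiemannianMetric (𝓡 n) ∞ (EuclideanSpace ℝ (Fin n))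
      (fun x : M => TangentSpace (𝓡 n) x)) (x : M) {d : ℕ}
    (L : EuclideanSpace ℝ (Fin d) →ₗ[ℝ] TangentSpace (𝓡 n) x)
    (A : EuclideanSpace ℝ (Fin d) →ₗ[ℝ] EuclideanSpace ℝ (Fin d)) :
    gramDet g x (L ∘ₗ A) = (LinearMap.det A) ^ 2 * gramDet g x L := by
  have h : pullbackForm g x (L ∘ₗ A) = (pullbackForm g x L).comp A A := by
    ext v w
    simp [pullbackForm_apply]
  rw [gramDet_eq, gramDet_eq, h,
    LinearMap.BilinForm.toMatrix_comp (EuclideanSpace.basisFun (Fin d) ℝ).toBasis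
      (EuclideanSpace.basisFun (Fin d) ℝ).toBasis, Matrix.det_mul, Matrix.det_mul,
    Matrix.det_transpose, LinearMap.det_toMatrix]
  ring

theorem gramDet_pos
    (g : Bundle.ContMDiffRiemannianMetric (𝓡 n) ∞ (EuclideanSpace ℝ (Fin n))
      (fun x : M => TangentSpace (𝓡 n) x)) (x : M) {d : ℕ}
    (L : EuclideanSpace ℝ (Fin d) →ₗ[ℝ] TangentSpace (𝓡 n) x) (hL : Function.Injective L) :
    0 < gramDet g x L := by
  rw [gramDet_eq]
  apply Matrix.PosDef.det_pos
  refine Matrix.PosDef.of_dotProduct_mulVec_pos ?_ ?_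
  · ext i j
    rw [Matrix.conjTranspose_apply, LinearMap.BilinForm.toMatrix_apply,
      LinearMap.BilinForm.toMatrix_apply, pullbackForm_apply, pullbackForm_apply, g.symm]
    simp
  · intro v hv
    have h := LinearMap.BilinForm.apply_eq_dotProduct_toMatrix_mulVec
      (EuclideanSpace.basisFun (Fin d) ℝ).toBasis (pullbackForm g x L)
      (WithLp.toLp 2 v) (WithLp.toLp 2 v)
    have h2 : ((EuclideanSpace.basisFun (Fin d) ℝ).toBasis.repr (WithLp.toLp 2 v) : Fin d → ℝ)
        = v := by
      ext i; simp
    rw [h2] at h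
    rw [show star v = v from by ext; simp, ← h, pullbackForm_apply]
    apply g.pos
    intro h0
    apply hv
    have := hL (h0.trans (map_zero L).symm)
    simpa using this

end GramDeterminant

/-! ### Riemannian volume through a single parametrization -/

section Params

variable {n : ℕ} {M : Type*} [TopologicalSpace M] [ChartedSpace (EuclideanSpace ℝ (Fin n)) M]
  [IsManifold (𝓡 n) ∞ M]
  (g : Bundle.ContMDiffRiemannianMetric (𝓡 n) ∞ (EuclideanSpace ℝ (Fin n))
      (fun x : M => TangentSpace (𝓡 n) x)) {S : Set M} {d : ℕ}

theorem LocalParam.volumeElement_eq (p : LocalParam n S d) (x : EuclideanSpace ℝ (Fin d)) :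
    p.volumeElement g x = √ (gramDet g (p.toFun x) (mfderiv (𝓡 d) (𝓡 n) p.toFun x).toLinearMap) :=
  rfl

theorem measurableSet_preimage_inter_of_continuousOn {X Y : Type*} [TopologicalSpace X]
    [MeasurableSpace X] [OpensMeasurableSpace X] [TopologicalSpace Y] [MeasurableSpace Y]
    [BorelSpace Y] {f : X → Y} {D : Set X} (hf : ContinuousOn f D) (hD : MeasurableSet D)
    {A : Set Y} (hA : MeasurableSet A) : MeasurableSet (f ⁻¹' A ∩ D) := by
  have h : MeasurableSet (D.domRestrict f ⁻¹' A) := hf.domRestrict.measurable hA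
  have := hD.subtype_image h
  convert this using 1
  ext x
  constructor
  · rintro ⟨hx, hD⟩
    exact ⟨⟨x, hD⟩, hx, rfl⟩
  · rintro ⟨⟨y, hy⟩, h, rfl⟩
    exact ⟨h, hy⟩

variable [MeasurableSpace M] [BorelSpace M]

theorem LocalParam.measure_apply (p : LocalParam n S d) {A : Set M} (hA : MeasurableSet A) :
    p.measure g A
      = ∫⁻ x in p.toFun ⁻¹' A ∩ p.dom, ENNReal.ofReal (p.volumeElement g x) := by
  have hm : AEMeasurable p.toFun ((volume.restrict p.dom).withDensity
      (fun x => ENNReal.ofReal (p.volumeElement g x))) :=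
    (p.contMDiffOn.continuousOn.aemeasurable p.isOpen_dom.measurableSet).mono_ac
      (withDensity_absolutelyContinuous _ _)
  rw [LocalParam.measure, Measure.map_apply_of_aemeasurable hm hA, withDensity_apply',
    Measure.restrict_restrict' p.isOpen_dom.measurableSet]

/-- Over `O` the parametrization `q` factors as `p ∘ ψ` with `ψ = π ∘ q`. By the chain rule the
volume elements differ by `|det Dψ|`, and the change of variables formula applies. Only an
inequality results, because `q` need not reach all of `S ∩ O`. -/
theorem LocalParam.measure_le_measure (p q : LocalParam n S d) {O : Set M} (hO : IsOpen O)
    (himg : p.toFun '' p.dom = S ∩ O) {π : M → EuclideanSpace ℝ (Fin d)}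
    (hπ : ContMDiffOn (𝓡 n) (𝓡 d) 1 π O) (hπp : ∀ y ∈ p.dom, π (p.toFun y) = y)
    {A : Set M} (hA : MeasurableSet A) (hAO : A ⊆ O) :
    q.measure g A ≤ p.measure g A := by
  rw [q.measure_apply g hA, p.measure_apply g hA]
  set D := q.toFun ⁻¹' A ∩ q.dom
  have hD : MeasurableSet D := measurableSet_preimage_inter_of_continuousOn
    q.contMDiffOn.continuousOn q.isOpen_dom.measurableSet hA
  set ψ : EuclideanSpace ℝ (Fin d) → EuclideanSpace ℝ (Fin d) := fun x => π (q.toFun x)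
  have hopen : IsOpen (q.dom ∩ q.toFun ⁻¹' O) :=
    q.contMDiffOn.continuousOn.isOpen_inter_preimage q.isOpen_dom hO
  have hpψ : ∀ x ∈ q.dom ∩ q.toFun ⁻¹' O, ψ x ∈ p.dom ∧ p.toFun (ψ x) = q.toFun x := by
    intro x hx
    have : q.toFun x ∈ p.toFun '' p.dom := by
      rw [himg]; exact ⟨q.mapsTo hx.1, hx.2⟩
    obtain ⟨y, hy, hyx⟩ := this
    have h1 : ψ x = y := by simp only [ψ, ← hyx, hπp y hy]
    rw [h1]; exact ⟨hy, hyx⟩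
  have hDsub : D ⊆ q.dom ∩ q.toFun ⁻¹' O := fun x hx => ⟨hx.2, hAO hx.1⟩
  have hqd : ∀ x ∈ q.dom, MDifferentiableAt (𝓡 d) (𝓡 n) q.toFun x := fun x hx =>
    (q.contMDiffOn.contMDiffAt (q.isOpen_dom.mem_nhds hx)).mdifferentiableAt one_ne_zero
  have hpd : ∀ x ∈ p.dom, MDifferentiableAt (𝓡 d) (𝓡 n) p.toFun x := fun x hx =>
    (p.contMDiffOn.contMDiffAt (p.isOpen_dom.mem_nhds hx)).mdifferentiableAt one_ne_zero
  have hψd : ∀ x ∈ q.dom ∩ q.toFun ⁻¹' O, MDifferentiableAt (𝓡 d) (𝓡 d) ψ x := fun x hx =>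
    ((hπ.contMDiffAt (hO.mem_nhds hx.2)).mdifferentiableAt one_ne_zero).comp x (hqd x hx.1)
  have hψinj : InjOn ψ D := by
    intro x hx y hy hxy
    apply q.injOn hx.2 hy.2
    rw [← (hpψ x (hDsub hx)).2, ← (hpψ y (hDsub hy)).2, hxy]
  have hvol : ∀ x ∈ D, q.volumeElement g x = |(fderiv ℝ ψ x).det| * p.volumeElement g (ψ x) := by
    intro x hx
    have hx' := hDsub hx
    have h1 : mfderiv (𝓡 d) (𝓡 n) q.toFun x
        = (mfderiv (𝓡 d) (𝓡 n) p.toFun (ψ x)).comp (mfderiv (𝓡 d) (𝓡 d) ψ x) := by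
      rw [← mfderiv_comp x (hpd _ (hpψ x hx').1) (hψd x hx')]
      apply Filter.EventuallyEq.mfderiv_eq
      filter_upwards [hopen.mem_nhds hx'] with z hz
      exact (hpψ z hz).2.symm
    have h2 : q.volumeElement g x = √ (gramDet g (p.toFun (ψ x))
        ((mfderiv (𝓡 d) (𝓡 n) p.toFun (ψ x)).toLinearMap ∘ₗ (fderiv ℝ ψ x).toLinearMap)) := by
      unfold LocalParam.volumeElement gramDet
      rw [h1, (hpψ x hx').2, mfderiv_eq_fderiv]
      rfl
    rw [h2, p.volumeElement_eq]
    refine (congrArg Real.sqrt (gramDet_comp g (p.toFun (ψ x))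
      (mfderiv (𝓡 d) (𝓡 n) p.toFun (ψ x)).toLinearMap (fderiv ℝ ψ x).toLinearMap)).trans ?_
    rw [Real.sqrt_mul (sq_nonneg _), Real.sqrt_sq_eq_abs]
  calc ∫⁻ x in D, ENNReal.ofReal (q.volumeElement g x)
      = ∫⁻ x in D, ENNReal.ofReal |(fderiv ℝ ψ x).det| *
          ENNReal.ofReal (p.volumeElement g (ψ x)) := by
        apply setLIntegral_congr_fun hD
        intro x hx
        simp only [hvol x hx, ENNReal.ofReal_mul (abs_nonneg _)]
    _ = ∫⁻ y in ψ '' D, ENNReal.ofReal (p.volumeElement g y) := by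
        rw [lintegral_image_eq_lintegral_abs_det_fderiv_mul volume hD (f' := fderiv ℝ ψ) _ hψinj]
        intro x hx
        exact ((mdifferentiableAt_iff_differentiableAt.mp
          (hψd x (hDsub hx))).hasFDerivAt).hasFDerivWithinAt
    _ ≤ _ := by
        apply lintegral_mono_set
        rintro _ ⟨x, hx, rfl⟩
        have := hpψ x (hDsub hx)
        refine ⟨?_, this.1⟩
        rw [mem_preimage, this.2]
        exact hx.1

/-- A parametrization that covers `S ∩ O` and has a `C¹` left inverse attains the supremum over all
parametrizations there, so the volume can be computed in one chart. -/
theorem riemannianVolumeOn_apply (p : LocalParam n S d) {O : Set M} (hO : IsOpen O)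
    (himg : p.toFun '' p.dom = S ∩ O) {π : M → EuclideanSpace ℝ (Fin d)}
    (hπ : ContMDiffOn (𝓡 n) (𝓡 d) 1 π O) (hπp : ∀ y ∈ p.dom, π (p.toFun y) = y)
    {A : Set M} (hA : MeasurableSet A) (hAO : A ⊆ O) :
    riemannianVolumeOn g S d A = p.measure g A := by
  apply le_antisymm
  -- The supremum is taken in the lattice of measures, so it has to be bounded by a measure on all
  -- of `M`; outside of `O` this bound is made trivial.
  · have h : riemannianVolumeOn g S d ≤ p.measure g + (⊤ : Measure M).restrict Oᶜ := by
      apply iSup_le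
      intro q
      rw [Measure.le_iff]
      intro B hB
      rw [← measure_inter_add_sdiff B hO.measurableSet, Measure.add_apply]
      refine add_le_add ?_ ?_
      · exact (p.measure_le_measure g q hO himg hπ hπp (hB.inter hO.measurableSet)
          inter_subset_right).trans (measure_mono inter_subset_left)
      · rw [Measure.restrict_apply hB]
        exact le_top (a := q.measure g) (B \ O)
    refine (h A).trans ?_
    rw [Measure.add_apply, Measure.restrict_apply hA]
    have : A ∩ Oᶜ = ∅ := by
      rw [← disjoint_iff_inter_eq_empty]; exact disjoint_compl_right_iff_subset.mpr hAO
    simp [this]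
  · exact le_iSup (fun p : LocalParam n S d => p.measure g) p A

theorem riemannianVolumeOn_compl (S : Set M) (d : ℕ) (hS : MeasurableSet S) :
    riemannianVolumeOn g S d Sᶜ = 0 := by
  have h : riemannianVolumeOn g S d ≤ (⊤ : Measure M).restrict S := by
    apply iSup_le
    intro q
    rw [Measure.le_iff]
    intro B hB
    rw [← measure_inter_add_sdiff B hS, Measure.restrict_apply hB]
    have : q.measure g (B \ S) = 0 := by
      rw [q.measure_apply g (hB.diff hS)]
      have : q.toFun ⁻¹' (B \ S) ∩ q.dom = ∅ := by
        ext x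
        simp only [mem_inter_iff, mem_preimage, Set.mem_sdiff, mem_empty_iff_false, iff_false]
        rintro ⟨⟨-, h⟩, hx⟩
        exact h (q.mapsTo hx)
      rw [this, setLIntegral_empty]
    rw [this, add_zero]
    exact le_top (a := q.measure g) _
  refine le_antisymm ((h Sᶜ).trans ?_) bot_le
  rw [Measure.restrict_apply hS.compl]
  simp

end Params

end Averaging

namespace Averaging

/-! ### Charts in which `h` is a projection -/

section Charts

variable {n m d : ℕ} {M : Type*} [TopologicalSpace M] [ChartedSpace (EuclideanSpace ℝ (Fin n)) M]

/-- A `C²` chart in which `h` is the projection to the first factor. -/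
structure AdaptedChart (n d : ℕ) {m : ℕ} {M : Type*} [TopologicalSpace M]
    [ChartedSpace (EuclideanSpace ℝ (Fin n)) M] (h : M → EuclideanSpace ℝ (Fin m)) where
  chart : OpenPartialHomeomorph M (EuclideanSpace ℝ (Fin m) × EuclideanSpace ℝ (Fin d))
  contMDiffOn : ContMDiffOn (𝓡 n) 𝓘(ℝ, EuclideanSpace ℝ (Fin m) × EuclideanSpace ℝ (Fin d)) 2
    chart chart.source
  contMDiffOn_symm : ContMDiffOn 𝓘(ℝ, EuclideanSpace ℝ (Fin m) × EuclideanSpace ℝ (Fin d)) (𝓡 n) 2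
    chart.symm chart.target
  fst_apply : ∀ x ∈ chart.source, (chart x).1 = h x

/-- `A` is the projection onto `ker L` along the image of a right inverse of `L`, followed by an
identification of the kernel with `ℝᵈ`. -/
theorem exists_equiv_prod_of_surjective {m d n : ℕ} (hmd : m + d = n)
    (L : EuclideanSpace ℝ (Fin n) →L[ℝ] EuclideanSpace ℝ (Fin m)) (hL : Function.Surjective L) :
    ∃ (A : EuclideanSpace ℝ (Fin n) →L[ℝ] EuclideanSpace ℝ (Fin d))
      (e : EuclideanSpace ℝ (Fin n) ≃L[ℝ] EuclideanSpace ℝ (Fin m) × EuclideanSpace ℝ (Fin d)),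
      (e : EuclideanSpace ℝ (Fin n) →L[ℝ] _) = L.prod A := by
  obtain ⟨s, hs⟩ := L.toLinearMap.exists_rightInverse_of_surjective
    (LinearMap.range_eq_top.mpr hL)
  have hs' : ∀ y, L (s y) = y := fun y => LinearMap.congr_fun hs y
  have hfin : Module.finrank ℝ (LinearMap.ker L.toLinearMap) = Module.finrank ℝ
      (EuclideanSpace ℝ (Fin d)) := by
    have h1 := LinearMap.finrank_range_add_finrank_ker L.toLinearMap
    rw [LinearMap.range_eq_top.mpr hL, finrank_top] at h1
    simp only [finrank_euclideanSpace, Fintype.card_fin] at h1 ⊢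
    omega
  let i := LinearEquiv.ofFinrankEq _ _ hfin
  let P : EuclideanSpace ℝ (Fin n) →ₗ[ℝ] LinearMap.ker L.toLinearMap :=
    (LinearMap.id - s ∘ₗ L.toLinearMap).codRestrict _ (by
      intro x
      simp [hs'])
  let A := LinearMap.toContinuousLinearMap (i.toLinearMap ∘ₗ P)
  have hinj : Function.Injective (L.prod A) := by
    rw [injective_iff_map_eq_zero]
    intro x hx
    have h1 : L x = 0 := congrArg Prod.fst hx
    have h2 : i (P x) = 0 := congrArg Prod.snd hx
    have h3 : P x = 0 := by simpa using h2
    have h4 : x - s (L x) = 0 := congrArg Subtype.val h3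
    simpa [h1] using h4
  have hfr : Module.finrank ℝ (EuclideanSpace ℝ (Fin n)) = Module.finrank ℝ
      (EuclideanSpace ℝ (Fin m) × EuclideanSpace ℝ (Fin d)) := by
    simp [hmd]
  refine ⟨A, (LinearEquiv.ofInjectiveOfFinrankEq (L.prod A).toLinearMap hinj hfr
    ).toContinuousLinearEquiv, ?_⟩
  ext x <;> rfl

/-- The submersion theorem: the inverse function theorem is applied to `h`, read in a chart and
completed by linear coordinates on the kernel of its derivative. -/
theorem exists_adaptedChart [IsManifold (𝓡 n) ∞ M] (hmd : m + d = n)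
    {h : M → EuclideanSpace ℝ (Fin m)}
    (hh : ContMDiff (𝓡 n) (𝓡 m) 2 h) (x₀ : M)
    (hsurj : Function.Surjective (mfderiv (𝓡 n) (𝓡 m) h x₀)) :
    ∃ Ψ : AdaptedChart n d h, x₀ ∈ Ψ.chart.source := by
  have : IsManifold (𝓡 n) 2 M := IsManifold.of_le (n := ∞) (by norm_cast)
  set e := chartAt (EuclideanSpace ℝ (Fin n)) x₀ with he
  have hx₀ : x₀ ∈ e.source := mem_chart_source _ x₀
  have hes : ContMDiffOn (𝓡 n) (𝓡 n) 2 e e.source := contMDiffOn_chart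
  have hes' : ContMDiffOn (𝓡 n) (𝓡 n) 2 e.symm e.target := contMDiffOn_chart_symm
  set f : EuclideanSpace ℝ (Fin n) → EuclideanSpace ℝ (Fin m) := h ∘ e.symm with hf
  have hfc : ContDiffOn ℝ 2 f e.target := by
    rw [← contMDiffOn_iff_contDiffOn]
    exact hh.comp_contMDiffOn hes'
  have hu₀ : e x₀ ∈ e.target := e.map_source hx₀
  have hfat : ContDiffAt ℝ 2 f (e x₀) := hfc.contDiffAt (e.open_target.mem_nhds hu₀)
  have hderiv : fderiv ℝ f (e x₀) = mfderiv (𝓡 n) (𝓡 m) h x₀ := by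
    refine Eq.trans ?_ (hh.mdifferentiable (by norm_num) x₀).mfderiv.symm
    simp only [mfld_simps, fderivWithin_univ]
    rfl
  have hsurj' : Function.Surjective (fderiv ℝ f (e x₀)) := by rw [hderiv]; exact hsurj
  obtain ⟨A, L, hL⟩ := exists_equiv_prod_of_surjective hmd _ hsurj'
  set F : EuclideanSpace ℝ (Fin n) → EuclideanSpace ℝ (Fin m) × EuclideanSpace ℝ (Fin d) :=
    fun x => (f x, A x) with hF
  have hFat : ContDiffAt ℝ 2 F (e x₀) := hfat.prodMk A.contDiff.contDiffAt
  have hFd : HasFDerivAt F (L : EuclideanSpace ℝ (Fin n) →L[ℝ] _) (e x₀) := by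
    rw [hL]
    exact (hfat.differentiableAt (by norm_num)).hasFDerivAt.prodMk A.hasFDerivAt
  set P := hFat.toOpenPartialHomeomorph F hFd (by norm_num) with hP
  have hPF : ∀ x, P x = F x := fun x => rfl
  have hPu : e x₀ ∈ P.source := hFat.mem_toOpenPartialHomeomorph_source hFd (by norm_num)
  have hinv : ContDiffAt ℝ 2 P.symm (F (e x₀)) := hFat.to_localInverse hFd (by norm_num)
  -- The inverse function theorem gives `C²` regularity of the inverse at the one image point only.
  -- It then holds nearby, and the target is cut down to such a neighbourhood, by restricting the
  -- source of the inverse.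
  set T := interior {v | ContDiffAt ℝ 2 P.symm v}
  have hT : F (e x₀) ∈ T := mem_interior_iff_mem_nhds.mpr (hinv.eventually (by norm_num))
  set P' := P.restrOpen e.target e.open_target
  set Q := (P'.symm.restrOpen T isOpen_interior).symm with hQ
  have hQs : Q.target = P'.target ∩ T := by
    simp [hQ]
  have hQsrc : Q.source = P'.source ∩ P' ⁻¹' T := by
    rw [← Q.symm_target, hQ, OpenPartialHomeomorph.symm_symm]
    have := (P'.symm.restrOpen T isOpen_interior).image_source_eq_target
    rw [OpenPartialHomeomorph.restrOpen_source] at this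
    rw [← this]
    ext x
    constructor
    · rintro ⟨v, ⟨hv, hvT⟩, rfl⟩
      refine ⟨P'.map_target hv, ?_⟩
      have : P' (P'.symm v) = v := P'.right_inv hv
      change P' (P'.symm v) ∈ T
      rw [this]; exact hvT
    · rintro ⟨hx, hxT⟩
      exact ⟨P' x, ⟨P'.map_source hx, hxT⟩, P'.left_inv hx⟩
  have hP's : P'.source = P.source ∩ e.target := P.restrOpen_source _ _
  refine ⟨⟨e.trans Q, ?_, ?_, ?_⟩, ?_⟩
  · have h1 : ContMDiffOn (𝓡 n) 𝓘(ℝ, EuclideanSpace ℝ (Fin m) × EuclideanSpace ℝ (Fin d)) 2 F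
        e.target := contMDiffOn_iff_contDiffOn.mpr (hfc.prodMk A.contDiff.contDiffOn)
    refine h1.comp (hes.mono ?_) ?_
    · intro x hx; rw [OpenPartialHomeomorph.trans_source] at hx; exact hx.1
    · intro x hx; rw [OpenPartialHomeomorph.trans_source] at hx; exact e.map_source hx.1
  · have h1 : ContMDiffOn 𝓘(ℝ, EuclideanSpace ℝ (Fin m) × EuclideanSpace ℝ (Fin d)) (𝓡 n) 2 P.symm
        T := contMDiffOn_iff_contDiffOn.mpr fun v hv => by
          have := interior_subset hv
          exact ContDiffAt.contDiffWithinAt this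
    refine hes'.comp (h1.mono ?_) ?_
    · intro v hv
      rw [OpenPartialHomeomorph.trans_target] at hv
      have := hv.1
      rw [hQs] at this
      exact this.2
    · intro v hv
      rw [OpenPartialHomeomorph.trans_target] at hv
      exact hv.2
  · intro x hx
    rw [OpenPartialHomeomorph.trans_source] at hx
    change h (e.symm (e x)) = h x
    rw [e.left_inv hx.1]
  · rw [OpenPartialHomeomorph.trans_source, hQsrc, hP's]
    exact ⟨hx₀, ⟨hPu, hu₀⟩, hT⟩

end Charts

end Averaging

namespace Averaging

/-! ### Volume elements of the level sets in adapted charts -/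

section TangentMaps

/-- The image of a `C¹` family of tangent vectors under the derivative of a `C²` map is `C¹`. -/
theorem contMDiffOn_mfderiv_apply {E₁ : Type*} [NormedAddCommGroup E₁] [NormedSpace ℝ E₁]
    {H₁ : Type*} [TopologicalSpace H₁] {I₁ : ModelWithCorners ℝ E₁ H₁}
    {N₁ : Type*} [TopologicalSpace N₁] [ChartedSpace H₁ N₁] [IsManifold I₁ 1 N₁]
    {E₂ : Type*} [NormedAddCommGroup E₂] [NormedSpace ℝ E₂]
    {H₂ : Type*} [TopologicalSpace H₂] {I₂ : ModelWithCorners ℝ E₂ H₂}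
    {N₂ : Type*} [TopologicalSpace N₂] [ChartedSpace H₂ N₂] [IsManifold I₂ 1 N₂]
    {E₃ : Type*} [NormedAddCommGroup E₃] [NormedSpace ℝ E₃]
    {H₃ : Type*} [TopologicalSpace H₃] {I₃ : ModelWithCorners ℝ E₃ H₃}
    {N₃ : Type*} [TopologicalSpace N₃] [ChartedSpace H₃ N₃]
    {f : N₁ → N₂} {O : Set N₁} (hO : IsOpen O) (hf : ContMDiffOn I₁ I₂ 2 f O)
    {b : N₃ → N₁} {W : (p : N₃) → TangentSpace I₁ (b p)} {s : Set N₃} (hb : MapsTo b s O)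
    (hW : ContMDiffOn I₃ I₁.tangent 1 (fun p => (⟨b p, W p⟩ : TangentBundle I₁ N₁)) s) :
    ContMDiffOn I₃ I₂.tangent 1
      (fun p => (⟨f (b p), mfderiv I₁ I₂ f (b p) (W p)⟩ : TangentBundle I₂ N₂)) s := by
  have h1 := hf.contMDiffOn_tangentMapWithin (m := 1) (by norm_num) hO.uniqueMDiffOn
  refine (h1.comp hW (fun p hp => hb hp)).congr ?_
  intro p hp
  simp only [Function.comp_apply, tangentMapWithin]
  rw [mfderivWithin_of_isOpen hO (hb hp)]

/-- The same in the case of a map with values in a normed space. -/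
theorem contMDiffOn_mfderiv_apply_vectorSpace {E₁ : Type*} [NormedAddCommGroup E₁]
    [NormedSpace ℝ E₁]
    {H₁ : Type*} [TopologicalSpace H₁] {I₁ : ModelWithCorners ℝ E₁ H₁}
    {N₁ : Type*} [TopologicalSpace N₁] [ChartedSpace H₁ N₁] [IsManifold I₁ 1 N₁]
    {F : Type*} [NormedAddCommGroup F] [NormedSpace ℝ F]
    {E₃ : Type*} [NormedAddCommGroup E₃] [NormedSpace ℝ E₃]
    {H₃ : Type*} [TopologicalSpace H₃] {I₃ : ModelWithCorners ℝ E₃ H₃}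
    {N₃ : Type*} [TopologicalSpace N₃] [ChartedSpace H₃ N₃]
    {f : N₁ → F} {O : Set N₁} (hO : IsOpen O) (hf : ContMDiffOn I₁ 𝓘(ℝ, F) 2 f O)
    {b : N₃ → N₁} {W : (p : N₃) → TangentSpace I₁ (b p)} {s : Set N₃} (hb : MapsTo b s O)
    (hW : ContMDiffOn I₃ I₁.tangent 1 (fun p => (⟨b p, W p⟩ : TangentBundle I₁ N₁)) s) :
    ContMDiffOn I₃ 𝓘(ℝ, F) 1 (fun p => (mfderiv I₁ 𝓘(ℝ, F) f (b p) (W p) : F)) s :=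
  (contMDiff_snd_tangentBundle_modelSpace F 𝓘(ℝ, F)).comp_contMDiffOn
    (contMDiffOn_mfderiv_apply hO hf hb hW)

end TangentMaps

section Slices

variable {n m d : ℕ} {M : Type*} [TopologicalSpace M] [ChartedSpace (EuclideanSpace ℝ (Fin n)) M]
  {h : M → EuclideanSpace ℝ (Fin m)}

namespace AdaptedChart

theorem mdifferentiableAt_symm (Ψ : AdaptedChart n d h)
    {u : EuclideanSpace ℝ (Fin m) × EuclideanSpace ℝ (Fin d)} (hu : u ∈ Ψ.chart.target) :
    MDifferentiableAt 𝓘(ℝ, EuclideanSpace ℝ (Fin m) × EuclideanSpace ℝ (Fin d)) (𝓡 n)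
      Ψ.chart.symm u :=
  (Ψ.contMDiffOn_symm.contMDiffAt (Ψ.chart.open_target.mem_nhds hu)).mdifferentiableAt (by norm_num)

theorem mdifferentiableAt (Ψ : AdaptedChart n d h) {x : M} (hx : x ∈ Ψ.chart.source) :
    MDifferentiableAt (𝓡 n) 𝓘(ℝ, EuclideanSpace ℝ (Fin m) × EuclideanSpace ℝ (Fin d))
      Ψ.chart x :=
  (Ψ.contMDiffOn.contMDiffAt (Ψ.chart.open_source.mem_nhds hx)).mdifferentiableAt (by norm_num)

theorem h_symm (Ψ : AdaptedChart n d h)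
    {u : EuclideanSpace ℝ (Fin m) × EuclideanSpace ℝ (Fin d)} (hu : u ∈ Ψ.chart.target) :
    h (Ψ.chart.symm u) = u.1 := by
  rw [← Ψ.fst_apply _ (Ψ.chart.map_target hu), Ψ.chart.right_inv hu]

theorem mfderiv_mfderiv_symm (Ψ : AdaptedChart n d h)
    {u : EuclideanSpace ℝ (Fin m) × EuclideanSpace ℝ (Fin d)} (hu : u ∈ Ψ.chart.target)
    (v : EuclideanSpace ℝ (Fin m) × EuclideanSpace ℝ (Fin d)) :
    (mfderiv (𝓡 n) 𝓘(ℝ, EuclideanSpace ℝ (Fin m) × EuclideanSpace ℝ (Fin d)) Ψ.chart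
      (Ψ.chart.symm u) (mfderiv 𝓘(ℝ, EuclideanSpace ℝ (Fin m) × EuclideanSpace ℝ (Fin d)) (𝓡 n)
      Ψ.chart.symm u v) : EuclideanSpace ℝ (Fin m) × EuclideanSpace ℝ (Fin d)) = v := by
  let L : EuclideanSpace ℝ (Fin m) × EuclideanSpace ℝ (Fin d) →L[ℝ]
      EuclideanSpace ℝ (Fin m) × EuclideanSpace ℝ (Fin d) :=
    (mfderiv (𝓡 n) 𝓘(ℝ, EuclideanSpace ℝ (Fin m) × EuclideanSpace ℝ (Fin d)) Ψ.chart
      (Ψ.chart.symm u)).comp (mfderiv 𝓘(ℝ, EuclideanSpace ℝ (Fin m) × EuclideanSpace ℝ (Fin d))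
      (𝓡 n) Ψ.chart.symm u)
  have h1 : HasFDerivAt (Ψ.chart ∘ Ψ.chart.symm) L u :=
    (HasMFDerivAt.comp u (Ψ.mdifferentiableAt (Ψ.chart.map_target hu)).hasMFDerivAt
    (Ψ.mdifferentiableAt_symm hu).hasMFDerivAt).hasFDerivAt
  have h2 : HasFDerivAt (Ψ.chart ∘ Ψ.chart.symm) (ContinuousLinearMap.id ℝ
      (EuclideanSpace ℝ (Fin m) × EuclideanSpace ℝ (Fin d))) u := by
    refine (hasFDerivAt_id u).congr_of_eventuallyEq ?_
    filter_upwards [Ψ.chart.open_target.mem_nhds hu] with v hv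
    exact Ψ.chart.right_inv hv
  exact DFunLike.congr_fun (h1.unique h2) v

theorem injective_mfderiv_symm (Ψ : AdaptedChart n d h)
    {u : EuclideanSpace ℝ (Fin m) × EuclideanSpace ℝ (Fin d)} (hu : u ∈ Ψ.chart.target) :
    Function.Injective (mfderiv 𝓘(ℝ, EuclideanSpace ℝ (Fin m) × EuclideanSpace ℝ (Fin d)) (𝓡 n)
      Ψ.chart.symm u) := by
  intro v w hvw
  have h3 := Ψ.mfderiv_mfderiv_symm hu v
  rw [hvw] at h3
  exact h3.symm.trans (Ψ.mfderiv_mfderiv_symm hu w)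

theorem mfderiv_slice (Ψ : AdaptedChart n d h) {c : EuclideanSpace ℝ (Fin m)}
    {y : EuclideanSpace ℝ (Fin d)} (hy : (c, y) ∈ Ψ.chart.target) :
    mfderiv (𝓡 d) (𝓡 n) (fun y => Ψ.chart.symm (c, y)) y
      = (mfderiv 𝓘(ℝ, EuclideanSpace ℝ (Fin m) × EuclideanSpace ℝ (Fin d)) (𝓡 n)
          Ψ.chart.symm (c, y)).comp
        (ContinuousLinearMap.inr ℝ (EuclideanSpace ℝ (Fin m)) (EuclideanSpace ℝ (Fin d))) := by
  have hd : HasFDerivAt (fun y : EuclideanSpace ℝ (Fin d) => (c, y))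
      (ContinuousLinearMap.inr ℝ (EuclideanSpace ℝ (Fin m)) (EuclideanSpace ℝ (Fin d))) y :=
    hasFDerivAt_prodMk_right c y
  have h1 := HasMFDerivAt.comp y (Ψ.mdifferentiableAt_symm hy).hasMFDerivAt hd.hasMFDerivAt
  exact h1.mfderiv

/-- The part of a level set of `h` that lies in an adapted chart. -/
noncomputable def slice (Ψ : AdaptedChart n d h) (c : EuclideanSpace ℝ (Fin m)) :
    LocalParam n (h ⁻¹' {c}) d where
  dom := {y | (c, y) ∈ Ψ.chart.target}
  toFun y := Ψ.chart.symm (c, y)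
  isOpen_dom := Ψ.chart.open_target.preimage (by fun_prop)
  contMDiffOn := by
    refine (Ψ.contMDiffOn_symm.of_le (by norm_num)).comp (t := Ψ.chart.target)
      (f := fun y => (c, y)) ?_ (fun y hy => hy)
    exact ((contDiff_const.prodMk contDiff_id).contMDiff).contMDiffOn
  injOn := by
    intro y hy z hz hyz
    have := Ψ.chart.symm.injOn hy hz hyz
    exact congrArg Prod.snd this
  immersion := by
    intro y hy
    rw [Ψ.mfderiv_slice hy]
    exact (Ψ.injective_mfderiv_symm hy).comp fun v w hvw => congrArg Prod.snd hvw
  mapsTo := by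
    intro y hy
    exact Ψ.h_symm hy

variable [IsManifold (𝓡 n) ∞ M]
  (g : Bundle.ContMDiffRiemannianMetric (𝓡 n) ∞ (EuclideanSpace ℝ (Fin n))
      (fun x : M => TangentSpace (𝓡 n) x))

/-- The volume element of the level sets of `h` in an adapted chart. -/
noncomputable def fiberElement (Ψ : AdaptedChart n d h)
    (u : EuclideanSpace ℝ (Fin m) × EuclideanSpace ℝ (Fin d)) : ℝ :=
  √ (gramDet g (Ψ.chart.symm u)
    ((mfderiv 𝓘(ℝ, EuclideanSpace ℝ (Fin m) × EuclideanSpace ℝ (Fin d)) (𝓡 n)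
          Ψ.chart.symm u).comp (ContinuousLinearMap.inr ℝ (EuclideanSpace ℝ (Fin m))
            (EuclideanSpace ℝ (Fin d)))).toLinearMap)

theorem volumeElement_slice (Ψ : AdaptedChart n d h) {c : EuclideanSpace ℝ (Fin m)}
    {y : EuclideanSpace ℝ (Fin d)} (hy : (c, y) ∈ Ψ.chart.target) :
    (Ψ.slice c).volumeElement g y = Ψ.fiberElement g (c, y) := by
  rw [LocalParam.volumeElement_eq]
  unfold fiberElement
  congr 2
  exact congrArg ContinuousLinearMap.toLinearMap (Ψ.mfderiv_slice hy)

theorem gramDet_pos (Ψ : AdaptedChart n d h)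
    {u : EuclideanSpace ℝ (Fin m) × EuclideanSpace ℝ (Fin d)} (hu : u ∈ Ψ.chart.target) :
    0 < gramDet g (Ψ.chart.symm u)
    ((mfderiv 𝓘(ℝ, EuclideanSpace ℝ (Fin m) × EuclideanSpace ℝ (Fin d)) (𝓡 n)
          Ψ.chart.symm u).comp (ContinuousLinearMap.inr ℝ (EuclideanSpace ℝ (Fin m))
            (EuclideanSpace ℝ (Fin d)))).toLinearMap := by
  apply Averaging.gramDet_pos
  exact (Ψ.injective_mfderiv_symm hu).comp fun v w hvw => congrArg Prod.snd hvw

theorem fiberElement_pos (Ψ : AdaptedChart n d h)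
    {u : EuclideanSpace ℝ (Fin m) × EuclideanSpace ℝ (Fin d)} (hu : u ∈ Ψ.chart.target) :
    0 < Ψ.fiberElement g u :=
  Real.sqrt_pos.mpr (Ψ.gramDet_pos g hu)

/-- One derivative of the `C²` inverse chart is spent, so constant vectors are carried to `C¹`
families of tangent vectors, and the smooth metric is evaluated on these. -/
theorem contDiffOn_metric (Ψ : AdaptedChart n d h)
    (v w : EuclideanSpace ℝ (Fin m) × EuclideanSpace ℝ (Fin d)) :
    ContDiffOn ℝ 1 (fun u => g.inner (Ψ.chart.symm u)
      (mfderiv 𝓘(ℝ, EuclideanSpace ℝ (Fin m) × EuclideanSpace ℝ (Fin d)) (𝓡 n)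
          Ψ.chart.symm u v)
      (mfderiv 𝓘(ℝ, EuclideanSpace ℝ (Fin m) × EuclideanSpace ℝ (Fin d)) (𝓡 n)
          Ψ.chart.symm u w)) Ψ.chart.target := by
  have : IsManifold (𝓡 n) 1 M := IsManifold.of_le (n := ∞) (by norm_cast)
  have hconst : ∀ v : EuclideanSpace ℝ (Fin m) × EuclideanSpace ℝ (Fin d),
      ContMDiffOn 𝓘(ℝ, EuclideanSpace ℝ (Fin m) × EuclideanSpace ℝ (Fin d))
      (𝓡 n).tangent 1 (fun u => (⟨Ψ.chart.symm u,
        mfderiv 𝓘(ℝ, EuclideanSpace ℝ (Fin m) × EuclideanSpace ℝ (Fin d)) (𝓡 n)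
          Ψ.chart.symm u v⟩ : TangentBundle (𝓡 n) M)) Ψ.chart.target := by
    intro v
    refine contMDiffOn_mfderiv_apply Ψ.chart.open_target Ψ.contMDiffOn_symm (b := id)
      (W := fun _ => v) (mapsTo_id _) ?_
    exact contMDiffOn_vectorSpace_iff_contDiffOn.mpr contDiffOn_const
  have hg : ContMDiffOn 𝓘(ℝ, EuclideanSpace ℝ (Fin m) × EuclideanSpace ℝ (Fin d))
      ((𝓡 n).prod 𝓘(ℝ, EuclideanSpace ℝ (Fin n) →L[ℝ] EuclideanSpace ℝ (Fin n) →L[ℝ] ℝ)) 1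
      (fun u => Bundle.TotalSpace.mk'
        (EuclideanSpace ℝ (Fin n) →L[ℝ] EuclideanSpace ℝ (Fin n) →L[ℝ] ℝ)
        (E := fun x : M => TangentSpace (𝓡 n) x →L[ℝ] TangentSpace (𝓡 n) x →L[ℝ] ℝ)
        (Ψ.chart.symm u) (g.inner (Ψ.chart.symm u))) Ψ.chart.target :=
    (g.contMDiff.of_le (by norm_cast)).comp_contMDiffOn
      (Ψ.contMDiffOn_symm.of_le (by norm_num))
  have := ContMDiffOn.clm_bundle_apply₂ (F₁ := EuclideanSpace ℝ (Fin n))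
    (F₂ := EuclideanSpace ℝ (Fin n)) (F₃ := ℝ) (E₃ := Bundle.Trivial M ℝ)
    hg (hconst v) (hconst w)
  rw [← contMDiffOn_iff_contDiffOn]
  intro u hu
  have h2 := this u hu
  simp only [Bundle.contMDiffWithinAt_totalSpace] at h2
  exact h2.2

/-- The determinant is a polynomial in `C¹` entries, and it is positive, so its square root is `C¹`
as well. -/
theorem contDiffOn_fiberElement (Ψ : AdaptedChart n d h) :
    ContDiffOn ℝ 1 (Ψ.fiberElement g) Ψ.chart.target := by
  have h1 : ContDiffOn ℝ 1 (fun u => gramDet g (Ψ.chart.symm u)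
    ((mfderiv 𝓘(ℝ, EuclideanSpace ℝ (Fin m) × EuclideanSpace ℝ (Fin d)) (𝓡 n)
          Ψ.chart.symm u).comp (ContinuousLinearMap.inr ℝ (EuclideanSpace ℝ (Fin m))
            (EuclideanSpace ℝ (Fin d)))).toLinearMap) Ψ.chart.target := by
    unfold gramDet
    simp only [Matrix.det_apply']
    refine ContDiffOn.sum fun σ _ => contDiffOn_const.mul (contDiffOn_prod fun i _ => ?_)
    exact Ψ.contDiffOn_metric g _ _
  intro u hu
  exact (h1 u hu).sqrt (Ψ.gramDet_pos g hu).ne'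

end AdaptedChart

end Slices

end Averaging

namespace Averaging

abbrev Euc (d : ℕ) := EuclideanSpace ℝ (Fin d)

/-! ### The measures on the level sets in adapted charts -/

section FiberMeasure

variable {n m : ℕ} {M : Type*} [TopologicalSpace M] [ChartedSpace (EuclideanSpace ℝ (Fin n)) M]
  [IsManifold (𝓡 n) ∞ M] [MeasurableSpace M] [BorelSpace M]
  (g : Bundle.ContMDiffRiemannianMetric (𝓡 n) ∞ (EuclideanSpace ℝ (Fin n))
      (fun x : M => TangentSpace (𝓡 n) x))
  {h : M → EuclideanSpace ℝ (Fin m)}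

/-- The density of the fiber measures in an adapted chart. -/
noncomputable def AdaptedChart.fiberDensity {d : ℕ} (Ψ : AdaptedChart n d h) (ρ : M → ℝ)
    (u : Euc m × Euc d) : ℝ :=
  ρ (Ψ.chart.symm u) * Ψ.fiberElement g u

omit [MeasurableSpace M] [BorelSpace M] in
theorem AdaptedChart.fiberDensity_pos {d : ℕ} (Ψ : AdaptedChart n d h) {ρ : M → ℝ}
    (hρ : ∀ x, 0 < ρ x) {u : Euc m × Euc d} (hu : u ∈ Ψ.chart.target) :
    0 < Ψ.fiberDensity g ρ u :=
  mul_pos (hρ _) (Ψ.fiberElement_pos g hu)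

omit [MeasurableSpace M] [BorelSpace M] in
theorem AdaptedChart.contDiffOn_fiberDensity {d : ℕ} (Ψ : AdaptedChart n d h) {ρ : M → ℝ}
    (hρ : ContMDiff (𝓡 n) 𝓘(ℝ, ℝ) 1 ρ) :
    ContDiffOn ℝ 1 (Ψ.fiberDensity g ρ) Ψ.chart.target := by
  refine ContDiffOn.mul ?_ (Ψ.contDiffOn_fiberElement g)
  exact contMDiffOn_iff_contDiffOn.mp
    (hρ.comp_contMDiffOn (Ψ.contMDiffOn_symm.of_le (by norm_num)))

theorem riemannianVolumeOn_slice {d : ℕ} (Ψ : AdaptedChart n d h) (c : Euc m)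
    {A : Set M} (hA : MeasurableSet A) (hAO : A ⊆ Ψ.chart.source) :
    riemannianVolumeOn g (h ⁻¹' {c}) d A = (Ψ.slice c).measure g A := by
  refine riemannianVolumeOn_apply g (Ψ.slice c) Ψ.chart.open_source ?_
    (π := fun x => (Ψ.chart x).2) ?_ ?_ hA hAO
  · ext x
    constructor
    · rintro ⟨y, hy, rfl⟩
      exact ⟨(Ψ.slice c).mapsTo hy, Ψ.chart.map_target hy⟩
    · rintro ⟨hx, hxs⟩
      have h1 : (c, (Ψ.chart x).2) = Ψ.chart x := by
        rw [← show h x = c from hx, ← Ψ.fst_apply x hxs]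
      refine ⟨(Ψ.chart x).2, ?_, ?_⟩
      · change (c, (Ψ.chart x).2) ∈ Ψ.chart.target
        rw [h1]; exact Ψ.chart.map_source hxs
      · change Ψ.chart.symm (c, (Ψ.chart x).2) = x
        rw [h1, Ψ.chart.left_inv hxs]
  · exact (contDiff_snd.contMDiff).comp_contMDiffOn (Ψ.contMDiffOn.of_le (by norm_num))
  · intro y hy
    change (Ψ.chart (Ψ.chart.symm (c, y))).2 = y
    rw [Ψ.chart.right_inv hy]

/-- In one chart all fiber measures are given by the same density on the chart target, restricted to
the slices with fixed first coordinate. Regularity in `c` and Fubini arguments rest on this. -/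
theorem fiberMeasure_restrict (Ψ : AdaptedChart n (n - m) h) {ρ : M → ℝ} (hρc : Continuous ρ)
    (hρ : ∀ x, 0 < ρ x) (c : Euc m) :
    (fiberMeasure g h ρ c).restrict Ψ.chart.source
      = ((volume.restrict {y | (c, y) ∈ Ψ.chart.target}).withDensity
          (fun y => ENNReal.ofReal (Ψ.fiberDensity g ρ (c, y)))).map
        (fun y => Ψ.chart.symm (c, y)) := by
  have hdom : MeasurableSet {y | (c, y) ∈ Ψ.chart.target} := (Ψ.slice c).isOpen_dom.measurableSet
  have hcont : ContinuousOn (fun y => Ψ.chart.symm (c, y)) {y | (c, y) ∈ Ψ.chart.target} :=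
    (Ψ.slice c).contMDiffOn.continuousOn
  have hm : AEMeasurable (fun y => Ψ.chart.symm (c, y))
      (volume.restrict {y | (c, y) ∈ Ψ.chart.target}) := hcont.aemeasurable hdom
  have helt : ContinuousOn (fun y => Ψ.fiberElement g (c, y)) {y | (c, y) ∈ Ψ.chart.target} :=
    (Ψ.contDiffOn_fiberElement g).continuousOn.comp (by fun_prop) (fun y hy => hy)
  have hS := Ψ.chart.open_source.measurableSet
  have hρm : Measurable (fun x => ENNReal.ofReal (ρ x)) := hρc.measurable.ennreal_ofReal
  ext A hA
  rw [Measure.restrict_apply hA, fiberMeasure, withDensity_apply _ (hA.inter hS)]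
  have h1 : (riemannianVolumeOn g (h ⁻¹' {c}) (n - m)).restrict (A ∩ Ψ.chart.source)
      = ((Ψ.slice c).measure g).restrict (A ∩ Ψ.chart.source) := by
    ext B hB
    rw [Measure.restrict_apply hB, Measure.restrict_apply hB]
    exact riemannianVolumeOn_slice g Ψ c (hB.inter (hA.inter hS))
      (fun x hx => hx.2.2)
  have h2 : (Ψ.slice c).measure g = ((volume.restrict {y | (c, y) ∈ Ψ.chart.target}).withDensity
          (fun y => ENNReal.ofReal (Ψ.fiberElement g (c, y)))).map
        (fun y => Ψ.chart.symm (c, y)) := by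
    unfold LocalParam.measure
    congr 1
    apply withDensity_congr_ae
    refine (ae_restrict_mem hdom).mono fun y hy => ?_
    simp only [Ψ.volumeElement_slice g hy]
  rw [h1, h2, ← lintegral_indicator (hA.inter hS), lintegral_map'
    ((hρm.indicator (hA.inter hS)).aemeasurable)
    (hm.mono_ac (withDensity_absolutelyContinuous _ _)),
    Measure.map_apply_of_aemeasurable (hm.mono_ac (withDensity_absolutelyContinuous _ _)) hA,
    withDensity_apply']
  refine (lintegral_withDensity_eq_lintegral_mul₀ ((helt.aemeasurable hdom).ennreal_ofReal)
    (g := fun y => (A ∩ Ψ.chart.source).indicator (fun x => ENNReal.ofReal (ρ x))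
      (Ψ.chart.symm (c, y))) ((hρm.indicator (hA.inter hS)).comp_aemeasurable hm)).trans ?_
  have hpre : MeasurableSet ((fun y => Ψ.chart.symm (c, y)) ⁻¹' A ∩
    {y | (c, y) ∈ Ψ.chart.target}) := measurableSet_preimage_inter_of_continuousOn hcont hdom hA
  rw [Measure.restrict_restrict' hdom, ← lintegral_indicator hpre, ← lintegral_indicator hdom]
  apply lintegral_congr
  intro y
  by_cases hy : (c, y) ∈ Ψ.chart.target
  · by_cases hyA : Ψ.chart.symm (c, y) ∈ A
    · rw [indicator_of_mem (show y ∈ {y | (c, y) ∈ Ψ.chart.target} from hy),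
        indicator_of_mem (s := (fun y => Ψ.chart.symm (c, y)) ⁻¹' A ∩
          {y | (c, y) ∈ Ψ.chart.target}) ⟨hyA, hy⟩]
      simp only [Pi.mul_apply]
      rw [indicator_of_mem (s := A ∩ Ψ.chart.source) ⟨hyA, Ψ.chart.map_target hy⟩,
        AdaptedChart.fiberDensity, mul_comm, ENNReal.ofReal_mul (hρ _).le]
    · rw [indicator_of_mem (show y ∈ {y | (c, y) ∈ Ψ.chart.target} from hy),
        indicator_of_notMem (s := (fun y => Ψ.chart.symm (c, y)) ⁻¹' A ∩
          {y | (c, y) ∈ Ψ.chart.target}) (fun h => hyA h.1)]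
      simp only [Pi.mul_apply]
      rw [indicator_of_notMem (s := A ∩ Ψ.chart.source) (fun h => hyA h.1), mul_zero]
  · rw [indicator_of_notMem (s := {y | (c, y) ∈ Ψ.chart.target}) hy,
        indicator_of_notMem (s := (fun y => Ψ.chart.symm (c, y)) ⁻¹' A ∩
          {y | (c, y) ∈ Ψ.chart.target}) (fun h => hy h.2)]

theorem fiberMeasure_compl (hh : Continuous h) (ρ : M → ℝ) (c : Euc m) :
    fiberMeasure g h ρ c (h ⁻¹' {c})ᶜ = 0 := by
  have hS : MeasurableSet (h ⁻¹' {c}) := (isClosed_singleton.preimage hh).measurableSet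
  exact withDensity_absolutelyContinuous _ _ (riemannianVolumeOn_compl g _ _ hS)

omit [MeasurableSpace M] [BorelSpace M] in
/-- The fiber density, extended by zero outside of the chart and outside of a set. -/
theorem measurable_indicator_fiberDensity {d : ℕ} (Ψ : AdaptedChart n d h) {ρ : M → ℝ}
    (hρ : ContMDiff (𝓡 n) 𝓘(ℝ, ℝ) 1 ρ) :
    Measurable (Ψ.chart.target.indicator (fun u => ENNReal.ofReal (Ψ.fiberDensity g ρ u))) := by
  classical
  rw [← piecewise_eq_indicator]
  refine ContinuousOn.measurable_piecewise ?_ continuousOn_const Ψ.chart.open_target.measurableSet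
  exact ENNReal.continuous_ofReal.comp_continuousOn (Ψ.contDiffOn_fiberDensity g hρ).continuousOn

theorem fiberMeasure_apply (Ψ : AdaptedChart n (n - m) h) {ρ : M → ℝ}
    (hρc : ContMDiff (𝓡 n) 𝓘(ℝ, ℝ) 1 ρ)
    (hρ : ∀ x, 0 < ρ x) (c : Euc m) {A : Set M} (hA : MeasurableSet A)
    (hAO : A ⊆ Ψ.chart.source) :
    fiberMeasure g h ρ c A = ∫⁻ y, (Ψ.chart.symm ⁻¹' A ∩ Ψ.chart.target).indicator
      (fun u => ENNReal.ofReal (Ψ.fiberDensity g ρ u)) (c, y) := by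
  have hdom : MeasurableSet {y | (c, y) ∈ Ψ.chart.target} := (Ψ.slice c).isOpen_dom.measurableSet
  have hcont : ContinuousOn (fun y => Ψ.chart.symm (c, y)) {y | (c, y) ∈ Ψ.chart.target} :=
    (Ψ.slice c).contMDiffOn.continuousOn
  have hm : AEMeasurable (fun y => Ψ.chart.symm (c, y))
      (volume.restrict {y | (c, y) ∈ Ψ.chart.target}) := hcont.aemeasurable hdom
  have h1 : fiberMeasure g h ρ c A = (fiberMeasure g h ρ c).restrict Ψ.chart.source A := by
    rw [Measure.restrict_apply hA, inter_eq_self_of_subset_left hAO]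
  have hpre : MeasurableSet ((fun y => Ψ.chart.symm (c, y)) ⁻¹' A ∩
    {y | (c, y) ∈ Ψ.chart.target}) := measurableSet_preimage_inter_of_continuousOn hcont hdom hA
  rw [h1, fiberMeasure_restrict g Ψ hρc.continuous hρ c,
    Measure.map_apply_of_aemeasurable (hm.mono_ac (withDensity_absolutelyContinuous _ _)) hA,
    withDensity_apply', Measure.restrict_restrict' hdom, ← lintegral_indicator hpre]
  rfl

omit [IsManifold (𝓡 n) ∞ M] in
theorem measurableSet_symm_preimage {d : ℕ} (Ψ : AdaptedChart n d h) {A : Set M}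
    (hA : MeasurableSet A) : MeasurableSet (Ψ.chart.symm ⁻¹' A ∩ Ψ.chart.target) :=
  measurableSet_preimage_inter_of_continuousOn Ψ.contMDiffOn_symm.continuousOn
    Ψ.chart.open_target.measurableSet hA

theorem measurable_chart_indicator {d : ℕ} (Ψ : AdaptedChart n d h) {ρ : M → ℝ}
    (hρ : ContMDiff (𝓡 n) 𝓘(ℝ, ℝ) 1 ρ) {A : Set M} (hA : MeasurableSet A) :
    Measurable ((Ψ.chart.symm ⁻¹' A ∩ Ψ.chart.target).indicator
      (fun u => ENNReal.ofReal (Ψ.fiberDensity g ρ u))) := by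
  have := (measurable_indicator_fiberDensity g Ψ hρ).indicator (measurableSet_symm_preimage Ψ hA)
  rwa [indicator_indicator, inter_assoc, inter_self] at this

theorem measurable_fiberMeasure_apply_of_subset (Ψ : AdaptedChart n (n - m) h) {ρ : M → ℝ}
    (hρc : ContMDiff (𝓡 n) 𝓘(ℝ, ℝ) 1 ρ) (hρ : ∀ x, 0 < ρ x) {A : Set M} (hA : MeasurableSet A)
    (hAO : A ⊆ Ψ.chart.source) : Measurable (fun c => fiberMeasure g h ρ c A) := by
  simp only [fun c => fiberMeasure_apply g Ψ hρc hρ c hA hAO]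
  exact (measurable_chart_indicator g Ψ hρc hA).lintegral_prod_right'

/-- `M` is the disjoint union of countably many Borel sets that lie in adapted charts. -/
theorem exists_chart_partition [SecondCountableTopology M] {d : ℕ} (hmd : m + d = n)
    (hh : ContMDiff (𝓡 n) (𝓡 m) 2 h)
    (hindep : ∀ x : M, Function.Surjective (mfderiv (𝓡 n) (𝓡 m) h x)) [Nonempty M] :
    ∃ (Ψ : ℕ → AdaptedChart n d h) (P : ℕ → Set M), (∀ i, P i ⊆ (Ψ i).chart.source) ∧
      (∀ i, MeasurableSet (P i)) ∧ Pairwise (Function.onFun Disjoint P) ∧ ⋃ i, P i = univ := by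
  choose Ψ hΨ using fun x => exists_adaptedChart hmd hh x (hindep x)
  obtain ⟨s, hs, hsU⟩ := TopologicalSpace.countable_cover_nhds
    (fun x => (Ψ x).chart.open_source.mem_nhds (hΨ x))
  have hsne : s.Nonempty := by
    by_contra h0
    rw [not_nonempty_iff_eq_empty] at h0
    obtain ⟨x⟩ := ‹Nonempty M›
    have : x ∈ (univ : Set M) := mem_univ x
    rw [← hsU, h0] at this
    simp at this
  obtain ⟨f, hf⟩ := hs.exists_eq_range hsne
  refine ⟨fun i => Ψ (f i), disjointed fun i => (Ψ (f i)).chart.source,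
    fun i => disjointed_subset _ i,
    fun i => MeasurableSet.disjointed (fun i => (Ψ (f i)).chart.open_source.measurableSet) i,
    disjoint_disjointed _, ?_⟩
  rw [iUnion_disjointed, ← hsU, hf, biUnion_range]

omit [MeasurableSpace M] [BorelSpace M] in
omit [IsManifold (𝓡 n) ∞ M] in
theorem le_of_surjective_mfderiv
    (hindep : ∀ x : M, Function.Surjective (mfderiv (𝓡 n) (𝓡 m) h x)) [Nonempty M] : m ≤ n := by
  obtain ⟨x⟩ := ‹Nonempty M›
  let L : Euc n →L[ℝ] Euc m := mfderiv (𝓡 n) (𝓡 m) h x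
  have hL : Function.Surjective L.toLinearMap := hindep x
  simpa using LinearMap.finrank_le_finrank_of_surjective hL

/-- A countable partition into pieces of charts reduces this to measurability of partial integrals.
It makes the integral of the fiber measures over `c` meaningful. -/
theorem measurable_fiberMeasure [SecondCountableTopology M]
    (hh : ContMDiff (𝓡 n) (𝓡 m) 2 h)
    (hindep : ∀ x : M, Function.Surjective (mfderiv (𝓡 n) (𝓡 m) h x)) {ρ : M → ℝ}
    (hρc : ContMDiff (𝓡 n) 𝓘(ℝ, ℝ) 1 ρ) (hρ : ∀ x, 0 < ρ x) :
    Measurable (fun c => fiberMeasure g h ρ c) := by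
  rcases isEmpty_or_nonempty M with hM | hM
  · have : ∀ c, fiberMeasure g h ρ c = 0 := fun c => Measure.eq_zero_of_isEmpty _
    simp only [this]
    exact measurable_const
  have hmn := le_of_surjective_mfderiv hindep
  obtain ⟨Ψ, P, hPs, hPm, hPd, hPU⟩ := exists_chart_partition (d := n - m) (by omega) hh hindep
  refine Measure.measurable_of_measurable_coe _ fun A hA => ?_
  have : ∀ c, fiberMeasure g h ρ c A = ∑' i, fiberMeasure g h ρ c (A ∩ P i) := by
    intro c
    rw [← measure_iUnion, ← inter_iUnion, hPU, inter_univ]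
    · exact fun i j hij => (hPd hij).mono inter_subset_right inter_subset_right
    · exact fun i => hA.inter (hPm i)
  simp only [this]
  exact Measurable.tsum fun i => measurable_fiberMeasure_apply_of_subset g (Ψ i) hρc hρ
    (hA.inter (hPm i)) (inter_subset_right.trans (hPs i))

end FiberMeasure

end Averaging

namespace Averaging

/-! ### The integrated fiber measures and Riemannian volume -/

section TotalMeasure

variable {n m : ℕ} {M : Type*} [TopologicalSpace M] [ChartedSpace (EuclideanSpace ℝ (Fin n)) M]
  [IsManifold (𝓡 n) ∞ M] [MeasurableSpace M] [BorelSpace M]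
  (g : Bundle.ContMDiffRiemannianMetric (𝓡 n) ∞ (EuclideanSpace ℝ (Fin n))
      (fun x : M => TangentSpace (𝓡 n) x))
  {h : M → EuclideanSpace ℝ (Fin m)}

/-- The measure obtained by integrating the fiber measures over a set of values of `h`. -/
noncomputable def totalMeasure (h : M → EuclideanSpace ℝ (Fin m)) (ρ : M → ℝ) (U : Set (Euc m)) :
    Measure M :=
  (volume.restrict U).bind (fun c => fiberMeasure g h ρ c)

theorem totalMeasure_apply [SecondCountableTopology M]
    (hh : ContMDiff (𝓡 n) (𝓡 m) 2 h)
    (hindep : ∀ x : M, Function.Surjective (mfderiv (𝓡 n) (𝓡 m) h x)) {ρ : M → ℝ}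
    (hρc : ContMDiff (𝓡 n) 𝓘(ℝ, ℝ) 1 ρ) (hρ : ∀ x, 0 < ρ x) (U : Set (Euc m)) {A : Set M}
    (hA : MeasurableSet A) :
    totalMeasure g h ρ U A = ∫⁻ c in U, fiberMeasure g h ρ c A :=
  Measure.bind_apply hA (measurable_fiberMeasure g hh hindep hρc hρ).aemeasurable

/-- Fubini in a chart whose first coordinate is `h`. No coarea factor appears, because the fiber
measures are integrated against plain Lebesgue measure in `c`. -/
theorem totalMeasure_apply_chart [SecondCountableTopology M]
    (hh : ContMDiff (𝓡 n) (𝓡 m) 2 h)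
    (hindep : ∀ x : M, Function.Surjective (mfderiv (𝓡 n) (𝓡 m) h x)) {ρ : M → ℝ}
    (hρc : ContMDiff (𝓡 n) 𝓘(ℝ, ℝ) 1 ρ) (hρ : ∀ x, 0 < ρ x) {U : Set (Euc m)}
    (hU : MeasurableSet U)
    (Ψ : AdaptedChart n (n - m) h) {A : Set M}
    (hA : MeasurableSet A) (hAO : A ⊆ Ψ.chart.source) (hAU : A ⊆ h ⁻¹' U) :
    totalMeasure g h ρ U A = ∫⁻ u in Ψ.chart.symm ⁻¹' A ∩ Ψ.chart.target,
      ENNReal.ofReal (Ψ.fiberDensity g ρ u) := by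
  rw [totalMeasure_apply g hh hindep hρc hρ U hA, ← lintegral_indicator hU,
    ← lintegral_indicator (measurableSet_symm_preimage Ψ hA), Measure.volume_eq_prod,
    lintegral_prod _ (measurable_chart_indicator g Ψ hρc hA).aemeasurable]
  apply lintegral_congr
  intro c
  by_cases hc : c ∈ U
  · rw [indicator_of_mem hc, fiberMeasure_apply g Ψ hρc hρ c hA hAO]
  · rw [indicator_of_notMem hc, eq_comm, lintegral_eq_zero_iff]
    · refine ae_of_all _ fun y => indicator_of_notMem ?_ _
      rintro ⟨hy, hy'⟩
      apply hc
      have := hAU hy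
      rwa [mem_preimage, Ψ.h_symm hy'] at this
    · exact (measurable_chart_indicator g Ψ hρc hA).comp measurable_prodMk_left

namespace AdaptedChart

omit [IsManifold (𝓡 n) ∞ M] [MeasurableSpace M] [BorelSpace M] in
theorem mfderiv_symm_comp_equiv {d : ℕ} (Ψ : AdaptedChart n d h)
    (L : Euc n ≃L[ℝ] Euc m × Euc d) {x : Euc n} (hx : L x ∈ Ψ.chart.target) :
    mfderiv (𝓡 n) (𝓡 n) (fun x => Ψ.chart.symm (L x)) x
      = (mfderiv 𝓘(ℝ, Euc m × Euc d) (𝓡 n) Ψ.chart.symm (L x)).comp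
        (L : Euc n →L[ℝ] Euc m × Euc d) := by
  have hd : HasFDerivAt L (L : Euc n →L[ℝ] Euc m × Euc d) x := L.hasFDerivAt
  exact (HasMFDerivAt.comp x (Ψ.mdifferentiableAt_symm hx).hasMFDerivAt hd.hasMFDerivAt).mfderiv

/-- The local parametrization of `M` given by the inverse of an adapted chart. -/
noncomputable def param {d : ℕ} (Ψ : AdaptedChart n d h) (L : Euc n ≃L[ℝ] Euc m × Euc d) :
    LocalParam n (univ : Set M) n where
  dom := {x | L x ∈ Ψ.chart.target}
  toFun x := Ψ.chart.symm (L x)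
  isOpen_dom := Ψ.chart.open_target.preimage L.continuous
  contMDiffOn := by
    refine (Ψ.contMDiffOn_symm.of_le (by norm_num)).comp (t := Ψ.chart.target)
      (f := L) ?_ (fun y hy => hy)
    exact L.contDiff.contMDiff.contMDiffOn
  injOn := fun y hy z hz hyz => L.injective (Ψ.chart.symm.injOn hy hz hyz)
  immersion := by
    intro x hx
    rw [Ψ.mfderiv_symm_comp_equiv L hx]
    exact (Ψ.injective_mfderiv_symm hx).comp L.injective
  mapsTo := fun _ _ => mem_univ _

end AdaptedChart

/-- The volume element in the chart is continuous, hence bounded near `x₀`. A linear identification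
of `ℝⁿ` with the product changes Lebesgue measure by a constant factor, by uniqueness of Haar
measure. -/
theorem exists_riemannianVolume_le_chart {d : ℕ} (hmd : m + d = n) (Ψ : AdaptedChart n d h) {x₀ : M}
    (hx₀ : x₀ ∈ Ψ.chart.source) :
    ∃ W : Set M, IsOpen W ∧ x₀ ∈ W ∧ W ⊆ Ψ.chart.source ∧ ∃ C : ℝ≥0∞, C ≠ ⊤ ∧ ∀ A ⊆ W,
      MeasurableSet A → riemannianVolume g A ≤ C * volume (Ψ.chart.symm ⁻¹' A ∩ Ψ.chart.target) := by
  have hfr : Module.finrank ℝ (Euc n) = Module.finrank ℝ (Euc m × Euc d) := by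
    simp [hmd]
  let L : Euc n ≃L[ℝ] Euc m × Euc d := ContinuousLinearEquiv.ofFinrankEq hfr
  let D : Euc m × Euc d → ℝ := fun u => gramDet g (Ψ.chart.symm u)
    ((mfderiv 𝓘(ℝ, Euc m × Euc d) (𝓡 n) Ψ.chart.symm u).comp
        (L : Euc n →L[ℝ] Euc m × Euc d)).toLinearMap
  have hD : ContinuousOn D Ψ.chart.target := by
    have h1 : ContDiffOn ℝ 1 D Ψ.chart.target := by
      simp only [D, gramDet, Matrix.det_apply']
      refine ContDiffOn.sum fun σ _ => contDiffOn_const.mul (contDiffOn_prod fun i _ => ?_)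
      exact Ψ.contDiffOn_metric g (L (EuclideanSpace.single (σ i) 1)) (L (EuclideanSpace.single i 1))
    exact h1.continuousOn
  have hu₀ := Ψ.chart.map_source hx₀
  set B : ℝ := √ (D (Ψ.chart x₀)) + 1
  have hev : ∀ᶠ u in 𝓝 (Ψ.chart x₀), √ (D u) < B := by
    have : ContinuousAt (fun u => √ (D u)) (Ψ.chart x₀) :=
      Real.continuous_sqrt.continuousAt.comp
        (hD.continuousAt (Ψ.chart.open_target.mem_nhds hu₀))
    exact this.eventually_lt continuousAt_const (by simp [B])
  obtain ⟨T, hT, hTo, hu₀T⟩ := eventually_nhds_iff.mp hev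
  have : (volume : Measure (Euc m × Euc d)).IsAddHaarMeasure :=
    Measure.prod.instIsAddHaarMeasure volume volume
  have := L.isAddHaarMeasure_map (volume : Measure (Euc n))
  obtain ⟨c, hc, hcL⟩ : ∃ c : ℝ≥0∞, c ≠ ⊤ ∧
      (volume : Measure (Euc n)).map L = c • (volume : Measure (Euc m × Euc d)) :=
    ⟨_, ENNReal.coe_ne_top, Measure.isAddLeftInvariant_eq_smul _ _⟩
  refine ⟨Ψ.chart.source ∩ Ψ.chart ⁻¹' T, Ψ.chart.isOpen_inter_preimage hTo, ⟨hx₀, hu₀T⟩,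
    inter_subset_left, ENNReal.ofReal B * c, ENNReal.mul_ne_top ENNReal.ofReal_ne_top hc, ?_⟩
  intro A hAW hA
  have h1 : riemannianVolume g A = (Ψ.param L).measure g A := by
    refine riemannianVolumeOn_apply g (Ψ.param L) Ψ.chart.open_source ?_
      (π := fun x => L.symm (Ψ.chart x)) ?_ ?_ hA (hAW.trans inter_subset_left)
    · ext x
      rw [univ_inter]
      constructor
      · rintro ⟨y, hy, rfl⟩
        exact Ψ.chart.map_target hy
      · intro hx
        refine ⟨L.symm (Ψ.chart x), ?_, ?_⟩
        · change L (L.symm (Ψ.chart x)) ∈ Ψ.chart.target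
          rw [L.apply_symm_apply]; exact Ψ.chart.map_source hx
        · change Ψ.chart.symm (L (L.symm (Ψ.chart x))) = x
          rw [L.apply_symm_apply, Ψ.chart.left_inv hx]
    · exact (L.symm.contDiff.contMDiff).comp_contMDiffOn (Ψ.contMDiffOn.of_le (by norm_num))
    · intro y hy
      change L.symm (Ψ.chart (Ψ.chart.symm (L y))) = y
      rw [Ψ.chart.right_inv hy, L.symm_apply_apply]
  rw [h1, (Ψ.param L).measure_apply g hA]
  have hset : (Ψ.param L).toFun ⁻¹' A ∩ (Ψ.param L).dom
      = L ⁻¹' (Ψ.chart.symm ⁻¹' A ∩ Ψ.chart.target) := rfl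
  have hms := measurableSet_symm_preimage Ψ hA
  calc ∫⁻ x in (Ψ.param L).toFun ⁻¹' A ∩ (Ψ.param L).dom,
        ENNReal.ofReal ((Ψ.param L).volumeElement g x)
      ≤ ∫⁻ x in L ⁻¹' (Ψ.chart.symm ⁻¹' A ∩ Ψ.chart.target), ENNReal.ofReal B := by
        rw [hset]
        refine setLIntegral_mono measurable_const fun x hx => ENNReal.ofReal_le_ofReal ?_
        have hLx : L x ∈ Ψ.chart.target := hx.2
        have h2 : (Ψ.param L).volumeElement g x = √ (D (L x)) := by
          rw [LocalParam.volumeElement_eq]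
          simp only [D]
          congr 2
          exact congrArg ContinuousLinearMap.toLinearMap (Ψ.mfderiv_symm_comp_equiv L hLx)
        rw [h2]
        have h3 : Ψ.chart (Ψ.chart.symm (L x)) ∈ T := (hAW hx.1).2
        rw [Ψ.chart.right_inv hLx] at h3
        exact (hT _ h3).le
    _ = ENNReal.ofReal B * c * volume (Ψ.chart.symm ⁻¹' A ∩ Ψ.chart.target) := by
        rw [setLIntegral_const, mul_assoc]
        congr 1
        rw [← Measure.map_apply L.continuous.measurable hms, hcL]
        rfl

/-- The density of the total measure is positive and continuous, so near `x₀` it exceeds half of its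
value there, while the Riemannian volume element is bounded. Only this one-sided comparison with the
volume is needed. -/
theorem exists_riemannianVolume_le_totalMeasure_nhds [SecondCountableTopology M]
    (hh : ContMDiff (𝓡 n) (𝓡 m) 2 h)
    (hindep : ∀ x : M, Function.Surjective (mfderiv (𝓡 n) (𝓡 m) h x)) {ρ : M → ℝ}
    (hρc : ContMDiff (𝓡 n) 𝓘(ℝ, ℝ) 1 ρ) (hρ : ∀ x, 0 < ρ x) {U : Set (Euc m)}
    (hU : IsOpen U) (x₀ : M) (hx₀ : h x₀ ∈ U) :
    ∃ W : Set M, IsOpen W ∧ x₀ ∈ W ∧ ∃ C : ℝ≥0∞, C ≠ ⊤ ∧ ∀ A ⊆ W,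
      MeasurableSet A → riemannianVolume g A ≤ C * totalMeasure g h ρ U A := by
  have : Nonempty M := ⟨x₀⟩
  have hmn := le_of_surjective_mfderiv hindep
  obtain ⟨Ψ, hΨ⟩ := exists_adaptedChart (d := n - m) (by omega) hh x₀ (hindep x₀)
  obtain ⟨W, hWo, hxW, hWs, C, hC, hCA⟩ :=
    exists_riemannianVolume_le_chart g (d := n - m) (by omega) Ψ hΨ
  have hu₀ := Ψ.chart.map_source hΨ
  have hpos := Ψ.fiberDensity_pos g hρ hu₀
  set b := Ψ.fiberDensity g ρ (Ψ.chart x₀) / 2 with hb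
  have hbpos : 0 < b := by positivity
  have hev : ∀ᶠ u in 𝓝 (Ψ.chart x₀), b < Ψ.fiberDensity g ρ u :=
    continuousAt_const.eventually_lt ((Ψ.contDiffOn_fiberDensity g hρc).continuousOn.continuousAt
      (Ψ.chart.open_target.mem_nhds hu₀)) (by rw [hb]; linarith)
  obtain ⟨T, hT, hTo, hu₀T⟩ := eventually_nhds_iff.mp hev
  refine ⟨W ∩ (Ψ.chart.source ∩ Ψ.chart ⁻¹' T) ∩ h ⁻¹' U,
    (hWo.inter (Ψ.chart.isOpen_inter_preimage hTo)).inter (hU.preimage hh.continuous),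
    ⟨⟨hxW, hΨ, hu₀T⟩, hx₀⟩, C * (ENNReal.ofReal b)⁻¹,
    ENNReal.mul_ne_top hC (ENNReal.inv_ne_top.mpr (ENNReal.ofReal_pos.mpr hbpos).ne'), ?_⟩
  intro A hAW hA
  refine (hCA A (fun x hx => (hAW hx).1.1) hA).trans ?_
  rw [mul_assoc]
  gcongr
  rw [totalMeasure_apply_chart g hh hindep hρc hρ hU.measurableSet Ψ hA
    (fun x hx => (hAW hx).1.2.1) (fun x hx => (hAW hx).2), ← ENNReal.div_eq_inv_mul,
    ENNReal.le_div_iff_mul_le (Or.inl (ENNReal.ofReal_pos.mpr hbpos).ne') (Or.inl ENNReal.ofReal_ne_top),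
    mul_comm, ← setLIntegral_const]
  refine setLIntegral_mono' (measurableSet_symm_preimage Ψ hA) fun u hu => ?_
  apply ENNReal.ofReal_le_ofReal
  have h3 : Ψ.chart (Ψ.chart.symm u) ∈ T := (hAW hu.1).1.2.2
  rw [Ψ.chart.right_inv hu.2] at h3
  exact (hT _ h3).le

theorem exists_riemannianVolume_le_totalMeasure [SecondCountableTopology M]
    (hh : ContMDiff (𝓡 n) (𝓡 m) 2 h)
    (hindep : ∀ x : M, Function.Surjective (mfderiv (𝓡 n) (𝓡 m) h x)) {ρ : M → ℝ}
    (hρc : ContMDiff (𝓡 n) 𝓘(ℝ, ℝ) 1 ρ) (hρ : ∀ x, 0 < ρ x) {U : Set (Euc m)}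
    (hU : IsOpen U) {K : Set M} (hK : IsCompact K) (hKU : K ⊆ h ⁻¹' U) :
    ∃ C : ℝ≥0∞, C ≠ ⊤ ∧ ∀ A ⊆ K,
      MeasurableSet A → riemannianVolume g A ≤ C * totalMeasure g h ρ U A := by
  choose! W hWo hxW C hC hCA using
    exists_riemannianVolume_le_totalMeasure_nhds g hh hindep hρc hρ hU
  obtain ⟨t, htK, ht⟩ := hK.elim_nhds_subcover W
    (fun x hx => (hWo x (hKU hx)).mem_nhds (hxW x (hKU hx)))
  refine ⟨∑ x ∈ t, C x, (ENNReal.sum_lt_top.mpr fun x hx =>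
    (hC x (hKU (htK x hx))).lt_top).ne, fun A hAK hA => ?_⟩
  calc riemannianVolume g A ≤ riemannianVolume g (⋃ x ∈ t, A ∩ W x) := by
        apply measure_mono
        intro x hx
        obtain ⟨y, hy, hxy⟩ := mem_iUnion₂.mp (ht (hAK hx))
        exact mem_iUnion₂.mpr ⟨y, hy, hx, hxy⟩
    _ ≤ ∑ x ∈ t, riemannianVolume g (A ∩ W x) := measure_biUnion_finset_le _ _
    _ ≤ ∑ x ∈ t, C x * totalMeasure g h ρ U A := by
        refine Finset.sum_le_sum fun x hx => ?_
        have hxU := hKU (htK x hx)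
        refine (hCA x hxU (A ∩ W x) inter_subset_right
          (hA.inter (hWo x hxU).measurableSet)).trans ?_
        gcongr
        exact inter_subset_left
    _ = _ := by rw [Finset.sum_mul]

end TotalMeasure

end Averaging

namespace Averaging

/-! ### Dependence of fiber integrals on the level -/

section FiberIntegrals

variable {n m : ℕ} {M : Type*} [TopologicalSpace M] [ChartedSpace (EuclideanSpace ℝ (Fin n)) M]
  [IsManifold (𝓡 n) ∞ M] [MeasurableSpace M] [BorelSpace M]
  (g : Bundle.ContMDiffRiemannianMetric (𝓡 n) ∞ (EuclideanSpace ℝ (Fin n))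
      (fun x : M => TangentSpace (𝓡 n) x))
  {h : M → EuclideanSpace ℝ (Fin m)}
  {F : Type*} [NormedAddCommGroup F] [NormedSpace ℝ F]

/-- A function times the density of the fiber measures, in an adapted chart. -/
noncomputable def AdaptedChart.weighted {d : ℕ} (Ψ : AdaptedChart n d h) (ρ : M → ℝ) (f : M → F) :
    Euc m × Euc d → F :=
  Ψ.chart.target.indicator fun u => Ψ.fiberDensity g ρ u • f (Ψ.chart.symm u)

omit [MeasurableSpace M] [BorelSpace M] in
theorem AdaptedChart.weighted_eq_zero {d : ℕ} (Ψ : AdaptedChart n d h) {ρ : M → ℝ} {f : M → F}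
    {u : Euc m × Euc d} (hu : u ∉ Ψ.chart '' tsupport f) : Ψ.weighted g ρ f u = 0 := by
  unfold weighted
  by_cases hut : u ∈ Ψ.chart.target
  · have h0 : f (Ψ.chart.symm u) = 0 :=
      image_eq_zero_of_notMem_tsupport fun h => hu ⟨_, h, Ψ.chart.right_inv hut⟩
    rw [indicator_of_mem hut, h0, smul_zero]
  · exact indicator_of_notMem hut _

omit [MeasurableSpace M] [BorelSpace M] in
theorem AdaptedChart.hasCompactSupport_weighted {d : ℕ} (Ψ : AdaptedChart n d h) {ρ : M → ℝ}
    {f : M → F} (hf : HasCompactSupport f) (hfs : tsupport f ⊆ Ψ.chart.source) :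
    HasCompactSupport (Ψ.weighted g ρ f) :=
  HasCompactSupport.intro (hf.isCompact.image_of_continuousOn
    (Ψ.contMDiffOn.continuousOn.mono hfs)) fun _ hu => Ψ.weighted_eq_zero g hu

omit [MeasurableSpace M] [BorelSpace M] in
-- The support of `f` is a compact subset of the chart, so the extension by zero does not spoil
-- smoothness at the boundary of the target.
theorem AdaptedChart.contDiff_weighted {d : ℕ} (Ψ : AdaptedChart n d h) {ρ : M → ℝ}
    (hρ : ContMDiff (𝓡 n) 𝓘(ℝ, ℝ) 1 ρ) {f : M → F} (hfc : ContMDiff (𝓡 n) 𝓘(ℝ, F) 1 f)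
    (hf : HasCompactSupport f) (hfs : tsupport f ⊆ Ψ.chart.source) :
    ContDiff ℝ 1 (Ψ.weighted g ρ f) := by
  have hK : IsCompact (Ψ.chart '' tsupport f) :=
    hf.isCompact.image_of_continuousOn (Ψ.contMDiffOn.continuousOn.mono hfs)
  rw [contDiff_iff_contDiffAt]
  intro u
  by_cases hu : u ∈ Ψ.chart.target
  · have h1 : ContDiffOn ℝ 1 (fun u => Ψ.fiberDensity g ρ u • f (Ψ.chart.symm u))
        Ψ.chart.target := by
      refine (Ψ.contDiffOn_fiberDensity g hρ).smul ?_
      exact contMDiffOn_iff_contDiffOn.mp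
        (hfc.comp_contMDiffOn (Ψ.contMDiffOn_symm.of_le (by norm_num)))
    have hn := Ψ.chart.open_target.mem_nhds hu
    refine (h1.contDiffAt hn).congr_of_eventuallyEq ?_
    filter_upwards [hn] with v hv
    exact indicator_of_mem hv _
  · have h2 : u ∉ Ψ.chart '' tsupport f := by
      rintro ⟨x, hx, rfl⟩
      exact hu (Ψ.chart.map_source (hfs hx))
    refine (contDiffAt_const (c := (0 : F))).congr_of_eventuallyEq ?_
    filter_upwards [hK.isClosed.isOpen_compl.mem_nhds h2] with v hv
    exact Ψ.weighted_eq_zero g hv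

omit [NormedSpace ℝ F] in
theorem integrable_prodMk_of_hasCompactSupport {d : ℕ} {u : Euc m × Euc d → F}
    (hu : Continuous u) (huc : HasCompactSupport u) (c : Euc m) :
    Integrable (fun y => u (c, y)) :=
  (hu.comp (Continuous.prodMk_right c)).integrable_of_hasCompactSupport
    (huc.comp_isClosedEmbedding
      (Topology.IsClosedEmbedding.of_continuous_injective_isClosedMap
        (Continuous.prodMk_right c) (Prod.mk_right_injective c) (by
          intro s hs
          have : (Prod.mk c) '' s = {c} ×ˢ s := by rw [singleton_prod]
          rw [this]
          exact isClosed_singleton.prod hs)))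

theorem integral_fiberMeasure_chart (Ψ : AdaptedChart n (n - m) h) {ρ : M → ℝ}
    (hρc : ContMDiff (𝓡 n) 𝓘(ℝ, ℝ) 1 ρ) (hρ : ∀ x, 0 < ρ x) {f : M → F}
    (hfc : ContMDiff (𝓡 n) 𝓘(ℝ, F) 1 f) [SecondCountableTopology F]
    (hf : HasCompactSupport f) (hfs : tsupport f ⊆ Ψ.chart.source) (c : Euc m) :
    Integrable f (fiberMeasure g h ρ c) ∧
    ∫ x, f x ∂(fiberMeasure g h ρ c) = ∫ y, Ψ.weighted g ρ f (c, y) := by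
  have hf0 : ∀ x ∉ Ψ.chart.source, f x = 0 := fun x hx =>
    image_eq_zero_of_notMem_tsupport fun h => hx (hfs h)
  have hdom : MeasurableSet {y | (c, y) ∈ Ψ.chart.target} := (Ψ.slice c).isOpen_dom.measurableSet
  have hcont : ContinuousOn (fun y => Ψ.chart.symm (c, y)) {y | (c, y) ∈ Ψ.chart.target} :=
    (Ψ.slice c).contMDiffOn.continuousOn
  have hm : AEMeasurable (fun y => Ψ.chart.symm (c, y))
      ((volume.restrict {y | (c, y) ∈ Ψ.chart.target}).withDensity
        (fun y => ENNReal.ofReal (Ψ.fiberDensity g ρ (c, y)))) :=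
    (hcont.aemeasurable hdom).mono_ac (withDensity_absolutelyContinuous _ _)
  have hdens : AEMeasurable (fun y => ENNReal.ofReal (Ψ.fiberDensity g ρ (c, y)))
      (volume.restrict {y | (c, y) ∈ Ψ.chart.target}) := by
    have : ContinuousOn (fun y => Ψ.fiberDensity g ρ (c, y)) {y | (c, y) ∈ Ψ.chart.target} :=
      (Ψ.contDiffOn_fiberDensity g hρc).continuousOn.comp (by fun_prop) (fun y hy => hy)
    exact (this.aemeasurable hdom).ennreal_ofReal
  have hlt : ∀ᵐ y ∂(volume.restrict {y | (c, y) ∈ Ψ.chart.target}),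
      ENNReal.ofReal (Ψ.fiberDensity g ρ (c, y)) < ⊤ := ae_of_all _ fun y => ENNReal.ofReal_lt_top
  have hint : Integrable (fun y => Ψ.weighted g ρ f (c, y)) :=
    integrable_prodMk_of_hasCompactSupport (Ψ.contDiff_weighted g hρc hfc hf hfs).continuous
      (Ψ.hasCompactSupport_weighted g hf hfs) c
  have heq : ∀ y ∈ {y | (c, y) ∈ Ψ.chart.target},
      Ψ.weighted g ρ f (c, y)
      = (ENNReal.ofReal (Ψ.fiberDensity g ρ (c, y))).toReal • f (Ψ.chart.symm (c, y)) := by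
    intro y hy
    have : Ψ.weighted g ρ f (c, y) = Ψ.fiberDensity g ρ (c, y) • f (Ψ.chart.symm (c, y)) :=
      indicator_of_mem (s := Ψ.chart.target) hy _
    rw [this, ENNReal.toReal_ofReal (Ψ.fiberDensity_pos g hρ hy).le]
  constructor
  · rw [← integrableOn_iff_integrable_of_support_subset (s := Ψ.chart.source)
      (fun x hx => by_contra fun h => hx (hf0 x h)), IntegrableOn,
      fiberMeasure_restrict g Ψ hρc.continuous hρ c,
      integrable_map_measure hfc.continuous.aestronglyMeasurable hm]
    refine (integrable_withDensity_iff_integrable_smul₀' hdens hlt).mpr ?_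
    exact IntegrableOn.congr_fun hint.integrableOn heq hdom
  · rw [← setIntegral_eq_integral_of_forall_compl_eq_zero hf0,
      fiberMeasure_restrict g Ψ hρc.continuous hρ c,
      integral_map hm hfc.continuous.aestronglyMeasurable,
      integral_withDensity_eq_integral_toReal_smul₀ hdens hlt,
      ← setIntegral_congr_fun hdom heq]
    refine setIntegral_eq_integral_of_forall_compl_eq_zero fun y hy => ?_
    exact indicator_of_notMem (s := Ψ.chart.target) hy _

/-- The constant is the Lipschitz constant of `u` times the volume of the projection of its support.
-/
theorem exists_lipschitz_integral_snd {d : ℕ} {u : Euc m × Euc d → F} (hu : ContDiff ℝ 1 u)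
    (huc : HasCompactSupport u) :
    ∃ L : ℝ, 0 ≤ L ∧ ∀ c c' : Euc m, ‖∫ y, u (c, y) - u (c', y)‖ ≤ L * ‖c - c'‖ := by
  obtain ⟨C, hC⟩ := hu.lipschitzWith_of_hasCompactSupport huc one_ne_zero
  have hK : IsCompact (Prod.snd '' tsupport u) := huc.isCompact.image continuous_snd
  have h0 : ∀ c y, y ∉ Prod.snd '' tsupport u → u (c, y) = 0 := fun c y hy =>
    image_eq_zero_of_notMem_tsupport fun h => hy ⟨_, h, rfl⟩
  refine ⟨C * volume.real (Prod.snd '' tsupport u), by positivity, fun c c' => ?_⟩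
  have h1 : ∫ y, u (c, y) - u (c', y)
      = ∫ y in Prod.snd '' tsupport u, (u (c, y) - u (c', y)) := by
    refine (setIntegral_eq_integral_of_forall_compl_eq_zero fun y hy => ?_).symm
    rw [h0 c y hy, h0 c' y hy, sub_zero]
  rw [h1]
  refine (norm_setIntegral_le_of_norm_le_const (C := C * ‖c - c'‖)
    hK.measure_lt_top fun y _ => ?_).trans (le_of_eq (by ring))
  have := hC.dist_le_mul (c, y) (c', y)
  rw [dist_eq_norm] at this
  refine this.trans (le_of_eq ?_)
  rw [Prod.dist_eq, dist_self, max_eq_left dist_nonneg, dist_eq_norm]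

omit [MeasurableSpace M] [BorelSpace M] in
theorem exists_adapted_partitionOfUnity [T2Space M] [SecondCountableTopology M]
    (hh : ContMDiff (𝓡 n) (𝓡 m) 2 h)
    (hindep : ∀ x : M, Function.Surjective (mfderiv (𝓡 n) (𝓡 m) h x)) {K : Set M}
    (hK : IsCompact K) :
    ∃ (t : Finset M) (Ψ : M → AdaptedChart n (n - m) h) (χ : M → M → ℝ),
      (∀ x ∈ t, ContMDiff (𝓡 n) 𝓘(ℝ, ℝ) 1 (χ x)) ∧ (∀ x ∈ t, HasCompactSupport (χ x)) ∧
      (∀ x ∈ t, tsupport (χ x) ⊆ (Ψ x).chart.source) ∧ ∀ z ∈ K, ∑ x ∈ t, χ x z = 1 := by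
  classical
  rcases isEmpty_or_nonempty M with hM | hM
  · exact ⟨∅, fun x => (hM.false x).elim, fun x => (hM.false x).elim, by simp, by simp, by simp,
      fun z => (hM.false z).elim⟩
  have hmn := le_of_surjective_mfderiv hindep
  have : LocallyCompactSpace M := ChartedSpace.locallyCompactSpace (EuclideanSpace ℝ (Fin n)) M
  choose Ψ hΨ using fun x => exists_adaptedChart (d := n - m) (by omega) hh x (hindep x)
  choose B hB hBs hBc using fun x =>
    (local_compact_nhds ((Ψ x).chart.open_source.mem_nhds (hΨ x)))
  obtain ⟨t, htK, ht⟩ := hK.elim_nhds_subcover (fun x => interior (B x))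
    (fun x hx => interior_mem_nhds.mpr (hB x))
  obtain ⟨f, hf⟩ := SmoothPartitionOfUnity.exists_isSubordinate (𝓡 n) hK.isClosed
    (fun x : t => interior (B x)) (fun _ => isOpen_interior) (by
      intro x hx
      obtain ⟨y, hy, hxy⟩ := mem_iUnion₂.mp (ht hx)
      exact mem_iUnion.mpr ⟨⟨y, hy⟩, hxy⟩)
  have hsub : ∀ x : t, tsupport (f x) ⊆ B x := fun x => (hf x).trans interior_subset
  refine ⟨t, Ψ, fun x => if hx : x ∈ t then f ⟨x, hx⟩ else 0, ?_, ?_, ?_, ?_⟩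
  · intro x hx
    simp only [hx, dite_true]
    exact (f ⟨x, hx⟩).contMDiff.of_le (by norm_cast)
  · intro x hx
    simp only [hx, dite_true]
    exact (hBc x).of_isClosed_subset (isClosed_tsupport _) (hsub ⟨x, hx⟩)
  · intro x hx
    simp only [hx, dite_true]
    exact (hsub ⟨x, hx⟩).trans (hBs x)
  · intro z hz
    have := f.sum_eq_one hz
    rw [finsum_eq_sum_of_fintype] at this
    rw [← this, ← Finset.sum_coe_sort t]
    refine Finset.sum_congr rfl fun x _ => ?_
    simp only [x.2, dite_true]

/-- A partition of unity on the compact set over `V` splits `f` into pieces supported in charts,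
where the preceding estimate applies. The pieces need to add up to `f` only over `V`, since the
fiber measure of `c` is carried by the level set of `c`. -/
theorem exists_lipschitz_integral_fiberMeasure [T2Space M] [SecondCountableTopology M]
    (hh : ContMDiff (𝓡 n) (𝓡 m) 2 h)
    (hindep : ∀ x : M, Function.Surjective (mfderiv (𝓡 n) (𝓡 m) h x)) {ρ : M → ℝ}
    (hρc : ContMDiff (𝓡 n) 𝓘(ℝ, ℝ) 1 ρ) (hρ : ∀ x, 0 < ρ x) {V : Set (Euc m)}
    (hV : IsCompact (h ⁻¹' V)) [SecondCountableTopology F]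
    {f : M → F} (hf : ContMDiff (𝓡 n) 𝓘(ℝ, F) 1 f) :
    (∀ c ∈ V, Integrable f (fiberMeasure g h ρ c)) ∧
    ∃ L : ℝ, 0 ≤ L ∧ ∀ c ∈ V, ∀ c' ∈ V,
      ‖∫ x, f x ∂(fiberMeasure g h ρ c) - ∫ x, f x ∂(fiberMeasure g h ρ c')‖ ≤ L * ‖c - c'‖ := by
  obtain ⟨t, Ψ, χ, hχ, hχc, hχs, hχ1⟩ := exists_adapted_partitionOfUnity hh hindep hV
  have hfχ : ∀ x ∈ t, ContMDiff (𝓡 n) 𝓘(ℝ, F) 1 (fun z => χ x z • f z) :=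
    fun x hx => (hχ x hx).smul hf
  have hfχc : ∀ x ∈ t, HasCompactSupport (fun z => χ x z • f z) :=
    fun x hx => (hχc x hx).smul_right
  have hfχs : ∀ x ∈ t, tsupport (fun z => χ x z • f z) ⊆ (Ψ x).chart.source :=
    fun x hx => (closure_mono (Function.support_smul_subset_left (χ x) f)).trans (hχs x hx)
  have hae : ∀ c ∈ V, f =ᵐ[fiberMeasure g h ρ c] fun z => ∑ x ∈ t, χ x z • f z := by
    intro c hc
    have h0 : ∀ᵐ z ∂(fiberMeasure g h ρ c), z ∈ h ⁻¹' {c} := by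
      rw [ae_iff]
      exact fiberMeasure_compl g hh.continuous ρ c
    filter_upwards [h0] with z hz
    rw [← Finset.sum_smul, hχ1 z (by rw [mem_preimage, show h z = c from hz]; exact hc), one_smul]
  have hchart := fun x hx c => integral_fiberMeasure_chart g (Ψ x) hρc hρ (hfχ x hx) (hfχc x hx)
    (hfχs x hx) c
  have hI : ∀ c ∈ V, Integrable f (fiberMeasure g h ρ c) := fun c hc =>
    (integrable_finsetSum t fun x hx => (hchart x hx c).1).congr (hae c hc).symm
  refine ⟨hI, ?_⟩
  have hL := fun x (hx : x ∈ t) => exists_lipschitz_integral_snd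
    ((Ψ x).contDiff_weighted g hρc (hfχ x hx) (hfχc x hx) (hfχs x hx))
    ((Ψ x).hasCompactSupport_weighted g (ρ := ρ) (hfχc x hx) (hfχs x hx))
  choose! L hL0 hL using hL
  refine ⟨∑ x ∈ t, L x, Finset.sum_nonneg fun x hx => hL0 x hx, fun c hc c' hc' => ?_⟩
  rw [integral_congr_ae (hae c hc), integral_congr_ae (hae c' hc'),
    integral_finsetSum t fun x hx => (hchart x hx c).1,
    integral_finsetSum t fun x hx => (hchart x hx c').1, ← Finset.sum_sub_distrib,
    Finset.sum_mul]
  refine norm_sum_le_of_le t fun x hx => ?_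
  rw [(hchart x hx c).2, (hchart x hx c').2]
  have hslice : ∀ c, Integrable fun y => (Ψ x).weighted g ρ (fun z => χ x z • f z) (c, y) := by
    exact integrable_prodMk_of_hasCompactSupport
      ((Ψ x).contDiff_weighted g hρc (hfχ x hx) (hfχc x hx) (hfχs x hx)).continuous
      ((Ψ x).hasCompactSupport_weighted g (hfχc x hx) (hfχs x hx))
  rw [← integral_sub (hslice c) (hslice c')]
  exact hL x hx c c'

/-- The density in a chart is positive. This serves twice: for the lower bound on the total masses,
and to contradict ergodicity in the proof that `h` is proper. -/
theorem fiberMeasure_pos_of_isOpen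
    (hh : ContMDiff (𝓡 n) (𝓡 m) 2 h)
    (hindep : ∀ x : M, Function.Surjective (mfderiv (𝓡 n) (𝓡 m) h x)) {ρ : M → ℝ}
    (hρc : ContMDiff (𝓡 n) 𝓘(ℝ, ℝ) 1 ρ) (hρ : ∀ x, 0 < ρ x) {W : Set M} (hW : IsOpen W) {x : M}
    (hx : x ∈ W) : 0 < fiberMeasure g h ρ (h x) W := by
  have : Nonempty M := ⟨x⟩
  have hmn := le_of_surjective_mfderiv hindep
  obtain ⟨Ψ, hΨ⟩ := exists_adaptedChart (d := n - m) (by omega) hh x (hindep x)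
  have hWo : IsOpen (W ∩ Ψ.chart.source) := hW.inter Ψ.chart.open_source
  refine lt_of_lt_of_le ?_ (measure_mono (inter_subset_left (s := W) (t := Ψ.chart.source)))
  rw [fiberMeasure_apply g Ψ hρc hρ (h x) hWo.measurableSet inter_subset_right, pos_iff_ne_zero]
  intro h0
  replace h0 := (lintegral_eq_zero_iff ((measurable_chart_indicator g Ψ hρc
    hWo.measurableSet).comp measurable_prodMk_left)).mp h0
  have hopen : IsOpen (Ψ.chart.target ∩ Ψ.chart.symm ⁻¹' (W ∩ Ψ.chart.source)) :=
    Ψ.chart.isOpen_inter_preimage_symm hWo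
  set T : Set (Euc (n - m)) :=
    {y | (h x, y) ∈ Ψ.chart.target ∩ Ψ.chart.symm ⁻¹' (W ∩ Ψ.chart.source)} with hT
  have hTo : IsOpen T := hopen.preimage (Continuous.prodMk_right (h x))
  have hTne : T.Nonempty := by
    refine ⟨(Ψ.chart x).2, ?_⟩
    have h1 : (h x, (Ψ.chart x).2) = Ψ.chart x := by rw [← Ψ.fst_apply x hΨ]
    rw [hT, mem_ofPred_eq, h1]
    refine ⟨Ψ.chart.map_source hΨ, ?_⟩
    rw [mem_preimage, Ψ.chart.left_inv hΨ]
    exact ⟨hx, hΨ⟩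
  have hpos := hTo.measure_pos volume hTne
  apply hpos.ne'
  refine measure_mono_null (fun y hy => ?_) (ae_iff.mp h0)
  rw [mem_ofPred_eq, Function.comp_apply]
  intro h1
  rw [indicator_of_mem (show (h x, y) ∈ Ψ.chart.symm ⁻¹' (W ∩ Ψ.chart.source) ∩ Ψ.chart.target from
    ⟨hy.2, hy.1⟩)] at h1
  have := Ψ.fiberDensity_pos g hρ hy.1
  simp only [Pi.zero_apply, ENNReal.ofReal_eq_zero] at h1
  linarith

end FiberIntegrals

end Averaging

namespace Averaging

/-! ### Averages over the level sets are Lipschitz -/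

section Averages

variable {n m : ℕ} {M : Type*} [TopologicalSpace M] [ChartedSpace (EuclideanSpace ℝ (Fin n)) M]
  [IsManifold (𝓡 n) ∞ M] [MeasurableSpace M] [BorelSpace M] [T2Space M]
  [SecondCountableTopology M]
  (g : Bundle.ContMDiffRiemannianMetric (𝓡 n) ∞ (EuclideanSpace ℝ (Fin n))
      (fun x : M => TangentSpace (𝓡 n) x))
  {h : M → EuclideanSpace ℝ (Fin m)}

/-- The masses are fiber integrals of the constant `1`, hence Lipschitz in `c`. They are positive on
nonempty fibers, and compactness of `V` gives the uniform bounds. -/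
theorem exists_fiberMeasure_real_bounds
    (hh : ContMDiff (𝓡 n) (𝓡 m) 2 h)
    (hindep : ∀ x : M, Function.Surjective (mfderiv (𝓡 n) (𝓡 m) h x)) {ρ : M → ℝ}
    (hρc : ContMDiff (𝓡 n) 𝓘(ℝ, ℝ) 1 ρ) (hρ : ∀ x, 0 < ρ x) {V : Set (Euc m)}
    (hVc : IsCompact V) (hV : IsCompact (h ⁻¹' V)) (hne : ∀ c ∈ V, (h ⁻¹' {c}).Nonempty) :
    (∀ c ∈ V, IsFiniteMeasure (fiberMeasure g h ρ c)) ∧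
    ∃ a b L : ℝ, 0 < a ∧ 0 ≤ L ∧ (∀ c ∈ V, a ≤ (fiberMeasure g h ρ c).real univ ∧
      (fiberMeasure g h ρ c).real univ ≤ b) ∧ ∀ c ∈ V, ∀ c' ∈ V,
      |(fiberMeasure g h ρ c).real univ - (fiberMeasure g h ρ c').real univ| ≤ L * ‖c - c'‖ := by
  obtain ⟨hI, L, hL0, hL⟩ := exists_lipschitz_integral_fiberMeasure g hh hindep hρc hρ hV
    (f := fun _ => (1 : ℝ)) contMDiff_const
  have hfin : ∀ c ∈ V, IsFiniteMeasure (fiberMeasure g h ρ c) := fun c hc =>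
    (integrable_const_iff_isFiniteMeasure one_ne_zero).mp (hI c hc)
  have hL' : ∀ c ∈ V, ∀ c' ∈ V,
      |(fiberMeasure g h ρ c).real univ - (fiberMeasure g h ρ c').real univ| ≤ L * ‖c - c'‖ := by
    intro c hc c' hc'
    have := hL c hc c' hc'
    simpa only [integral_const, smul_eq_mul, mul_one, Real.norm_eq_abs] using this
  have hpos : ∀ c ∈ V, 0 < (fiberMeasure g h ρ c).real univ := by
    intro c hc
    have := hfin c hc
    obtain ⟨x, hx⟩ := hne c hc
    have h1 := fiberMeasure_pos_of_isOpen g hh hindep hρc hρ isOpen_univ (mem_univ x)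
    rw [show h x = c from hx] at h1
    exact ENNReal.toReal_pos h1.ne' (measure_ne_top _ _)
  refine ⟨hfin, ?_⟩
  have hcont : ContinuousOn (fun c => (fiberMeasure g h ρ c).real univ) V := by
    have : LipschitzOnWith L.toNNReal (fun c => (fiberMeasure g h ρ c).real univ) V := by
      refine LipschitzOnWith.of_dist_le_mul fun c hc c' hc' => ?_
      rw [Real.dist_eq, dist_eq_norm, Real.coe_toNNReal _ hL0]
      exact hL' c hc c' hc'
    exact this.continuousOn
  rcases V.eq_empty_or_nonempty with hVe | hVne
  · subst hVe
    exact ⟨1, 1, 0, one_pos, le_rfl, by simp, by simp⟩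
  obtain ⟨c₁, hc₁, hmin⟩ := hVc.exists_isMinOn hVne hcont
  obtain ⟨c₂, hc₂, hmax⟩ := hVc.exists_isMaxOn hVne hcont
  exact ⟨_, _, L, hpos c₁ hc₁, hL0, fun c hc => ⟨hmin hc, hmax hc⟩, hL'⟩

/-- A quotient of a bounded Lipschitz numerator and a Lipschitz denominator bounded away from zero.
With `f` the drift, this is the regularity of the averaged field that Gronwall's inequality
requires. -/
theorem exists_lipschitzOnWith_average {F : Type*} [NormedAddCommGroup F] [NormedSpace ℝ F]
    [SecondCountableTopology F]
    (hh : ContMDiff (𝓡 n) (𝓡 m) 2 h)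
    (hindep : ∀ x : M, Function.Surjective (mfderiv (𝓡 n) (𝓡 m) h x)) {ρ : M → ℝ}
    (hρc : ContMDiff (𝓡 n) 𝓘(ℝ, ℝ) 1 ρ) (hρ : ∀ x, 0 < ρ x) {V : Set (Euc m)}
    (hVc : IsCompact V) (hV : IsCompact (h ⁻¹' V)) (hne : ∀ c ∈ V, (h ⁻¹' {c}).Nonempty)
    {f : M → F} (hf : ContMDiff (𝓡 n) 𝓘(ℝ, F) 1 f) :
    ∃ C, LipschitzOnWith C (fun c => ⨍ z, f z ∂(fiberMeasure g h ρ c)) V := by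
  obtain ⟨hfin, a, b, L, ha, hL0, hab, hL⟩ :=
    exists_fiberMeasure_real_bounds g hh hindep hρc hρ hVc hV hne
  obtain ⟨hI, L', hL'0, hL'⟩ := exists_lipschitz_integral_fiberMeasure g hh hindep hρc hρ hV hf
  rcases V.eq_empty_or_nonempty with hVe | ⟨c₀, hc₀⟩
  · subst hVe
    exact ⟨0, by simp [LipschitzOnWith]⟩
  obtain ⟨R, hR⟩ := hVc.isBounded.subset_closedBall c₀
  have hR0 : 0 ≤ R := by
    have := hR hc₀
    simpa using this
  set B := ‖∫ x, f x ∂(fiberMeasure g h ρ c₀)‖ + L' * R with hB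
  have hB0 : 0 ≤ B := by positivity
  have hBc : ∀ c ∈ V, ‖∫ x, f x ∂(fiberMeasure g h ρ c)‖ ≤ B := by
    intro c hc
    have h1 := hL' c hc c₀ hc₀
    have h2 : ‖c - c₀‖ ≤ R := by rw [← dist_eq_norm]; exact hR hc
    have h3 : ‖∫ x, f x ∂(fiberMeasure g h ρ c)‖ ≤ ‖∫ x, f x ∂(fiberMeasure g h ρ c₀)‖ +
      ‖∫ x, f x ∂(fiberMeasure g h ρ c) - ∫ x, f x ∂(fiberMeasure g h ρ c₀)‖ := norm_le_insert' _ _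
    have h4 : L' * ‖c - c₀‖ ≤ L' * R := by gcongr
    linarith
  refine ⟨(a⁻¹ * L' + a⁻¹ * a⁻¹ * L * B).toNNReal, LipschitzOnWith.of_dist_le_mul ?_⟩
  intro c hc c' hc'
  rw [Real.coe_toNNReal _ (by positivity), dist_eq_norm, dist_eq_norm, average_eq, average_eq]
  set p := (fiberMeasure g h ρ c).real univ
  set q := (fiberMeasure g h ρ c').real univ
  set v := ∫ x, f x ∂(fiberMeasure g h ρ c)
  set w := ∫ x, f x ∂(fiberMeasure g h ρ c')
  have hp : a ≤ p := (hab c hc).1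
  have hq : a ≤ q := (hab c' hc').1
  have hp0 : 0 < p := ha.trans_le hp
  have hq0 : 0 < q := ha.trans_le hq
  have e1 : p⁻¹ • v - q⁻¹ • w = p⁻¹ • (v - w) + (p⁻¹ * q⁻¹ * (q - p)) • w := by
    have : p⁻¹ * q⁻¹ * (q - p) = p⁻¹ - q⁻¹ := by field_simp
    rw [this, sub_smul, smul_sub]
    abel
  have hpi : p⁻¹ ≤ a⁻¹ := by gcongr
  have hqi : q⁻¹ ≤ a⁻¹ := by gcongr
  rw [e1]
  calc ‖p⁻¹ • (v - w) + (p⁻¹ * q⁻¹ * (q - p)) • w‖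
      ≤ p⁻¹ * ‖v - w‖ + p⁻¹ * q⁻¹ * |q - p| * ‖w‖ := by
        refine (norm_add_le _ _).trans ?_
        rw [norm_smul, norm_smul, Real.norm_eq_abs, Real.norm_eq_abs, abs_mul,
          abs_of_pos (inv_pos.mpr hp0), abs_of_pos (mul_pos (inv_pos.mpr hp0) (inv_pos.mpr hq0))]
    _ ≤ a⁻¹ * (L' * ‖c - c'‖) + a⁻¹ * a⁻¹ * (L * ‖c - c'‖) * B := by
        have i1 : ‖v - w‖ ≤ L' * ‖c - c'‖ := hL' c hc c' hc'
        have i2 : |q - p| ≤ L * ‖c - c'‖ := by rw [abs_sub_comm]; exact hL c hc c' hc'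
        have i3 : ‖w‖ ≤ B := hBc c' hc'
        gcongr
    _ = _ := by ring

end Averages

end Averaging

namespace Averaging

/-! ### Uniqueness of integral curves -/

section IntegralCurves

variable {E : Type*} [NormedAddCommGroup E] [NormedSpace ℝ E]
  {H : Type*} [TopologicalSpace H] {I : ModelWithCorners ℝ E H}
  {N : Type*} [TopologicalSpace N] [ChartedSpace H N]
  {F : Type*} [NormedAddCommGroup F] [NormedSpace ℝ F]

/-- The components of the vector field `X` in the chart `ψ`. -/
noncomputable def chartField (ψ : N → F) (X : (x : N) → TangentSpace I x) (y : N) : F :=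
  mfderiv I 𝓘(ℝ, F) ψ y (X y)

theorem hasDerivWithinAt_comp_of_isMIntegralCurveOn {X : (x : N) → TangentSpace I x} {γ : ℝ → N}
    {s : Set ℝ} {t : ℝ} {ψ : N → F} (hγ : IsMIntegralCurveOn γ X s) (ht : t ∈ s)
    (hψ : MDifferentiableAt I 𝓘(ℝ, F) ψ (γ t)) :
    HasDerivWithinAt (ψ ∘ γ) (chartField ψ X (γ t)) s t := by
  let L : ℝ →L[ℝ] F := (1 : ℝ →L[ℝ] ℝ).smulRight (chartField ψ X (γ t))
  have h1 : HasMFDerivWithinAt 𝓘(ℝ, ℝ) 𝓘(ℝ, F) (ψ ∘ γ) s t L := by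
    refine (hψ.hasMFDerivAt.comp_hasMFDerivWithinAt t (hγ t ht)).congr_mfderiv ?_
    ext
    exact congrArg (mfderiv I 𝓘(ℝ, F) ψ (γ t)) (one_smul ℝ (X (γ t))) |>.trans
      (one_smul ℝ (chartField ψ X (γ t))).symm
  have h2 : HasFDerivWithinAt (ψ ∘ γ) L s t :=
    hasMFDerivWithinAt_iff_hasFDerivWithinAt.1 h1
  simpa [L] using h2.hasDerivWithinAt

theorem hasMFDerivWithinAt_comp_of_hasDerivWithinAt {Φ : F → N} {α : ℝ → F} {a : F}
    {s : Set ℝ} {t : ℝ} (hα : HasDerivWithinAt α a s t)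
    (hΦ : MDifferentiableAt 𝓘(ℝ, F) I Φ (α t)) :
    HasMFDerivWithinAt 𝓘(ℝ, ℝ) I (Φ ∘ α) s t
      ((1 : ℝ →L[ℝ] ℝ).smulRight (mfderiv 𝓘(ℝ, F) I Φ (α t) a)) := by
  have h1 : HasMFDerivWithinAt 𝓘(ℝ, ℝ) 𝓘(ℝ, F) α s t ((1 : ℝ →L[ℝ] ℝ).smulRight a) :=
    hasMFDerivWithinAt_iff_hasFDerivWithinAt.2 hα.hasFDerivWithinAt
  refine (hΦ.hasMFDerivAt.comp_hasMFDerivWithinAt t h1).congr_mfderiv ?_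
  ext
  exact (congrArg (mfderiv 𝓘(ℝ, F) I Φ (α t)) (one_smul ℝ a)).trans
    (one_smul ℝ (mfderiv 𝓘(ℝ, F) I Φ (α t) a)).symm

/-- The field `X` is Lipschitz near `x₀` when it is read in some differentiable chart `ψ` with
values in `F`. -/
def LipschitzInChartAt (F : Type*) [NormedAddCommGroup F] [NormedSpace ℝ F]
    (X : (x : N) → TangentSpace I x) (x₀ : N) : Prop :=
  ∃ (O : Set N) (ψ : N → F) (v : F → F) (K : NNReal), IsOpen O ∧ x₀ ∈ O ∧
    (∀ y ∈ O, MDifferentiableAt I 𝓘(ℝ, F) ψ y) ∧ InjOn ψ O ∧ LipschitzOnWith K v (ψ '' O) ∧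
    ∀ y ∈ O, chartField ψ X y = v (ψ y)

theorem LipschitzInChartAt.neg {X : (x : N) → TangentSpace I x} {x₀ : N}
    (h : LipschitzInChartAt F X x₀) :
    LipschitzInChartAt F ((-1 : ℝ) • X) x₀ := by
  obtain ⟨O, ψ, v, K, hO, hx, hψ, hinj, hv, he⟩ := h
  refine ⟨O, ψ, fun u => (-1 : ℝ) • v u, K, hO, hx, hψ, hinj, ?_, fun y hy => ?_⟩
  · intro a ha b hb
    simpa [edist_neg_neg] using hv ha hb
  · simp only [← he y hy]
    exact (mfderiv I 𝓘(ℝ, F) ψ y).map_smul (-1 : ℝ) (X y)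

variable [T2Space N]

/-- The set of coincidence is closed because `N` is Hausdorff. It extends to the right of each of
its points, by uniqueness for Lipschitz equations in a chart at that point. -/
theorem eqOn_Icc_of_isMIntegralCurveOn {X : (x : N) → TangentSpace I x} {γ γ' : ℝ → N} {a b : ℝ}
    (hX : ∀ t ∈ Icc a b, LipschitzInChartAt F X (γ t))
    (hγ : IsMIntegralCurveOn γ X (Icc a b)) (hγ' : IsMIntegralCurveOn γ' X (Icc a b))
    (h0 : γ a = γ' a) : EqOn γ γ' (Icc a b) := by
  rcases le_or_gt a b with hab | hab
  swap
  · simp [Icc_eq_empty hab.not_ge]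
  have hcl : IsClosed ({t | γ t = γ' t} ∩ Icc a b) := by
    have h1 := (hγ.continuousOn.prodMk hγ'.continuousOn).preimage_isClosed_of_isClosed isClosed_Icc
      (isClosed_diagonal (X := N))
    convert h1 using 1
    ext t
    simp [and_comm]
  refine fun t ht => hcl.Icc_subset_of_forall_mem_nhdsWithin h0 (fun s hs => ?_) ht
  obtain ⟨hs0, hsI⟩ := hs
  have hsc : s ∈ Icc a b := Ico_subset_Icc_self hsI
  obtain ⟨O, ψ, v, K, hO, hx, hψ, hinj, hv, he⟩ := hX s hsc
  have hsub : Icc s b ⊆ Icc a b := Icc_subset_Icc_left hsI.1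
  have hs' : s ∈ Icc s b := ⟨le_rfl, hsI.2.le⟩
  have h1 : ∀ᶠ u in 𝓝[Icc s b] s, γ u ∈ O ∧ γ' u ∈ O :=
    (((hγ.mono hsub).continuousWithinAt hs').eventually (hO.mem_nhds hx)).and
      (((hγ'.mono hsub).continuousWithinAt hs').eventually (hO.mem_nhds (by
        rw [← show γ s = γ' s from hs0]; exact hx)))
  rw [nhdsWithin_Icc_eq_nhdsGE hsI.2] at h1
  obtain ⟨u, hu, hus⟩ := mem_nhdsGE_iff_exists_Icc_subset.1
    (h1.and (by rw [← nhdsWithin_Icc_eq_nhdsGE hsI.2]; exact self_mem_nhdsWithin))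
  have key : ∀ {β : ℝ → N}, IsMIntegralCurveOn β X (Icc a b) → (∀ τ ∈ Icc s u, β τ ∈ O) →
      ContinuousOn (ψ ∘ β) (Icc s u) ∧
      ∀ τ ∈ Ico s u, HasDerivWithinAt (ψ ∘ β) (v ((ψ ∘ β) τ)) (Ici τ) τ := by
    intro β hβ hβO
    have hd : ∀ τ ∈ Icc s u, HasDerivWithinAt (ψ ∘ β) (v ((ψ ∘ β) τ)) (Icc s u) τ := by
      intro τ hτ
      have h2 := hasDerivWithinAt_comp_of_isMIntegralCurveOn
        (hβ.mono (fun x hx => hsub (hus hx).2)) hτ (hψ _ (hβO τ hτ))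
      rwa [he _ (hβO τ hτ)] at h2
    refine ⟨fun τ hτ => (hd τ hτ).continuousWithinAt, fun τ hτ => ?_⟩
    exact ((hd τ (Ico_subset_Icc_self hτ)).mono (Icc_subset_Icc_left hτ.1)).mono_of_mem_nhdsWithin
      (Icc_mem_nhdsGE hτ.2)
  obtain ⟨k1, k2⟩ := key hγ (fun τ hτ => (hus hτ).1.1)
  obtain ⟨k3, k4⟩ := key hγ' (fun τ hτ => (hus hτ).1.2)
  have heq := ODE_solution_unique_of_mem_Icc_right (v := fun _ => v) (s := fun _ => ψ '' O)
    (fun _ _ => hv) k1 k2 (fun τ hτ => mem_image_of_mem _ (hus (Ico_subset_Icc_self hτ)).1.1)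
    k3 k4 (fun τ hτ => mem_image_of_mem _ (hus (Ico_subset_Icc_self hτ)).1.2)
    (congrArg ψ hs0)
  refine mem_of_superset (Ioc_mem_nhdsGT hu) (fun τ hτ => ?_)
  have hτ' := Ioc_subset_Icc_self hτ
  exact hinj (hus hτ').1.1 (hus hτ').1.2 (heq hτ')

theorem eqOn_uIcc_of_isMIntegralCurveOn {X : (x : N) → TangentSpace I x} {γ γ' : ℝ → N} {t : ℝ}
    (hX : ∀ s ∈ uIcc 0 t, LipschitzInChartAt F X (γ s))
    (hγ : IsMIntegralCurveOn γ X (uIcc 0 t)) (hγ' : IsMIntegralCurveOn γ' X (uIcc 0 t))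
    (h0 : γ 0 = γ' 0) : EqOn γ γ' (uIcc 0 t) := by
  rcases le_total 0 t with ht | ht
  · rw [uIcc_of_le ht] at *
    exact eqOn_Icc_of_isMIntegralCurveOn hX hγ hγ' h0
  · rw [uIcc_of_ge ht] at *
    -- Negative times are reduced to positive ones by reversing time and the sign of the field.
    have hset : {s : ℝ | s * (-1) ∈ Icc t 0} = Icc 0 (-t) := by
      ext s
      simp only [mem_Icc, mem_ofPred_eq]
      constructor <;> rintro ⟨h1, h2⟩ <;> constructor <;> linarith
    have h1 := hγ.comp_mul (-1)
    have h2 := hγ'.comp_mul (-1)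
    rw [hset] at h1 h2
    have h3 := eqOn_Icc_of_isMIntegralCurveOn (F := F) (fun s hs => (hX (s * (-1)) (by
      rw [← hset] at hs; exact hs)).neg) h1 h2 (by simpa using h0)
    intro s hs
    have h4 := h3 (x := -s) (by rw [← hset]; simpa using hs)
    simpa using h4

end IntegralCurves

/-! ### The flow map does not depend on the chosen integral curve -/

section FlowMap

variable {k : ℕ} {N : Type*} [TopologicalSpace N] [ChartedSpace (EuclideanSpace ℝ (Fin k)) N]
  [T2Space N] {F : Type*} [NormedAddCommGroup F] [NormedSpace ℝ F]
  {X : (x : N) → TangentSpace (𝓡 k) x}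

theorem flowMap_eq {γ : ℝ → N} {t : ℝ} {x : N} (h0 : γ 0 = x)
    (hγ : IsMIntegralCurveOn γ X (uIcc 0 t))
    (hX : ∀ s ∈ uIcc 0 t, LipschitzInChartAt F X (γ s)) : flowMap X t x = γ t := by
  have hex : ∃ γ : ℝ → N, γ 0 = x ∧ IsMIntegralCurveOn γ X (uIcc 0 t) := ⟨γ, h0, hγ⟩
  rw [flowMap, dif_pos hex]
  exact (eqOn_uIcc_of_isMIntegralCurveOn hX hγ hex.choose_spec.2
    (h0.trans hex.choose_spec.1.symm) right_mem_uIcc).symm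

omit [T2Space N] in
theorem flowMap_zero (x : N) : flowMap X 0 x = x := by
  rw [flowMap]
  split_ifs with hex
  · exact hex.choose_spec.1
  · rfl

/-- The orbit of a point, unless it is not defined up to time `t`, is a continuous curve. -/
theorem flowMap_eq_self_or (hX : ∀ x, LipschitzInChartAt F X x) (t : ℝ) (x : N) :
    flowMap X t x = x ∨ ∃ γ : ℝ → N, ContinuousOn γ (uIcc 0 t) ∧ γ 0 = x ∧
      ∀ s ∈ uIcc 0 t, flowMap X s x = γ s := by
  by_cases hex : ∃ γ : ℝ → N, γ 0 = x ∧ IsMIntegralCurveOn γ X (uIcc 0 t)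
  · obtain ⟨γ, h0, hγ⟩ := hex
    refine Or.inr ⟨γ, hγ.continuousOn, h0, fun s hs => ?_⟩
    exact flowMap_eq h0 (hγ.mono (uIcc_subset_uIcc left_mem_uIcc hs)) (fun u _ => hX (γ u))
  · exact Or.inl (by rw [flowMap, dif_neg hex])

end FlowMap
end Averaging

namespace Averaging

/-! ### Vector fields read in adapted charts -/

section ChartFields

variable {n m d : ℕ} {M : Type*} [TopologicalSpace M] [ChartedSpace (Euc n) M]
  [IsManifold (𝓡 n) ∞ M] {h : M → Euc m} {X : ℝ → (x : M) → TangentSpace (𝓡 n) x}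
  {S : Set ℝ}

/-- A family of vector fields in an adapted chart, as a function of the chart variable and the
parameter. -/
noncomputable def AdaptedChart.field (Ψ : AdaptedChart n d h)
    (X : ℝ → (x : M) → TangentSpace (𝓡 n) x) (q : (Euc m × Euc d) × ℝ) : Euc m × Euc d :=
  chartField Ψ.chart (X q.2) (Ψ.chart.symm q.1)

omit [IsManifold (𝓡 n) ∞ M] in
theorem AdaptedChart.field_apply (Ψ : AdaptedChart n d h) (e : ℝ) {x : M}
    (hx : x ∈ Ψ.chart.source) : Ψ.field X (Ψ.chart x, e) = chartField Ψ.chart (X e) x := by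
  simp only [AdaptedChart.field]
  rw [Ψ.chart.left_inv hx]

theorem AdaptedChart.contDiffOn_field (Ψ : AdaptedChart n d h)
    (hX : ContMDiffOn ((𝓡 n).prod 𝓘(ℝ, ℝ)) (𝓡 n).tangent 1
      (fun p : M × ℝ => (⟨p.1, X p.2 p.1⟩ : TangentBundle (𝓡 n) M)) (univ ×ˢ S)) :
    ContDiffOn ℝ 1 (Ψ.field X) (Ψ.chart.target ×ˢ S) := by
  have : IsManifold (𝓡 n) 1 M := IsManifold.of_le (n := ∞) (by norm_cast)
  have h0 : ContMDiffOn 𝓘(ℝ, (Euc m × Euc d) × ℝ) (𝓡 n) 1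
      (fun q : (Euc m × Euc d) × ℝ => Ψ.chart.symm q.1) (Ψ.chart.target ×ˢ S) :=
    (Ψ.contMDiffOn_symm.of_le (by norm_num)).comp contDiff_fst.contMDiff.contMDiffOn
      (fun q hq => hq.1)
  have h1 : ContMDiffOn 𝓘(ℝ, (Euc m × Euc d) × ℝ) ((𝓡 n).prod 𝓘(ℝ, ℝ)) 1
      (fun q : (Euc m × Euc d) × ℝ => (Ψ.chart.symm q.1, q.2)) (Ψ.chart.target ×ˢ S) :=
    h0.prodMk contDiff_snd.contMDiff.contMDiffOn
  have h2 := hX.comp h1 (fun q hq => ⟨mem_univ _, hq.2⟩)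
  have h3 := contMDiffOn_mfderiv_apply_vectorSpace Ψ.chart.open_source Ψ.contMDiffOn
    (b := fun q : (Euc m × Euc d) × ℝ => Ψ.chart.symm q.1)
    (W := fun q => X q.2 (Ψ.chart.symm q.1)) (fun q hq => Ψ.chart.map_target hq.1) h2
  exact contMDiffOn_iff_contDiffOn.1 (h3.congr fun q _ => rfl)

theorem AdaptedChart.exists_lipschitzOnWith_field (Ψ : AdaptedChart n d h) {a b : ℝ}
    (hX : ContMDiffOn ((𝓡 n).prod 𝓘(ℝ, ℝ)) (𝓡 n).tangent 1
      (fun p : M × ℝ => (⟨p.1, X p.2 p.1⟩ : TangentBundle (𝓡 n) M)) (univ ×ˢ Icc a b))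
    {B : Set (Euc m × Euc d)} (hB : IsCompact B) (hBc : Convex ℝ B) (hBt : B ⊆ Ψ.chart.target) :
    ∃ K, LipschitzOnWith K (Ψ.field X) (B ×ˢ Icc a b) :=
  ((Ψ.contDiffOn_field hX).mono (prod_mono_left hBt)).exists_lipschitzOnWith one_ne_zero
    (hBc.prod (convex_Icc a b)) (hB.prod isCompact_Icc)

omit [IsManifold (𝓡 n) ∞ M] in
theorem AdaptedChart.exists_closedBall_subset_target (Ψ : AdaptedChart n d h) {x : M}
    (hx : x ∈ Ψ.chart.source) : ∃ R > 0, Metric.closedBall (Ψ.chart x) R ⊆ Ψ.chart.target :=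
  Metric.nhds_basis_closedBall.mem_iff.1
    (Ψ.chart.open_target.mem_nhds (Ψ.chart.map_source hx))

theorem lipschitzInChartAt_of_contMDiffOn {e a b : ℝ} (Ψ : AdaptedChart n d h)
    (hX : ContMDiffOn ((𝓡 n).prod 𝓘(ℝ, ℝ)) (𝓡 n).tangent 1
      (fun p : M × ℝ => (⟨p.1, X p.2 p.1⟩ : TangentBundle (𝓡 n) M)) (univ ×ˢ Icc a b))
    (he : e ∈ Icc a b) {x : M} (hx : x ∈ Ψ.chart.source) :
    LipschitzInChartAt (Euc m × Euc d) (X e) x := by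
  obtain ⟨R, hR, hRt⟩ := Ψ.exists_closedBall_subset_target hx
  obtain ⟨K, hK⟩ := Ψ.exists_lipschitzOnWith_field hX (isCompact_closedBall _ _)
    (convex_closedBall (Ψ.chart x) R) hRt
  refine ⟨Ψ.chart.source ∩ Ψ.chart ⁻¹' Metric.ball (Ψ.chart x) R, Ψ.chart,
    fun u => Ψ.field X (u, e), K, Ψ.chart.isOpen_inter_preimage Metric.isOpen_ball,
    ⟨hx, Metric.mem_ball_self hR⟩, fun y hy => Ψ.mdifferentiableAt hy.1,
    Ψ.chart.injOn.mono inter_subset_left, ?_, fun y hy => (Ψ.field_apply e hy.1).symm⟩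
  rintro _ ⟨y, hy, rfl⟩ _ ⟨z, hz, rfl⟩
  refine (hK (x := (Ψ.chart y, e)) (y := (Ψ.chart z, e))
    ⟨Metric.ball_subset_closedBall hy.2, he⟩ ⟨Metric.ball_subset_closedBall hz.2, he⟩).trans ?_
  simp [Prod.edist_eq]

end ChartFields

/-! ### Ergodicity makes `h` proper -/

section Properness

variable {n m : ℕ} {M : Type*} [TopologicalSpace M] [ChartedSpace (Euc n) M]
  [IsManifold (𝓡 n) ∞ M] {h : M → Euc m} [MeasurableSpace M] [BorelSpace M]

omit [MeasurableSpace M] [BorelSpace M] in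
theorem isOpenMap_of_surjective_mfderiv (hh : ContMDiff (𝓡 n) (𝓡 m) 2 h)
    (hindep : ∀ x : M, Function.Surjective (mfderiv (𝓡 n) (𝓡 m) h x)) : IsOpenMap h := by
  refine IsOpenMap.of_nhds_le fun x => ?_
  have : Nonempty M := ⟨x⟩
  have hmn := le_of_surjective_mfderiv hindep
  obtain ⟨Ψ, hΨ⟩ := exists_adaptedChart (d := n - m) (by omega) hh x (hindep x)
  have h1 : map h (𝓝 x) = map Prod.fst (map Ψ.chart (𝓝 x)) := by
    rw [map_map]
    refine map_congr ?_
    filter_upwards [Ψ.chart.open_source.mem_nhds hΨ] with y hy using (Ψ.fst_apply y hy).symm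
  rw [h1, Ψ.chart.map_nhds_eq hΨ, ← Ψ.fst_apply x hΨ, map_fst_nhds]

variable [T2Space M] [SecondCountableTopology M]
  (g : Bundle.ContMDiffRiemannianMetric (𝓡 n) ∞ (EuclideanSpace ℝ (Fin n))
      (fun x : M => TangentSpace (𝓡 n) x)) {ρ : M → ℝ} {X : (x : M) → TangentSpace (𝓡 n) x}
  {U : Set (Euc m)}

omit [SecondCountableTopology M] in
/-- If the flow of `X` is ergodic on almost every level set of `h`, all of which are compact, then
`h` is proper. -/
theorem exists_precompact_preimage_nhds (hh : ContMDiff (𝓡 n) (𝓡 m) 2 h)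
    (hindep : ∀ x : M, Function.Surjective (mfderiv (𝓡 n) (𝓡 m) h x))
    (hρc : ContMDiff (𝓡 n) 𝓘(ℝ, ℝ) 1 ρ) (hρ : ∀ x, 0 < ρ x)
    {F : Type*} [NormedAddCommGroup F] [NormedSpace ℝ F]
    (hX : ∀ x, LipschitzInChartAt F X x)
    (hint : ∀ (t : ℝ) (x : M), h (flowMap X t x) = h x) (hU : IsOpen U)
    (herg : ∀ᵐ c : Euc m, c ∈ U → IsErgodicOn (flowMap X) (h ⁻¹' {c}) (fiberMeasure g h ρ c))
    {c : Euc m} (hc : c ∈ U) (hcc : IsCompact (h ⁻¹' {c})) (hcne : (h ⁻¹' {c}).Nonempty) :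
    ∃ K, IsCompact K ∧ ∀ᶠ c' in 𝓝 c, h ⁻¹' {c'} ⊆ K := by
  have : LocallyCompactSpace M := ChartedSpace.locallyCompactSpace (EuclideanSpace ℝ (Fin n)) M
  have hop := isOpenMap_of_surjective_mfderiv hh hindep
  obtain ⟨K, hK, hKn⟩ := exists_compact_superset hcc
  have hfr : IsCompact (frontier K) := hK.of_isClosed_subset isClosed_frontier
    hK.isClosed.frontier_subset
  -- the level sets near `c` do not meet the frontier of `K`
  have h1 : ∀ᶠ c' in 𝓝 c, ∀ x ∈ frontier K, h x ≠ c' := by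
    have h2 : (h '' frontier K)ᶜ ∈ 𝓝 c := by
      refine (hfr.image hh.continuous).isClosed.isOpen_compl.mem_nhds ?_
      rintro ⟨x, hx, hxc⟩
      exact hx.2 (hKn hxc)
    filter_upwards [h2] with c' hc' x hx hxc
    exact hc' ⟨x, hx, hxc⟩
  have h2 : ∀ᶠ c' in 𝓝 c, ∃ x ∈ interior K, h x = c' := by
    obtain ⟨x, hx⟩ := hcne
    have := (hop _ isOpen_interior).mem_nhds ⟨x, hKn hx, hx⟩
    filter_upwards [this] with c' hc' using hc'
  obtain ⟨W, hW, hWo, hcW⟩ := eventually_nhds_iff.1 ((h1.and h2).and (hU.mem_nhds hc))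
  refine ⟨K, hK, ?_⟩
  filter_upwards [hWo.mem_nhds hcW] with c₁ hc₁ x₁ hx₁
  -- A level set near `c` that leaves `K` also meets the interior of `K`. Since `h` is open, the
  -- same holds for all values near `c₁`, hence for a set of values of positive Lebesgue measure.
  by_contra hxK
  have h3 : ∀ᶠ c' in 𝓝 c₁, ∃ x ∈ Kᶜ, h x = c' := by
    have := (hop _ hK.isClosed.isOpen_compl).mem_nhds ⟨x₁, hxK, hx₁⟩
    filter_upwards [this] with c' hc' using hc'
  obtain ⟨W', hW', hWo', hcW'⟩ := eventually_nhds_iff.1 (h3.and (hWo.mem_nhds hc₁))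
  have h4 : ∃ c' ∈ W', IsErgodicOn (flowMap X) (h ⁻¹' {c'}) (fiberMeasure g h ρ c') := by
    by_contra hcon
    push Not at hcon
    have h5 : volume W' = 0 := by
      refine measure_mono_null (fun c' hc' => ?_) (ae_iff.1 herg)
      simp only [mem_ofPred_eq, Classical.not_imp]
      exact ⟨(hW c' (hW' c' hc').2).2, hcon c' hc'⟩
    exact (hWo'.measure_pos volume ⟨c₁, hcW'⟩).ne' h5
  obtain ⟨c', hc', hergc⟩ := h4
  obtain ⟨⟨hf, x, hxK', hxc⟩, -⟩ := hW c' (hW' c' hc').2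
  obtain ⟨⟨y, hyK, hyc⟩, -⟩ := hW' c' hc'
  -- an orbit in the level set of `c'` stays in the interior of `K` or in the complement
  have hinv : ∀ t : ℝ, ∀ z ∈ h ⁻¹' {c'}, flowMap X t z ∈ interior K ↔ z ∈ interior K := by
    intro t z hz
    rcases flowMap_eq_self_or hX t z with ht | ⟨γ, hγc, hγ0, hγ⟩
    · rw [ht]
    have hγh : ∀ s ∈ uIcc 0 t, γ s ∉ frontier K := by
      intro s hs hfrs
      refine hf _ hfrs ?_
      rw [← hγ s hs, hint]
      exact hz
    have hpre : IsPreconnected (γ '' uIcc 0 t) := isPreconnected_uIcc.image _ hγc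
    have hsub : γ '' uIcc 0 t ⊆ interior K ∪ Kᶜ := by
      rintro _ ⟨s, hs, rfl⟩
      by_contra hcon
      simp only [mem_union, mem_compl_iff, not_or, not_not] at hcon
      exact hγh s hs ⟨subset_closure hcon.2, hcon.1⟩
    have hdisj : Disjoint (interior K) Kᶜ :=
      disjoint_compl_right.mono_left interior_subset
    rw [hγ t right_mem_uIcc, ← hγ0]
    rcases hpre.subset_or_subset isOpen_interior hK.isClosed.isOpen_compl hdisj hsub with h6 | h6
    · exact iff_of_true (h6 (mem_image_of_mem _ right_mem_uIcc))
        (h6 (mem_image_of_mem _ left_mem_uIcc))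
    · exact iff_of_false
        (fun h7 => h6 (mem_image_of_mem _ right_mem_uIcc) (interior_subset h7))
        (fun h7 => h6 (mem_image_of_mem _ left_mem_uIcc) (interior_subset h7))
  have hpos1 := fiberMeasure_pos_of_isOpen g hh hindep hρc hρ isOpen_interior hxK'
  have hpos2 := fiberMeasure_pos_of_isOpen g hh hindep hρc hρ hK.isClosed.isOpen_compl hyK
  rw [hxc] at hpos1
  rw [hyc] at hpos2
  rcases hergc _ isOpen_interior.measurableSet hinv with h8 | h8
  · exact hpos1.ne' h8
  · exact hpos2.ne' (measure_mono_null (compl_subset_compl.2 interior_subset) h8)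

omit [MeasurableSpace M] [BorelSpace M] [T2Space M] [SecondCountableTopology M] in
theorem isCompact_preimage (hh : Continuous h) {V : Set (Euc m)} (hV : IsCompact V)
    (hloc : ∀ c ∈ V, ∃ K : Set M, IsCompact K ∧ ∀ᶠ c' in 𝓝 c, h ⁻¹' {c'} ⊆ K) :
    IsCompact (h ⁻¹' V) := by
  choose! K hK hKc using hloc
  obtain ⟨t, ht, hVt⟩ := hV.elim_nhds_subcover (fun c => {c' | h ⁻¹' {c'} ⊆ K c}) hKc
  refine (t.isCompact_biUnion (fun c hc => hK c (ht c hc))).of_isClosed_subset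
    (hV.isClosed.preimage hh) (fun x hx => ?_)
  obtain ⟨c, hc, hxc⟩ := mem_iUnion₂.1 (hVt hx)
  exact mem_iUnion₂.2 ⟨c, hc, hxc rfl⟩

end Properness
end Averaging

namespace Averaging

/-! ### Local flows with a parameter -/

section LocalFlow

variable {n m d : ℕ} {M : Type*} [TopologicalSpace M] [ChartedSpace (Euc n) M]
  [IsManifold (𝓡 n) ∞ M] {h : M → Euc m} {X : ℝ → (x : M) → TangentSpace (𝓡 n) x}
  {a b : ℝ}

omit [IsManifold (𝓡 n) ∞ M] in
theorem AdaptedChart.mfderiv_symm_chartField (Ψ : AdaptedChart n d h)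
    (Y : (x : M) → TangentSpace (𝓡 n) x) {x : M} (hx : x ∈ Ψ.chart.source) :
    mfderiv 𝓘(ℝ, Euc m × Euc d) (𝓡 n) Ψ.chart.symm (Ψ.chart x)
      (chartField (F := Euc m × Euc d) Ψ.chart Y x) = Y x := by
  have h1 := Ψ.mdifferentiableAt hx
  have h2 := Ψ.mdifferentiableAt_symm (Ψ.chart.map_source hx)
  have h3 : mfderiv (𝓡 n) (𝓡 n) (Ψ.chart.symm ∘ Ψ.chart) x = ContinuousLinearMap.id ℝ _ := by
    rw [← mfderiv_id (I := 𝓡 n) (x := x)]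
    refine Filter.EventuallyEq.mfderiv_eq ?_
    filter_upwards [Ψ.chart.open_source.mem_nhds hx] with y hy using Ψ.chart.left_inv hy
  rw [mfderiv_comp x h2 h1] at h3
  exact congrArg (fun L : Euc n →L[ℝ] Euc n => L (Y x)) h3

/-- The parameter is adjoined to the state as a coordinate with derivative zero; the Picard–Lindelöf
theorem for the enlarged equation then gives continuity in time, initial point and parameter
together. -/
theorem exists_local_flow (Ψ : AdaptedChart n d h)
    (hX : ContMDiffOn ((𝓡 n).prod 𝓘(ℝ, ℝ)) (𝓡 n).tangent 1
      (fun p : M × ℝ => (⟨p.1, X p.2 p.1⟩ : TangentBundle (𝓡 n) M)) (univ ×ˢ Icc a b))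
    {e₀ : ℝ} (he₀ : e₀ ∈ Icc a b) {x₀ : M} (hx₀ : x₀ ∈ Ψ.chart.source) :
    ∃ s₀ > 0, ∃ O ∈ 𝓝 x₀, ∃ r > 0, ∃ β : ℝ × ℝ × M → M,
      ContinuousOn β (Metric.ball e₀ r ×ˢ Ioo (-s₀) s₀ ×ˢ O) ∧
      ∀ e ∈ Metric.ball e₀ r ∩ Icc a b, ∀ x ∈ O, β (e, 0, x) = x ∧
        IsMIntegralCurveOn (fun t => β (e, t, x)) (X e) (Ioo (-s₀) s₀) := by
  obtain ⟨R, hR, hRt⟩ := Ψ.exists_closedBall_subset_target hx₀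
  obtain ⟨K, hK⟩ := Ψ.exists_lipschitzOnWith_field hX (isCompact_closedBall _ _)
    (convex_closedBall (Ψ.chart x₀) R) hRt
  have hab : a ≤ b := he₀.1.trans he₀.2
  set u₀ := Ψ.chart x₀
  -- Composition with the projection onto `[a, b]` extends the field to all parameters with the same
  -- Lipschitz constant, so that parameters at the end points are covered as well.
  set F : (Euc m × Euc d) × ℝ → (Euc m × Euc d) × ℝ :=
    fun q => (Ψ.field X (q.1, projIcc a b hab q.2), 0) with hF
  let R' : NNReal := ⟨R, hR.le⟩
  have hFl : LipschitzOnWith K F (Metric.closedBall (u₀, e₀) R) := by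
    intro p hp q hq
    rw [← closedBall_prod_same] at hp hq
    have h1 := hK (x := (p.1, (projIcc a b hab p.2 : ℝ))) (y := (q.1, (projIcc a b hab q.2 : ℝ)))
      ⟨hp.1, (projIcc a b hab p.2).2⟩ ⟨hq.1, (projIcc a b hab q.2).2⟩
    have h2 := (LipschitzWith.projIcc hab).edist_le_mul p.2 q.2
    rw [ENNReal.coe_one, one_mul] at h2
    calc edist (F p) (F q) = edist (Ψ.field X (p.1, (projIcc a b hab p.2 : ℝ)))
          (Ψ.field X (q.1, (projIcc a b hab q.2 : ℝ))) := by simp [hF, Prod.edist_eq]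
      _ ≤ _ := h1
      _ ≤ K * edist p q := by
        gcongr
        rw [Prod.edist_eq, Prod.edist_eq]
        exact max_le_max le_rfl h2
  obtain ⟨L, hL⟩ : ∃ L : NNReal, ∀ q ∈ Metric.closedBall (u₀, e₀) R, ‖F q‖ ≤ L := by
    obtain ⟨C, hC⟩ := (isCompact_closedBall (u₀, e₀) R).exists_bound_of_continuousOn
      hFl.continuousOn
    exact ⟨C.toNNReal, fun q hq => (hC q hq).trans (Real.le_coe_toNNReal C)⟩
  set s : ℝ := R / 2 / (L + 1) with hs
  have hs0 : 0 < s := by positivity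
  have hpl : IsPicardLindelof (fun _ : ℝ => F) (tmin := -s) (tmax := s) ⟨0, by simp [hs0.le]⟩
      (u₀, e₀) R' (R' / 2) L K := by
    refine IsPicardLindelof.of_time_independent hL hFl ?_
    have : (L : ℝ) * s ≤ R / 2 := by
      rw [hs, mul_div_assoc', div_le_iff₀ (by positivity)]
      nlinarith
    simp only [sub_zero, zero_sub, neg_neg, max_self]
    refine this.trans (le_of_eq ?_)
    change R / 2 = R - R / 2
    ring
  obtain ⟨α, hα, hαc⟩ := hpl.exists_forall_mem_closedBall_eq_hasDerivWithinAt_continuousOn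
  have hr2 : ((R' / 2 : NNReal) : ℝ) = R / 2 := rfl
  rw [hr2] at hα hαc
  have hα0 : ∀ q ∈ Metric.closedBall (u₀, e₀) (R / 2), α (q, 0) = q := fun q hq => (hα q hq).1
  have hα2 : ∀ q ∈ Metric.closedBall (u₀, e₀) (R / 2), ∀ t ∈ Icc (-s) s, (α (q, t)).2 = q.2 := by
    intro q hq t ht
    have h1 : ∀ τ ∈ Icc (-s) s, HasDerivWithinAt (fun τ => (α (q, τ)).2) 0 (Icc (-s) s) τ :=
      fun τ hτ => ((hα q hq).2 τ hτ).snd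
    have h2 := (convex_Icc (-s) s).norm_image_sub_le_of_norm_hasDerivWithin_le (C := 0) h1
      (by simp) (x := 0) (y := t) ⟨by linarith, hs0.le⟩ ht
    rw [zero_mul, norm_le_zero_iff, sub_eq_zero, hα0 q hq] at h2
    exact h2
  have hball : α ⁻¹' Metric.ball (u₀, e₀) R ∈ 𝓝 ((u₀, e₀), (0 : ℝ)) := by
    have h0 : Metric.closedBall (u₀, e₀) (R / 2) ×ˢ Icc (-s) s ∈ 𝓝 ((u₀, e₀), (0 : ℝ)) :=
      prod_mem_nhds (Metric.closedBall_mem_nhds _ (by positivity))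
        (Icc_mem_nhds (by linarith) hs0)
    refine (hαc.continuousAt h0).preimage_mem_nhds ?_
    rw [hα0 _ (Metric.mem_closedBall_self (by positivity))]
    exact Metric.ball_mem_nhds _ hR
  obtain ⟨r, hr, hrs⟩ := Metric.mem_nhds_iff.1 hball
  -- One radius for parameter, time and initial point: `R / 2` and `s` keep them in the domain of
  -- the solution map, and `r` keeps the solution in the chart.
  set ρ := min r (min (R / 2) s) with hρ
  have hρ0 : 0 < ρ := by positivity
  have hρr : ρ ≤ r := min_le_left _ _
  have hρR : ρ ≤ R / 2 := (min_le_right _ _).trans (min_le_left _ _)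
  have hρs : ρ ≤ s := (min_le_right _ _).trans (min_le_right _ _)
  have key : ∀ e ∈ Metric.ball e₀ ρ, ∀ x ∈ Ψ.chart ⁻¹' Metric.ball u₀ ρ, ∀ t ∈ Ioo (-ρ) ρ,
      (Ψ.chart x, e) ∈ Metric.closedBall (u₀, e₀) (R / 2) ∧ t ∈ Icc (-s) s ∧
      (α ((Ψ.chart x, e), t)).1 ∈ Metric.ball u₀ R := by
    intro e he x hx t ht
    refine ⟨?_, ⟨by linarith [ht.1], by linarith [ht.2]⟩, ?_⟩
    · rw [← closedBall_prod_same]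
      exact ⟨Metric.ball_subset_closedBall (Metric.ball_subset_ball hρR hx),
        Metric.ball_subset_closedBall (Metric.ball_subset_ball hρR he)⟩
    · have h1 : ((Ψ.chart x, e), t) ∈ Metric.ball ((u₀, e₀), (0 : ℝ)) r := by
        rw [← ball_prod_same, ← ball_prod_same]
        refine ⟨⟨Metric.ball_subset_ball hρr hx, Metric.ball_subset_ball hρr he⟩, ?_⟩
        rw [Metric.mem_ball, Real.dist_eq, sub_zero]
        exact (abs_lt.2 ht).trans_le hρr
      have h2 := hrs h1
      rw [mem_preimage, ← ball_prod_same] at h2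
      exact h2.1
  have hRb : Metric.ball u₀ R ⊆ Ψ.chart.target := Metric.ball_subset_closedBall.trans hRt
  refine ⟨ρ, hρ0, Ψ.chart.source ∩ Ψ.chart ⁻¹' Metric.ball u₀ ρ,
    (Ψ.chart.isOpen_inter_preimage Metric.isOpen_ball).mem_nhds ⟨hx₀, Metric.mem_ball_self hρ0⟩,
    ρ, hρ0, fun p => Ψ.chart.symm (α ((Ψ.chart p.2.2, p.1), p.2.1)).1, ?_, ?_⟩
  · refine Ψ.chart.continuousOn_symm.comp (continuous_fst.comp_continuousOn (hαc.comp
      (((Ψ.chart.continuousOn.comp (continuous_snd.comp continuous_snd).continuousOn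
        (fun p hp => hp.2.2.1)).prodMk continuousOn_fst).prodMk
        (continuous_fst.comp continuous_snd).continuousOn) ?_)) ?_
    · rintro ⟨e, t, x⟩ ⟨he, ht, hx⟩
      exact ⟨(key e he x hx.2 t ht).1, (key e he x hx.2 t ht).2.1⟩
    · rintro ⟨e, t, x⟩ ⟨he, ht, hx⟩
      exact hRb (key e he x hx.2 t ht).2.2
  · rintro e ⟨he, heI⟩ x ⟨hx, hxρ⟩
    refine ⟨?_, fun t ht => ?_⟩
    · change Ψ.chart.symm (α ((Ψ.chart x, e), 0)).1 = x
      rw [hα0 _ (key e he x hxρ 0 ⟨by linarith, hρ0⟩).1]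
      exact Ψ.chart.left_inv hx
    · obtain ⟨k1, k2, k3⟩ := key e he x hxρ t ht
      have hsub : Ioo (-ρ) ρ ⊆ Icc (-s) s := fun τ hτ => (key e he x hxρ τ hτ).2.1
      have h1 : HasDerivWithinAt (fun τ => (α ((Ψ.chart x, e), τ)).1)
          (Ψ.field X ((α ((Ψ.chart x, e), t)).1, e)) (Ioo (-ρ) ρ) t := by
        have h2 := (((hα _ k1).2 t k2).mono hsub).fst
        simp only [hF, hα2 _ k1 t k2] at h2
        rwa [projIcc_of_mem hab heI] at h2
      have h3 := hasMFDerivWithinAt_comp_of_hasDerivWithinAt h1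
        (Ψ.mdifferentiableAt_symm (hRb k3))
      refine h3.congr_mfderiv ?_
      congr 1
      have h4 := Ψ.mfderiv_symm_chartField (X e) (Ψ.chart.map_target (hRb k3))
      rw [Ψ.chart.right_inv (hRb k3)] at h4
      exact h4

end LocalFlow
end Averaging

namespace Averaging

/-! ### Global flows of compactly supported fields -/

section GlobalFlow

variable {n m d : ℕ} {M : Type*} [TopologicalSpace M] [ChartedSpace (Euc n) M]
  {h : M → Euc m} {X : ℝ → (x : M) → TangentSpace (𝓡 n) x} {a b : ℝ}

/-- The global flows of the fields `X e`, `e ∈ S`. -/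
structure GlobalFlow (X : ℝ → (x : M) → TangentSpace (𝓡 n) x) (S : Set ℝ) where
  toFun : ℝ → ℝ → M → M
  map_zero : ∀ e ∈ S, ∀ x, toFun e 0 x = x
  map_add : ∀ e ∈ S, ∀ s t x, toFun e (s + t) x = toFun e t (toFun e s x)
  isMIntegralCurve : ∀ e ∈ S, ∀ x, IsMIntegralCurve (fun t => toFun e t x) (X e)
  continuousOn : ContinuousOn (fun p : ℝ × ℝ × M => toFun p.1 p.2.1 p.2.2) (S ×ˢ univ)

variable [IsManifold (𝓡 n) ∞ M] [T2Space M]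

/-- By compactness the local existence time is bounded below on `K`, and outside of `K` constant
curves are solutions. A uniform existence time yields curves for all times. -/
theorem exists_isMIntegralCurve_of_compact_support
    (hch : ∀ x : M, ∃ Ψ : AdaptedChart n d h, x ∈ Ψ.chart.source)
    (hX : ContMDiffOn ((𝓡 n).prod 𝓘(ℝ, ℝ)) (𝓡 n).tangent 1
      (fun p : M × ℝ => (⟨p.1, X p.2 p.1⟩ : TangentBundle (𝓡 n) M)) (univ ×ˢ Icc a b))
    {K : Set M} (hK : IsCompact K) (hXK : ∀ e ∈ Icc a b, ∀ x ∉ K, X e x = 0)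
    {e : ℝ} (he : e ∈ Icc a b) (x : M) :
    ∃ γ : ℝ → M, γ 0 = x ∧ IsMIntegralCurve γ (X e) := by
  have : IsManifold (𝓡 n) 1 M := IsManifold.of_le (n := ∞) (by norm_cast)
  have hloc : ∀ x : M, ∃ s > 0, ∃ O ∈ 𝓝 x, ∀ y ∈ O, ∃ γ : ℝ → M, γ 0 = y ∧
      IsMIntegralCurveOn γ (X e) (Ioo (-s) s) := by
    intro x
    obtain ⟨Ψ, hΨ⟩ := hch x
    obtain ⟨s, hs, O, hO, r, hr, β, -, hβ⟩ := exists_local_flow Ψ hX he hΨ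
    exact ⟨s, hs, O, hO, fun y hy => ⟨fun t => β (e, t, y), hβ e ⟨Metric.mem_ball_self hr, he⟩ y hy⟩⟩
  choose s hs O hO hγ using hloc
  obtain ⟨t, -, ht⟩ := hK.elim_nhds_subcover O (fun x _ => hO x)
  obtain ⟨σ, hσ, hσt⟩ : ∃ σ > 0, ∀ y ∈ t, σ ≤ s y := by
    rcases t.eq_empty_or_nonempty with h0 | h0
    · exact ⟨1, one_pos, by simp [h0]⟩
    · exact ⟨t.inf' h0 s, (Finset.lt_inf'_iff _).2 fun y _ => hs y,
        fun y hy => Finset.inf'_le s hy⟩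
  refine exists_isMIntegralCurve_of_isMIntegralCurveOn ?_ hσ (fun y => ?_) x
  · have h1 := hX.comp (contMDiff_id.prodMk (contMDiff_const (c := e))).contMDiffOn
      (s := univ) (fun x _ => ⟨mem_univ _, he⟩)
    exact contMDiffOn_univ.1 h1
  · by_cases hy : y ∈ K
    · obtain ⟨z, hz, hyz⟩ := mem_iUnion₂.1 (ht hy)
      obtain ⟨γ, h0, h1⟩ := hγ z y hyz
      exact ⟨γ, h0, h1.mono (Ioo_subset_Ioo (neg_le_neg (hσt z hz)) (hσt z hz))⟩
    · exact ⟨fun _ => y, rfl, (isMIntegralCurve_const (hXK e he y hy)).isMIntegralCurveOn _⟩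

/-- The difficulty is joint continuity in parameter, time and point. It holds for short times by the
local flows, and the group property carries it along each orbit. -/
theorem nonempty_globalFlow
    (hch : ∀ x : M, ∃ Ψ : AdaptedChart n d h, x ∈ Ψ.chart.source)
    (hX : ContMDiffOn ((𝓡 n).prod 𝓘(ℝ, ℝ)) (𝓡 n).tangent 1
      (fun p : M × ℝ => (⟨p.1, X p.2 p.1⟩ : TangentBundle (𝓡 n) M)) (univ ×ˢ Icc a b))
    {K : Set M} (hK : IsCompact K) (hXK : ∀ e ∈ Icc a b, ∀ x ∉ K, X e x = 0) :
    Nonempty (GlobalFlow X (Icc a b)) := by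
  classical
  choose! φ hφ0 hφ using fun e (he : e ∈ Icc a b) x =>
    exists_isMIntegralCurve_of_compact_support hch hX hK hXK he x
  have hlip : ∀ e ∈ Icc a b, ∀ x, LipschitzInChartAt (Euc m × Euc d) (X e) x := by
    intro e he x
    obtain ⟨Ψ, hΨ⟩ := hch x
    exact lipschitzInChartAt_of_contMDiffOn Ψ hX he hΨ
  have huniq : ∀ e ∈ Icc a b, ∀ (γ : ℝ → M) (t : ℝ), IsMIntegralCurveOn γ (X e) (uIcc 0 t) →
      γ t = φ e (γ 0) t := fun e he γ t hγ =>
    eqOn_uIcc_of_isMIntegralCurveOn (fun s _ => hlip e he (γ s)) hγ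
      ((hφ e he (γ 0)).isMIntegralCurveOn _) (hφ0 e he (γ 0)).symm right_mem_uIcc
  have hadd : ∀ e ∈ Icc a b, ∀ s t x, φ e x (s + t) = φ e (φ e x s) t := by
    intro e he s t x
    have h1 := huniq e he (fun τ => φ e x (τ + s)) t
      (((hφ e he x).comp_add s).isMIntegralCurveOn _)
    simp only [zero_add] at h1
    rw [add_comm, h1]
  set G : ℝ × ℝ × M → M := fun p => φ p.1 p.2.2 p.2.1 with hG
  have hloc : ∀ e₀ ∈ Icc a b, ∀ y : M, ∃ σ > 0, ∃ O ∈ 𝓝 y, ∀ z ∈ interior O, ∀ t ∈ Ioo (-σ) σ,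
      ContinuousWithinAt G (Icc a b ×ˢ univ) (e₀, t, z) := by
    intro e₀ he₀ y
    obtain ⟨Ψ, hΨ⟩ := hch y
    obtain ⟨σ, hσ, O, hO, r, hr, β, hβc, hβ⟩ := exists_local_flow Ψ hX he₀ hΨ
    refine ⟨σ, hσ, O, hO, fun z hz t ht => ?_⟩
    have hn : Metric.ball e₀ r ×ˢ Ioo (-σ) σ ×ˢ O ∈ 𝓝 (e₀, t, z) :=
      prod_mem_nhds (Metric.ball_mem_nhds _ hr) (prod_mem_nhds (Ioo_mem_nhds ht.1 ht.2)
        (mem_interior_iff_mem_nhds.1 hz))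
    have heq : ∀ p ∈ Metric.ball e₀ r ×ˢ Ioo (-σ) σ ×ˢ O, p.1 ∈ Icc a b → β p = G p := by
      rintro ⟨e, τ, w⟩ ⟨he, hτ, hw⟩ heI
      obtain ⟨hb0, hb⟩ := hβ e ⟨he, heI⟩ w hw
      have h1 := huniq e heI (fun t => β (e, t, w)) τ (hb.mono (by
        intro u hu
        have h0 : (0 : ℝ) ∈ Ioo (-σ) σ := ⟨by linarith, hσ⟩
        exact ordConnected_Ioo.uIcc_subset h0 hτ hu))
      simp only [hb0] at h1
      exact h1
    refine ((hβc.continuousAt hn).continuousWithinAt).congr_of_eventuallyEq ?_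
      (heq _ (mem_of_mem_nhds hn) he₀).symm
    filter_upwards [mem_nhdsWithin_of_mem_nhds hn, self_mem_nhdsWithin] with p hp hpI
    exact (heq p hp hpI.1).symm
  have hcurve : ∀ e ∈ Icc a b, ∀ x, Continuous (fun t => φ e x t) :=
    fun e he x => (hφ e he x).continuous
  have hcont : ∀ e₀ ∈ Icc a b, ∀ x₀ t₀, ContinuousWithinAt G (Icc a b ×ˢ univ) (e₀, t₀, x₀) := by
    intro e₀ he₀ x₀
    set P : Set ℝ := {t | ContinuousWithinAt G (Icc a b ×ˢ univ) (e₀, t, x₀)} with hP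
    -- For two times near `t₂`, the flow up to `t` is the flow up to `t₁` followed by a flow of
    -- duration less than `σ`, which starts in the region where local continuity is known. Hence the
    -- times of continuity form a clopen set.
    have hstep : ∀ t₂ : ℝ, ∃ J ∈ 𝓝 t₂, ∀ t₁ ∈ J, ∀ t ∈ J, t₁ ∈ P → t ∈ P := by
      intro t₂
      obtain ⟨σ, hσ, O, hO, hc⟩ := hloc e₀ he₀ (φ e₀ x₀ t₂)
      have h1 : (fun t => φ e₀ x₀ t) ⁻¹' interior O ∈ 𝓝 t₂ :=
        (hcurve e₀ he₀ x₀).continuousAt.preimage_mem_nhds (interior_mem_nhds.2 hO)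
      refine ⟨_, Filter.inter_mem h1 (Metric.ball_mem_nhds t₂ (half_pos hσ)), ?_⟩
      rintro t₁ ⟨ht₁, ht₁'⟩ t ⟨-, ht'⟩ hP1
      have h2 : t - t₁ ∈ Ioo (-σ) σ := by
        rw [Metric.mem_ball, Real.dist_eq, abs_lt] at ht₁' ht'
        constructor <;> linarith [ht₁'.1, ht₁'.2, ht'.1, ht'.2]
      have h3 := hc _ ht₁ (t - t₁) h2
      have h4 : ContinuousWithinAt (fun p : ℝ × ℝ × M => (p.1, p.2.1 - t₁, G (p.1, t₁, p.2.2)))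
          (Icc a b ×ˢ univ) (e₀, t, x₀) := by
        refine continuousWithinAt_fst.prodMk (ContinuousWithinAt.prodMk
          (by fun_prop) ?_)
        exact ContinuousWithinAt.comp (t := Icc a b ×ˢ univ) (g := G)
          (f := fun p : ℝ × ℝ × M => (p.1, t₁, p.2.2)) (x := (e₀, t, x₀)) hP1 (by fun_prop)
          (fun p hp => ⟨hp.1, mem_univ _⟩)
      have h5 := ContinuousWithinAt.comp (t := Icc a b ×ˢ univ) (g := G)
        (f := fun p : ℝ × ℝ × M => (p.1, p.2.1 - t₁, G (p.1, t₁, p.2.2)))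
        (x := (e₀, t, x₀)) h3 h4 (fun p hp => ⟨hp.1, mem_univ _⟩)
      refine h5.congr (fun p hp => ?_) ?_
      · have := hadd p.1 hp.1 t₁ (p.2.1 - t₁) p.2.2
        rw [add_sub_cancel] at this
        exact this
      · have := hadd e₀ he₀ t₁ (t - t₁) x₀
        rw [add_sub_cancel] at this
        exact this
    have hclopen : IsClopen P := by
      refine ⟨⟨isOpen_iff_mem_nhds.2 fun t₂ ht₂ => ?_⟩, isOpen_iff_mem_nhds.2 fun t₂ ht₂ => ?_⟩
      · obtain ⟨J, hJ, hJP⟩ := hstep t₂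
        filter_upwards [hJ] with t ht htP
        exact ht₂ (hJP t ht t₂ (mem_of_mem_nhds hJ) htP)
      · obtain ⟨J, hJ, hJP⟩ := hstep t₂
        filter_upwards [hJ] with t ht
        exact hJP t₂ (mem_of_mem_nhds hJ) t ht ht₂
    have hne : P.Nonempty := by
      obtain ⟨σ, hσ, O, hO, hc⟩ := hloc e₀ he₀ x₀
      exact ⟨0, hc x₀ (mem_interior_iff_mem_nhds.2 hO) 0 (by simp [hσ])⟩
    exact fun t₀ => eq_univ_iff_forall.1 (hclopen.eq_univ hne) t₀
  exact ⟨{ toFun := fun e t x => φ e x t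
           map_zero := hφ0
           map_add := hadd
           isMIntegralCurve := hφ
           continuousOn := fun p hp => hcont p.1 hp.1 p.2.2 p.2.1 }⟩

namespace GlobalFlow

variable {S : Set ℝ} (φ : GlobalFlow X S) {e : ℝ}

omit [IsManifold (𝓡 n) ∞ M] [T2Space M]

theorem continuous (he : e ∈ S) : Continuous (fun p : ℝ × M => φ.toFun e p.1 p.2) :=
  φ.continuousOn.comp_continuous (f := fun p : ℝ × M => (e, p.1, p.2)) (by fun_prop)
    (fun p => ⟨he, mem_univ _⟩)

theorem neg_apply (he : e ∈ S) (t : ℝ) (x : M) : φ.toFun e (-t) (φ.toFun e t x) = x := by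
  rw [← φ.map_add e he, add_neg_cancel, φ.map_zero e he]

theorem apply_neg (he : e ∈ S) (t : ℝ) (x : M) : φ.toFun e t (φ.toFun e (-t) x) = x := by
  rw [← φ.map_add e he, neg_add_cancel, φ.map_zero e he]

/-- The time `t` map of a global flow as a homeomorphism. -/
def homeomorph (he : e ∈ S) (t : ℝ) : M ≃ₜ M where
  toFun := φ.toFun e t
  invFun := φ.toFun e (-t)
  left_inv := φ.neg_apply he t
  right_inv := φ.apply_neg he t
  continuous_toFun := (φ.continuous he).comp (by fun_prop : Continuous fun x : M => (t, x))
  continuous_invFun := (φ.continuous he).comp (by fun_prop : Continuous fun x : M => (-t, x))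

end GlobalFlow
end GlobalFlow
end Averaging

namespace Averaging

/-! ### Short-time Gronwall estimate and second differences -/

section Estimates

variable {F : Type*} [NormedAddCommGroup F] [NormedSpace ℝ F]

/-- A short-time version of Gronwall's inequality, in both time directions. -/
theorem norm_le_of_norm_deriv_le {f f' : ℝ → F} {s L c : ℝ} (hs : 0 ≤ s) (hL : 0 ≤ L) (hc : 0 ≤ c)
    (hLs : L * s ≤ 1 / 2)
    (hf : ∀ t ∈ Icc 0 s, HasDerivWithinAt f (f' t) (Icc 0 s) t)
    (hf' : ∀ t ∈ Icc 0 s, ‖f' t‖ ≤ c + L * ‖f t‖) {t₀ t : ℝ} (ht₀ : t₀ ∈ Icc 0 s)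
    (ht : t ∈ Icc 0 s) : ‖f t‖ ≤ 2 * ‖f t₀‖ + 2 * c * s := by
  have hcont : ContinuousOn f (Icc 0 s) := fun τ hτ => (hf τ hτ).continuousWithinAt
  -- The mean value inequality between `t₀` and a maximum point of the norm bounds the maximum in
  -- terms of itself with the factor `L * s ≤ 1 / 2`, which is absorbed.
  obtain ⟨T, hT, hmax⟩ := isCompact_Icc.exists_isMaxOn (nonempty_Icc.2 hs) hcont.norm
  have hb : ∀ τ ∈ Icc 0 s, ‖f' τ‖ ≤ c + L * ‖f T‖ := fun τ hτ =>
    (hf' τ hτ).trans (by gcongr; exact hmax hτ)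
  have h1 := (convex_Icc 0 s).norm_image_sub_le_of_norm_hasDerivWithin_le hf hb ht₀ hT
  have h2 : ‖T - t₀‖ ≤ s := by
    rw [Real.norm_eq_abs, abs_le]
    constructor <;> linarith [hT.1, hT.2, ht₀.1, ht₀.2]
  have h3 : ‖f T‖ ≤ ‖f t₀‖ + ‖f T - f t₀‖ := by
    have := norm_add_le (f t₀) (f T - f t₀)
    rwa [add_sub_cancel] at this
  have h4 : (c + L * ‖f T‖) * ‖T - t₀‖ ≤ (c + L * ‖f T‖) * s := by gcongr
  have h5 : L * s * ‖f T‖ ≤ 1 / 2 * ‖f T‖ := by gcongr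
  have h6 : ‖f t‖ ≤ ‖f T‖ := hmax ht
  nlinarith

/-- Second differences of a `C¹` function on a compact convex set. -/
theorem exists_norm_second_difference_le {v : F → F} {O B : Set F} (hO : IsOpen O)
    (hv : ContDiffOn ℝ 1 v O) (hB : IsCompact B) (hBc : Convex ℝ B) (hBO : B ⊆ O) :
    ∃ L ≥ 0, ∀ η > 0, ∃ ζ > 0, ∀ u ∈ B, ∀ u' ∈ B, ∀ p ∈ B, ∀ p' ∈ B, ‖u - p‖ ≤ ζ → ‖u' - p'‖ ≤ ζ →
      ‖(v u - v u') - (v p - v p')‖ ≤ L * ‖(u - u') - (p - p')‖ + η * ‖u - u'‖ := by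
  have hd : ContinuousOn (fderiv ℝ v) B := (hv.continuousOn_fderiv_of_isOpen hO le_rfl).mono hBO
  obtain ⟨L, hL⟩ := hB.exists_bound_of_continuousOn hd
  have huc := hB.uniformContinuousOn_of_continuous hd
  refine ⟨max L 0, le_max_right _ _, fun η hη => ?_⟩
  obtain ⟨ζ, hζ, hdist⟩ := Metric.uniformContinuousOn_iff.1 huc η hη
  refine ⟨ζ / 2, by positivity, fun u hu u' hu' p hp p' hp' hup hup' => ?_⟩
  -- Both differences are followed along their segments. The two derivatives of `v` are taken at
  -- points at distance less than `ζ`, so they differ by at most `η`.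
  set g : ℝ → F := fun θ => v (u' + θ • (u - u')) - v (p' + θ • (p - p')) with hg
  have hmem : ∀ {x x' : F}, x ∈ B → x' ∈ B → ∀ θ ∈ Icc (0 : ℝ) 1, x' + θ • (x - x') ∈ B := by
    intro x x' hx hx' θ hθ
    have := hBc hx' hx (sub_nonneg.2 hθ.2) hθ.1 (by ring)
    convert this using 1
    module
  have hder : ∀ {x x' : F}, x ∈ B → x' ∈ B → ∀ θ ∈ Icc (0 : ℝ) 1,
      HasDerivWithinAt (fun θ => v (x' + θ • (x - x'))) (fderiv ℝ v (x' + θ • (x - x')) (x - x'))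
        (Icc 0 1) θ := by
    intro x x' hx hx' θ hθ
    have h1 : HasFDerivAt v (fderiv ℝ v (x' + θ • (x - x'))) (x' + θ • (x - x')) :=
      ((hv.contDiffAt (hO.mem_nhds (hBO (hmem hx hx' θ hθ)))).differentiableAt
        one_ne_zero).hasFDerivAt
    have h2 : HasDerivAt (fun θ : ℝ => x' + θ • (x - x')) (x - x') θ := by
      simpa using ((hasDerivAt_id θ).smul_const (x - x')).const_add x'
    exact (h1.comp_hasDerivAt θ h2).hasDerivWithinAt
  have h1 : ∀ θ ∈ Icc (0 : ℝ) 1, HasDerivWithinAt g (fderiv ℝ v (u' + θ • (u - u')) (u - u') -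
      fderiv ℝ v (p' + θ • (p - p')) (p - p')) (Icc 0 1) θ :=
    fun θ hθ => (hder hu hu' θ hθ).sub (hder hp hp' θ hθ)
  have h2 : ∀ θ ∈ Icc (0 : ℝ) 1, ‖fderiv ℝ v (u' + θ • (u - u')) (u - u') -
      fderiv ℝ v (p' + θ • (p - p')) (p - p')‖ ≤
      max L 0 * ‖(u - u') - (p - p')‖ + η * ‖u - u'‖ := by
    intro θ hθ
    set A := fderiv ℝ v (u' + θ • (u - u'))
    set A' := fderiv ℝ v (p' + θ • (p - p'))
    have h3 : A (u - u') - A' (p - p') = A' ((u - u') - (p - p')) + (A - A') (u - u') := by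
      simp only [map_sub, sub_apply]
      abel
    have h4 : ‖A'‖ ≤ max L 0 := (hL _ (hmem hp hp' θ hθ)).trans (le_max_left _ _)
    have h5 : ‖A - A'‖ ≤ η := by
      rw [← dist_eq_norm]
      refine (hdist _ (hmem hu hu' θ hθ) _ (hmem hp hp' θ hθ) ?_).le
      rw [dist_eq_norm]
      have h6 : u' + θ • (u - u') - (p' + θ • (p - p')) =
          (1 - θ) • (u' - p') + θ • (u - p) := by module
      rw [h6]
      calc ‖(1 - θ) • (u' - p') + θ • (u - p)‖ ≤ (1 - θ) * ‖u' - p'‖ + θ * ‖u - p‖ := by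
            refine (norm_add_le _ _).trans (le_of_eq ?_)
            rw [norm_smul, norm_smul, Real.norm_of_nonneg hθ.1,
              Real.norm_of_nonneg (sub_nonneg.2 hθ.2)]
        _ ≤ (1 - θ) * (ζ / 2) + θ * (ζ / 2) := by
            have := sub_nonneg.2 hθ.2
            have := hθ.1
            gcongr
        _ < ζ := by linarith
    rw [h3]
    refine (norm_add_le _ _).trans (add_le_add ?_ ?_)
    · exact (A'.le_opNorm _).trans (by gcongr)
    · exact ((A - A').le_opNorm _).trans (by gcongr)
  have h7 := (convex_Icc (0 : ℝ) 1).norm_image_sub_le_of_norm_hasDerivWithin_le h1 h2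
    (left_mem_Icc.2 zero_le_one) (right_mem_Icc.2 zero_le_one)
  simp only [hg, one_smul, zero_smul, add_zero, add_sub_cancel, sub_zero, norm_one, mul_one] at h7
  convert h7 using 2
  abel

end Estimates

/-! ### Volumes of images under Lipschitz maps -/

section VolumeDistortion

variable {F : Type*} [NormedAddCommGroup F] [NormedSpace ℝ F] [FiniteDimensional ℝ F]
  [MeasurableSpace F] [BorelSpace F]

/-- A Haar measure is a multiple of the Hausdorff measure of full dimension, for which the bound is
immediate in any norm. Differentiability of `f` is not required. -/
theorem measure_image_le_of_lipschitzOnWith (μ : Measure F) [μ.IsAddHaarMeasure] {f : F → F}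
    {K : NNReal} {s : Set F} (hf : LipschitzOnWith K f s) :
    μ (f '' s) ≤ (K : ℝ≥0∞) ^ Module.finrank ℝ F * μ s := by
  have h1 := Measure.isAddLeftInvariant_eq_smul μ (μH[(Module.finrank ℝ F : ℝ)] : Measure F)
  have h2 := hf.hausdorffMeasure_image_le (d := Module.finrank ℝ F) (by positivity)
  rw [h1]
  simp only [Measure.smul_apply, ENNReal.smul_def, smul_eq_mul]
  rw [mul_left_comm]
  gcongr
  simpa using h2

theorem lintegral_image_le_of_lipschitzOnWith (μ : Measure F) [μ.IsAddHaarMeasure] {f : F → F}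
    {K : NNReal} {s : Set F} (hs : MeasurableSet s) (hf : LipschitzOnWith K f s) (hinj : InjOn f s)
    {w : F → ℝ≥0∞} {C : ℝ≥0∞} (hC : C ≠ ⊤)
    (hw : ∀ x ∈ s, w (f x) ≤ C * w x) :
    ∫⁻ x in f '' s, w x ∂μ ≤ (K : ℝ≥0∞) ^ Module.finrank ℝ F * (C * ∫⁻ x in s, w x ∂μ) := by
  have hemb : MeasurableEmbedding (s.domRestrict f) :=
    hf.continuousOn.measurableEmbedding hs hinj
  have h1 : μ.restrict (f '' s) = (μ.comap (s.domRestrict f)).map (s.domRestrict f) := by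
    rw [hemb.map_comap, range_domRestrict]
  have h2 : μ.comap (s.domRestrict f) ≤
      ((K : ℝ≥0∞) ^ Module.finrank ℝ F) • μ.comap (Subtype.val : s → F) := by
    refine Measure.le_iff.2 fun A hA => ?_
    rw [hemb.comap_apply, Measure.smul_apply, (MeasurableEmbedding.subtype_coe hs).comap_apply,
      smul_eq_mul]
    have h3 : s.domRestrict f '' A = f '' (Subtype.val '' A) := by
      rw [image_image]
      rfl
    rw [h3]
    exact measure_image_le_of_lipschitzOnWith μ (hf.mono (by simp))
  rw [h1, hemb.lintegral_map]
  calc ∫⁻ x, w (s.domRestrict f x) ∂μ.comap (s.domRestrict f)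
      ≤ ∫⁻ x : s, C * w x ∂(((K : ℝ≥0∞) ^ Module.finrank ℝ F) • μ.comap Subtype.val) :=
        lintegral_mono' h2 fun x => hw x x.2
    _ = (K : ℝ≥0∞) ^ Module.finrank ℝ F * ∫⁻ x in s, C * w x ∂μ := by
        rw [lintegral_smul_measure, lintegral_subtype_comap hs (fun x => C * w x), smul_eq_mul]
    _ = _ := by rw [lintegral_const_mul' _ _ hC]

end VolumeDistortion
end Averaging

namespace Averaging

/-! ### Perturbed and unperturbed trajectories in a chart -/

section Comparison

variable {F : Type*} [NormedAddCommGroup F] [NormedSpace ℝ F]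

/-- Bounds for a slowly varying family of vector fields on the set `B`. -/
structure FieldBounds (v : F × ℝ → F) (B : Set F) (ε₀ L : ℝ) : Prop where
  nonneg : 0 ≤ L
  sub_le : ∀ e ∈ Icc 0 ε₀, ∀ u ∈ B, ‖v (u, e) - v (u, 0)‖ ≤ L * e
  sub_sub_le : ∀ e ∈ Icc 0 ε₀, ∀ u ∈ B, ∀ u' ∈ B,
    ‖(v (u, e) - v (u', e)) - (v (u, 0) - v (u', 0))‖ ≤ L * e * ‖u - u'‖
  lipschitz : ∀ e ∈ Icc 0 ε₀, ∀ u ∈ B, ∀ u' ∈ B, ‖v (u, e) - v (u', e)‖ ≤ L * ‖u - u'‖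
  second_difference : ∀ η > 0, ∃ ζ > 0, ∀ u ∈ B, ∀ u' ∈ B, ∀ p ∈ B, ∀ p' ∈ B,
    ‖u - p‖ ≤ ζ → ‖u' - p'‖ ≤ ζ → ‖(v (u, 0) - v (u', 0)) - (v (p, 0) - v (p', 0))‖ ≤
      L * ‖(u - u') - (p - p')‖ + η * ‖u - u'‖

variable {v : F × ℝ → F} {B : Set F} {ε₀ L e s : ℝ} {a a' p p' : ℝ → F}

theorem FieldBounds.norm_sub_le (hv : FieldBounds v B ε₀ L) (he : e ∈ Icc 0 ε₀) (hs : 0 ≤ s)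
    (hLs : L * s ≤ 1 / 2)
    (ha : ∀ t ∈ Icc 0 s, a t ∈ B ∧ HasDerivWithinAt a (v (a t, e)) (Icc 0 s) t)
    (hp : ∀ t ∈ Icc 0 s, p t ∈ B ∧ HasDerivWithinAt p (v (p t, 0)) (Icc 0 s) t)
    (h0 : a 0 = p 0) {t : ℝ} (ht : t ∈ Icc 0 s) : ‖a t - p t‖ ≤ 2 * (L * e) * s := by
  have h00 : (0 : ℝ) ∈ Icc 0 ε₀ := ⟨le_rfl, he.1.trans he.2⟩
  have h1 := norm_le_of_norm_deriv_le (f := fun t => a t - p t) hs hv.nonneg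
    (mul_nonneg hv.nonneg he.1) hLs
    (fun t ht => (ha t ht).2.sub (hp t ht).2) (fun t ht => ?_) (left_mem_Icc.2 hs) ht
  · simpa [h0] using h1
  · have h2 : v (a t, e) - v (p t, 0) = (v (a t, e) - v (a t, 0)) + (v (a t, 0) - v (p t, 0)) := by
      abel
    rw [h2]
    exact (norm_add_le _ _).trans (add_le_add (hv.sub_le e he _ (ha t ht).1)
      (hv.lipschitz 0 h00 _ (ha t ht).1 _ (hp t ht).1))

/-- For `C¹` fields, two pairs of trajectories are compared through the second difference `(a - a')
- (p - p')`, which vanishes at time zero and has derivative at most `O(e) ‖a - a'‖` plus `L` times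
itself. The bound is in terms of the separation of the perturbed end points, so it is a Lipschitz
estimate for `φ_0^s φ_e^{-s}`. -/
theorem FieldBounds.exists_norm_sub_le (hv : FieldBounds v B ε₀ L) (he : e ∈ Ioc 0 ε₀) :
    ∃ s₀ > 0, ∀ s ∈ Icc 0 s₀, L * s ≤ 1 / 2 ∧ ∀ a a' p p' : ℝ → F,
    (∀ t ∈ Icc 0 s, a t ∈ B ∧ HasDerivWithinAt a (v (a t, e)) (Icc 0 s) t) →
    (∀ t ∈ Icc 0 s, a' t ∈ B ∧ HasDerivWithinAt a' (v (a' t, e)) (Icc 0 s) t) →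
    (∀ t ∈ Icc 0 s, p t ∈ B ∧ HasDerivWithinAt p (v (p t, 0)) (Icc 0 s) t) →
    (∀ t ∈ Icc 0 s, p' t ∈ B ∧ HasDerivWithinAt p' (v (p' t, 0)) (Icc 0 s) t) →
    a 0 = p 0 → a' 0 = p' 0 →
    ‖p s - p' s‖ ≤ (1 + 4 * (L + 1) * e * s) * ‖a s - a' s‖ := by
  have heI : e ∈ Icc 0 ε₀ := Ioc_subset_Icc_self he
  have hL := hv.nonneg
  -- The oscillation of the derivative is allowed to be `η = e`. The price is that the admissible
  -- time `s₀` depends on `e`, which is harmless since short steps are iterated later.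
  obtain ⟨ζ, hζ, hsd⟩ := hv.second_difference e he.1
  -- The first bound allows the short-time Gronwall estimate; the second keeps the perturbed and the
  -- unperturbed trajectory within distance `ζ`.
  refine ⟨min (1 / (2 * (L + 1))) (ζ / (2 * (L * e) + 1)), by have := he.1; positivity,
    fun s hs => ?_⟩
  have hLs : L * s ≤ 1 / 2 := by
    have h1 : s ≤ 1 / (2 * (L + 1)) := hs.2.trans (min_le_left _ _)
    rw [le_div_iff₀ (by positivity)] at h1
    nlinarith [hs.1]
  have hζs : 2 * (L * e) * s ≤ ζ := by
    have h1 : s ≤ ζ / (2 * (L * e) + 1) := hs.2.trans (min_le_right _ _)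
    rw [le_div_iff₀ (by have := he.1; positivity)] at h1
    nlinarith [hs.1]
  refine ⟨hLs, fun a a' p p' ha ha' hp hp' h0 h0' => ?_⟩
  have hsI : s ∈ Icc 0 s := ⟨hs.1, le_rfl⟩
  have hA : ∀ t ∈ Icc 0 s, ‖a t - a' t‖ ≤ 2 * ‖a s - a' s‖ := by
    intro t ht
    have h1 := norm_le_of_norm_deriv_le (f := fun t => a t - a' t) hs.1 hL le_rfl hLs
      (fun t ht => (ha t ht).2.sub (ha' t ht).2)
      (fun t ht => by
        rw [zero_add]
        exact hv.lipschitz e heI _ (ha t ht).1 _ (ha' t ht).1) hsI ht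
    simpa using h1
  have h1 := norm_le_of_norm_deriv_le (f := fun t => (a t - a' t) - (p t - p' t)) hs.1 hL
    (c := (L + 1) * e * (2 * ‖a s - a' s‖)) (by have := he.1; positivity) hLs
    (fun t ht => ((ha t ht).2.sub (ha' t ht).2).sub ((hp t ht).2.sub (hp' t ht).2))
    (fun t ht => ?_) (left_mem_Icc.2 hs.1) hsI
  · simp only [h0, h0', sub_self, norm_zero, mul_zero, zero_add] at h1
    have h2 : ‖p s - p' s‖ ≤ ‖a s - a' s‖ + ‖(a s - a' s) - (p s - p' s)‖ := by
      have := _root_.norm_sub_le (a s - a' s) ((a s - a' s) - (p s - p' s))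
      rwa [sub_sub_cancel] at this
    calc _ ≤ _ := h2
      _ ≤ ‖a s - a' s‖ + 2 * ((L + 1) * e * (2 * ‖a s - a' s‖)) * s := by gcongr
      _ = _ := by ring
  · have h2 : v (a t, e) - v (a' t, e) - (v (p t, 0) - v (p' t, 0)) =
        ((v (a t, e) - v (a' t, e)) - (v (a t, 0) - v (a' t, 0))) +
        ((v (a t, 0) - v (a' t, 0)) - (v (p t, 0) - v (p' t, 0))) := by abel
    rw [h2]
    have h3 := hv.sub_sub_le e heI _ (ha t ht).1 _ (ha' t ht).1
    have h4 := hsd _ (ha t ht).1 _ (ha' t ht).1 _ (hp t ht).1 _ (hp' t ht).1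
      ((hv.norm_sub_le heI hs.1 hLs ha hp h0 ht).trans hζs)
      ((hv.norm_sub_le heI hs.1 hLs ha' hp' h0' ht).trans hζs)
    have h5 := hA t ht
    have h6 : (L + 1) * e * ‖a t - a' t‖ ≤ (L + 1) * e * (2 * ‖a s - a' s‖) := by
      have := he.1
      gcongr
    refine (norm_add_le _ _).trans ?_
    linarith

end Comparison

section ChartBounds

variable {n m d : ℕ} {M : Type*} [TopologicalSpace M] [ChartedSpace (Euc n) M]
  [IsManifold (𝓡 n) ∞ M] {h : M → Euc m} {X Y : ℝ → (x : M) → TangentSpace (𝓡 n) x} {ε₀ : ℝ}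

omit [IsManifold (𝓡 n) ∞ M] in
theorem AdaptedChart.hasDerivWithinAt_field (Ψ : AdaptedChart n d h) {S : Set ℝ} {e : ℝ}
    {u : Euc m × Euc d}
    (hXY : HasDerivWithinAt (F := Euc n) (fun e => X e (Ψ.chart.symm u)) (Y e (Ψ.chart.symm u)) S e) :
    HasDerivWithinAt (fun e => Ψ.field X (u, e)) (Ψ.field Y (u, e)) S e := by
  let L : Euc n →L[ℝ] Euc m × Euc d :=
    mfderiv (𝓡 n) 𝓘(ℝ, Euc m × Euc d) Ψ.chart (Ψ.chart.symm u)
  exact L.hasFDerivAt.comp_hasDerivWithinAt e hXY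

/-- The bounds that are linear in `e` follow from the mean value inequality in the parameter: `Y =
∂X/∂e` is bounded and Lipschitz on the compact convex set because it is `C¹`. -/
theorem AdaptedChart.exists_fieldBounds (Ψ : AdaptedChart n d h) (hε₀ : 0 ≤ ε₀)
    (hX : ContMDiffOn ((𝓡 n).prod 𝓘(ℝ, ℝ)) (𝓡 n).tangent 1
      (fun p : M × ℝ => (⟨p.1, X p.2 p.1⟩ : TangentBundle (𝓡 n) M)) (univ ×ˢ Icc 0 ε₀))
    (hY : ContMDiffOn ((𝓡 n).prod 𝓘(ℝ, ℝ)) (𝓡 n).tangent 1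
      (fun p : M × ℝ => (⟨p.1, Y p.2 p.1⟩ : TangentBundle (𝓡 n) M)) (univ ×ˢ Icc 0 ε₀))
    (hXY : ∀ x, ∀ e ∈ Icc 0 ε₀,
      HasDerivWithinAt (F := Euc n) (fun e => X e x) (Y e x) (Icc 0 ε₀) e)
    {B : Set (Euc m × Euc d)} (hB : IsCompact B) (hBc : Convex ℝ B) (hBt : B ⊆ Ψ.chart.target) :
    ∃ L, FieldBounds (Ψ.field X) B ε₀ L := by
  obtain ⟨K₁, hK₁⟩ := Ψ.exists_lipschitzOnWith_field hX hB hBc hBt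
  obtain ⟨K₂, hK₂⟩ := Ψ.exists_lipschitzOnWith_field hY hB hBc hBt
  obtain ⟨C, hC⟩ := (hB.prod (isCompact_Icc (a := (0 : ℝ)) (b := ε₀))).exists_bound_of_continuousOn
    hK₂.continuousOn
  have hcd : ContDiffOn ℝ 1 (fun u => Ψ.field X (u, 0)) Ψ.chart.target :=
    (Ψ.contDiffOn_field hX).comp (contDiff_id.prodMk contDiff_const).contDiffOn
      (fun u hu => ⟨hu, ⟨le_rfl, hε₀⟩⟩)
  obtain ⟨L₀, hL₀, hsd⟩ := exists_norm_second_difference_le Ψ.chart.open_target hcd hB hBc hBt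
  have h0 : (0 : ℝ) ∈ Icc 0 ε₀ := ⟨le_rfl, hε₀⟩
  set L : ℝ := K₁ + K₂ + |C| + L₀ with hL
  have hCL : C ≤ L := by
    have := le_abs_self C
    have := K₁.2
    have := K₂.2
    simp only [hL, ← NNReal.val_eq_coe]
    linarith
  have hK₁L : (K₁ : ℝ) ≤ L := by
    have := abs_nonneg C
    have := K₂.2
    simp only [hL, ← NNReal.val_eq_coe]
    linarith
  have hK₂L : (K₂ : ℝ) ≤ L := by
    have := abs_nonneg C
    have := K₁.2
    simp only [hL, ← NNReal.val_eq_coe]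
    linarith
  have hL₀L : L₀ ≤ L := by
    have := abs_nonneg C
    have := K₁.2
    have := K₂.2
    simp only [hL, ← NNReal.val_eq_coe]
    linarith
  have hlip : ∀ {V : ℝ → (x : M) → TangentSpace (𝓡 n) x} {K : NNReal},
      LipschitzOnWith K (Ψ.field V) (B ×ˢ Icc 0 ε₀) → ∀ e ∈ Icc 0 ε₀, ∀ u ∈ B, ∀ u' ∈ B,
      ‖Ψ.field V (u, e) - Ψ.field V (u', e)‖ ≤ K * ‖u - u'‖ := by
    intro V K hK e he u hu u' hu'
    have h1 := hK.dist_le_mul (u, e) ⟨hu, he⟩ (u', e) ⟨hu', he⟩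
    rw [dist_eq_norm] at h1
    simpa [Prod.dist_eq, dist_eq_norm] using h1
  refine ⟨L, ?_, ?_, ?_, ?_, ?_⟩
  · positivity
  · intro e he u hu
    have h1 := (convex_Icc 0 ε₀).norm_image_sub_le_of_norm_hasDerivWithin_le
      (fun e he => Ψ.hasDerivWithinAt_field (u := u) (hXY _ e he))
      (fun e he => (hC (u, e) ⟨hu, he⟩).trans hCL) h0 he
    rwa [sub_zero, Real.norm_of_nonneg he.1] at h1
  · intro e he u hu u' hu'
    have h1 := (convex_Icc 0 ε₀).norm_image_sub_le_of_norm_hasDerivWithin_le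
      (fun e he => (Ψ.hasDerivWithinAt_field (u := u) (hXY _ e he)).sub
        (Ψ.hasDerivWithinAt_field (u := u') (hXY _ e he)))
      (fun e he => (hlip hK₂ e he u hu u' hu').trans
        (mul_le_mul_of_nonneg_right hK₂L (norm_nonneg _))) h0 he
    rw [sub_zero, Real.norm_of_nonneg he.1] at h1
    calc _ ≤ _ := h1
      _ = _ := by ring
  · intro e he u hu u' hu'
    exact (hlip hK₁ e he u hu u' hu').trans (by gcongr)
  · intro η hη
    obtain ⟨ζ, hζ, h1⟩ := hsd η hη
    refine ⟨ζ, hζ, fun u hu u' hu' p hp p' hp' h2 h3 => (h1 u hu u' hu' p hp p' hp' h2 h3).trans ?_⟩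
    gcongr

end ChartBounds
end Averaging

namespace Averaging

/-! ### Local distortion of the measure by the perturbed flow -/

section Distortion

variable {n m d : ℕ} {M : Type*} [TopologicalSpace M] [ChartedSpace (Euc n) M]
  {h : M → Euc m} {X Y : ℝ → (x : M) → TangentSpace (𝓡 n) x} {ε₀ : ℝ}

theorem GlobalFlow.exists_nhds (φ : GlobalFlow X (Icc 0 ε₀)) (hε₀ : 0 ≤ ε₀) {x₀ : M} {T : Set M}
    (hT : T ∈ 𝓝 x₀) : ∃ δ > 0, ∃ O : Set M, IsOpen O ∧ x₀ ∈ O ∧ ∀ e ∈ Icc 0 ε₀, e < δ →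
      ∀ t : ℝ, |t| < δ → ∀ x ∈ O, φ.toFun e t x ∈ T := by
  have h0 : (0 : ℝ) ∈ Icc 0 ε₀ := ⟨le_rfl, hε₀⟩
  have h1 := φ.continuousOn (0, 0, x₀) ⟨h0, mem_univ _⟩
  have h2 : ∀ᶠ p in 𝓝[Icc 0 ε₀ ×ˢ univ] ((0 : ℝ), (0 : ℝ), x₀), φ.toFun p.1 p.2.1 p.2.2 ∈ T :=
    h1.eventually (by
      change ∀ᶠ y in 𝓝 (φ.toFun 0 0 x₀), y ∈ T
      rw [φ.map_zero 0 h0]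
      exact hT)
  rw [eventually_nhdsWithin_iff, nhds_prod_eq, nhds_prod_eq] at h2
  obtain ⟨p₁, hp₁, p₂, hp₂, h3⟩ := eventually_prod_iff.1 h2
  obtain ⟨p₃, hp₃, p₄, hp₄, h4⟩ := eventually_prod_iff.1 hp₂
  obtain ⟨δ₁, hδ₁, h5⟩ := Metric.eventually_nhds_iff.1 hp₁
  obtain ⟨δ₂, hδ₂, h6⟩ := Metric.eventually_nhds_iff.1 hp₃
  obtain ⟨O, hO, hOo, hx⟩ := eventually_nhds_iff.1 hp₄
  refine ⟨min δ₁ δ₂, lt_min hδ₁ hδ₂, O, hOo, hx, fun e he heδ t ht x hxO => ?_⟩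
  refine h3 (h5 ?_) (h4 (h6 ?_) (hO x hxO)) ⟨he, mem_univ _⟩
  · rw [Real.dist_eq, sub_zero, abs_of_nonneg he.1]
    exact heδ.trans_le (min_le_left _ _)
  · rw [Real.dist_eq, sub_zero]
    exact ht.trans_le (min_le_right _ _)

variable [IsManifold (𝓡 n) ∞ M] [MeasurableSpace M] [BorelSpace M]
  (g : Bundle.ContMDiffRiemannianMetric (𝓡 n) ∞ (EuclideanSpace ℝ (Fin n))
      (fun x : M => TangentSpace (𝓡 n) x)) {ρ : M → ℝ}

omit [MeasurableSpace M] [BorelSpace M] in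
/-- The density of the volume in a chart is nearly constant at small distances. -/
theorem AdaptedChart.exists_fiberDensity_le (Ψ : AdaptedChart n d h)
    (hρc : ContMDiff (𝓡 n) 𝓘(ℝ, ℝ) 1 ρ) (hρ : ∀ x, 0 < ρ x)
    {B : Set (Euc m × Euc d)} (hB : IsCompact B) (hBc : Convex ℝ B) (hBt : B ⊆ Ψ.chart.target) :
    ∃ C ≥ 0, ∀ u ∈ B, ∀ u' ∈ B, Ψ.fiberDensity g ρ u' ≤ (1 + C * ‖u' - u‖) * Ψ.fiberDensity g ρ u := by
  rcases B.eq_empty_or_nonempty with rfl | hne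
  · exact ⟨0, le_rfl, by simp⟩
  have hcd := (Ψ.contDiffOn_fiberDensity g hρc).mono hBt
  obtain ⟨K, hK⟩ := hcd.exists_lipschitzOnWith one_ne_zero hBc hB
  obtain ⟨u₁, hu₁, hmin⟩ := hB.exists_isMinOn hne hcd.continuousOn
  set w₀ := Ψ.fiberDensity g ρ u₁
  have hw₀ : 0 < w₀ := Ψ.fiberDensity_pos g hρ (hBt hu₁)
  refine ⟨K / w₀, by positivity, fun u hu u' hu' => ?_⟩
  have h1 := hK.dist_le_mul u' hu' u hu
  rw [Real.dist_eq, dist_eq_norm] at h1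
  have h2 := (abs_le.1 h1).2
  have h3 : w₀ ≤ Ψ.fiberDensity g ρ u := hmin hu
  have h4 : K * ‖u' - u‖ ≤ K / w₀ * ‖u' - u‖ * Ψ.fiberDensity g ρ u := by
    calc K * ‖u' - u‖ = K / w₀ * ‖u' - u‖ * w₀ := by field_simp
      _ ≤ _ := by gcongr
  linarith

variable [T2Space M] [SecondCountableTopology M]

omit [T2Space M] in
-- As `φ_0` preserves the measure, the preimage of `E` under `φ_e^s` may be replaced by `θ(E)` with
-- `θ = φ_0^s φ_e^{-s}`. In the chart the Lipschitz constant of `θ` controls Lebesgue measure, and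
-- its distance to the identity controls the change of the density; both deviate from the trivial
-- case by `O(es)`.
theorem exists_local_distortion (hh : ContMDiff (𝓡 n) (𝓡 m) 2 h)
    (hindep : ∀ x : M, Function.Surjective (mfderiv (𝓡 n) (𝓡 m) h x))
    (hρc : ContMDiff (𝓡 n) 𝓘(ℝ, ℝ) 1 ρ) (hρ : ∀ x, 0 < ρ x) (hε₀ : 0 < ε₀)
    (hX : ContMDiffOn ((𝓡 n).prod 𝓘(ℝ, ℝ)) (𝓡 n).tangent 1
      (fun p : M × ℝ => (⟨p.1, X p.2 p.1⟩ : TangentBundle (𝓡 n) M)) (univ ×ˢ Icc 0 ε₀))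
    (hY : ContMDiffOn ((𝓡 n).prod 𝓘(ℝ, ℝ)) (𝓡 n).tangent 1
      (fun p : M × ℝ => (⟨p.1, Y p.2 p.1⟩ : TangentBundle (𝓡 n) M)) (univ ×ˢ Icc 0 ε₀))
    (hXY : ∀ x, ∀ e ∈ Icc 0 ε₀,
      HasDerivWithinAt (F := Euc n) (fun e => X e x) (Y e x) (Icc 0 ε₀) e)
    (φ : GlobalFlow X (Icc 0 ε₀)) {U : Set (Euc m)} (hU : IsOpen U)
    (hpres : ∀ t A, MeasurableSet A →
      totalMeasure g h ρ U (φ.toFun 0 t ⁻¹' A) = totalMeasure g h ρ U A)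
    {x₀ : M} (hx₀ : h x₀ ∈ U) :
    ∃ O : Set M, IsOpen O ∧ x₀ ∈ O ∧ ∃ C ≥ 0, ∃ ε₁ > 0, ∀ e ∈ Ioc 0 ε₀, e < ε₁ → ∃ s₀ > 0,
      ∀ s ∈ Icc 0 s₀, ∀ E ⊆ O, MeasurableSet E →
        totalMeasure g h ρ U (φ.toFun e s ⁻¹' E) ≤
          ENNReal.ofReal (Real.exp (C * e * s)) * totalMeasure g h ρ U E := by
  have : Nonempty M := ⟨x₀⟩
  have hmn := le_of_surjective_mfderiv hindep
  obtain ⟨Ψ, hΨ⟩ := exists_adaptedChart (d := n - m) (by omega) hh x₀ (hindep x₀)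
  obtain ⟨R, hR, hRt⟩ := Ψ.exists_closedBall_subset_target hΨ
  set B := Metric.closedBall (Ψ.chart x₀) R with hBdef
  have hB : IsCompact B := isCompact_closedBall _ _
  have hBc : Convex ℝ B := convex_closedBall _ _
  obtain ⟨L, hL⟩ := Ψ.exists_fieldBounds hε₀.le hX hY hXY hB hBc hRt
  obtain ⟨Cw, hCw, hw⟩ := Ψ.exists_fiberDensity_le g hρc hρ hB hBc hRt
  have h00 : (0 : ℝ) ∈ Icc 0 ε₀ := ⟨le_rfl, hε₀.le⟩
  have hL0 := hL.nonneg
  set T := (Ψ.chart.source ∩ Ψ.chart ⁻¹' Metric.ball (Ψ.chart x₀) R) ∩ h ⁻¹' U with hT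
  have hTn : T ∈ 𝓝 x₀ :=
    ((Ψ.chart.isOpen_inter_preimage Metric.isOpen_ball).inter
      (hU.preimage hh.continuous)).mem_nhds ⟨⟨hΨ, Metric.mem_ball_self hR⟩, hx₀⟩
  -- Two nested neighbourhoods: orbits run backwards from `O₂` end in `O₁`, and both flows started
  -- in `O₁` stay in `T`, that is, in the chart ball and over `U`.
  obtain ⟨δ₁, hδ₁, O₁, hO₁, hxO₁, hφ₁⟩ := φ.exists_nhds hε₀.le hTn
  obtain ⟨δ₂, hδ₂, O₂, hO₂, hxO₂, hφ₂⟩ := φ.exists_nhds hε₀.le (hO₁.mem_nhds hxO₁)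
  set N := Module.finrank ℝ (Euc m × Euc (n - m))
  -- The first term comes from the `N`-th power of the Lipschitz constant, the second from the
  -- variation of the density over the displacement `2 * (L * e) * s`.
  refine ⟨O₂, hO₂, hxO₂, N * (4 * (L + 1)) + Cw * (2 * L), by positivity, min δ₁ δ₂,
    lt_min hδ₁ hδ₂, fun e he heδ => ?_⟩
  have heI : e ∈ Icc 0 ε₀ := Ioc_subset_Icc_self he
  have he₁ : e < δ₁ := heδ.trans_le (min_le_left _ _)
  have he₂ : e < δ₂ := heδ.trans_le (min_le_right _ _)
  obtain ⟨s₁, hs₁, hcmp⟩ := hL.exists_norm_sub_le he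
  refine ⟨min s₁ (min (δ₁ / 2) (δ₂ / 2)), by positivity, fun s hs E hE hEm => ?_⟩
  have hss₁ : s ∈ Icc 0 s₁ := ⟨hs.1, hs.2.trans (min_le_left _ _)⟩
  have hsδ₁ : s < δ₁ := by
    have := hs.2.trans ((min_le_right _ _).trans (min_le_left _ _))
    linarith
  have hsδ₂ : s < δ₂ := by
    have := hs.2.trans ((min_le_right _ _).trans (min_le_right _ _))
    linarith
  obtain ⟨hLs, hcmp⟩ := hcmp s hss₁
  set θ : M → M := fun x => φ.toFun 0 s (φ.toFun e (-s) x) with hθ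
  have hz : ∀ x ∈ E, φ.toFun e (-s) x ∈ O₁ := fun x hx =>
    hφ₂ e heI he₂ (-s) (by rwa [abs_neg, abs_of_nonneg hs.1]) x (hE hx)
  -- the two trajectories in the chart
  have hcurve : ∀ e' ∈ Icc 0 ε₀, e' < δ₁ → ∀ z ∈ O₁, ∀ t ∈ Icc 0 s,
      Ψ.chart (φ.toFun e' t z) ∈ B ∧ HasDerivWithinAt (fun t => Ψ.chart (φ.toFun e' t z))
        (Ψ.field X (Ψ.chart (φ.toFun e' t z), e')) (Icc 0 s) t := by
    intro e' he' hee' z hz t ht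
    have h1 := hφ₁ e' he' hee' t (by
      rw [abs_of_nonneg ht.1]
      exact ht.2.trans_lt hsδ₁) z hz
    refine ⟨Metric.ball_subset_closedBall h1.1.2, ?_⟩
    rw [Ψ.field_apply e' h1.1.1]
    exact hasDerivWithinAt_comp_of_isMIntegralCurveOn
      ((φ.isMIntegralCurve e' he' z).isMIntegralCurveOn _) ht (Ψ.mdifferentiableAt h1.1.1)
  have hθT : ∀ x ∈ E, θ x ∈ T := fun x hx =>
    hφ₁ 0 h00 hδ₁ s (by rwa [abs_of_nonneg hs.1]) _ (hz x hx)
  have hET : ∀ x ∈ E, x ∈ T := by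
    intro x hx
    have := hφ₁ e heI he₁ s (by rwa [abs_of_nonneg hs.1]) _ (hz x hx)
    rwa [φ.apply_neg heI] at this
  -- the image of `E`
  have hE' : θ '' E = φ.toFun 0 (-s) ⁻¹' (φ.toFun e s ⁻¹' E) := by
    ext y
    constructor
    · rintro ⟨x, hx, rfl⟩
      simp only [hθ, mem_preimage]
      rwa [φ.neg_apply h00, φ.apply_neg heI]
    · intro hy
      refine ⟨_, hy, ?_⟩
      simp only [hθ]
      rw [φ.neg_apply heI, φ.apply_neg h00]
  have hEsm : MeasurableSet (φ.toFun e s ⁻¹' E) :=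
    (φ.homeomorph heI s).continuous.measurable hEm
  have hE'm : MeasurableSet (θ '' E) := by
    rw [hE']
    exact (φ.homeomorph h00 (-s)).continuous.measurable hEsm
  have hθinj : Function.Injective θ :=
    ((φ.homeomorph h00 s).injective).comp (φ.homeomorph heI (-s)).injective
  rw [← hpres (-s) _ hEsm, ← hE', totalMeasure_apply_chart g hh hindep hρc hρ hU.measurableSet Ψ
    hE'm (by rintro _ ⟨x, hx, rfl⟩; exact (hθT x hx).1.1)
    (by rintro _ ⟨x, hx, rfl⟩; exact (hθT x hx).2),
    totalMeasure_apply_chart g hh hindep hρc hρ hU.measurableSet Ψ hEm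
      (fun x hx => (hET x hx).1.1) (fun x hx => (hET x hx).2)]
  set S := Ψ.chart.symm ⁻¹' E ∩ Ψ.chart.target with hS
  set f : Euc m × Euc (n - m) → Euc m × Euc (n - m) :=
    fun u => Ψ.chart (θ (Ψ.chart.symm u)) with hf
  have himg : Ψ.chart.symm ⁻¹' (θ '' E) ∩ Ψ.chart.target = f '' S := by
    ext u
    constructor
    · rintro ⟨⟨x, hx, hxu⟩, hu⟩
      refine ⟨Ψ.chart x, ⟨?_, Ψ.chart.map_source (hET x hx).1.1⟩, ?_⟩
      · rw [mem_preimage, Ψ.chart.left_inv (hET x hx).1.1]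
        exact hx
      · simp only [hf]
        rw [Ψ.chart.left_inv (hET x hx).1.1, hxu, Ψ.chart.right_inv hu]
    · rintro ⟨u', ⟨hu'E, hu't⟩, rfl⟩
      have h1 := (hθT _ hu'E).1.1
      refine ⟨⟨_, hu'E, ?_⟩, Ψ.chart.map_source h1⟩
      simp only [hf]
      rw [Ψ.chart.left_inv h1]
  have hSB : ∀ u ∈ S, u ∈ B := by
    intro u hu
    have := (hET _ hu.1).1.2
    rw [mem_preimage, Ψ.chart.right_inv hu.2] at this
    exact Metric.ball_subset_closedBall this
  have hend : ∀ u ∈ S, Ψ.chart (φ.toFun e s (φ.toFun e (-s) (Ψ.chart.symm u))) = u := by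
    intro u hu
    rw [φ.apply_neg heI, Ψ.chart.right_inv hu.2]
  have hstart : ∀ z, Ψ.chart (φ.toFun e 0 z) = Ψ.chart (φ.toFun 0 0 z) := fun z => by
    rw [φ.map_zero e heI, φ.map_zero 0 h00]
  have hinj : InjOn f S := by
    intro u hu u' hu' huu'
    have h1 := Ψ.chart.injOn (hθT _ hu.1).1.1 (hθT _ hu'.1).1.1 huu'
    have h2 := hθinj h1
    rw [← Ψ.chart.right_inv hu.2, h2, Ψ.chart.right_inv hu'.2]
  have hκ : 0 ≤ 4 * (L + 1) * e * s := by
    have := he.1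
    have := hs.1
    positivity
  set K : NNReal := ⟨1 + 4 * (L + 1) * e * s, by linarith⟩ with hK
  have hflip : LipschitzOnWith K f S := by
    refine LipschitzOnWith.of_dist_le_mul fun u hu u' hu' => ?_
    have h1 := hcmp _ _ _ _ (hcurve e heI he₁ _ (hz _ hu.1)) (hcurve e heI he₁ _ (hz _ hu'.1))
      (hcurve 0 h00 hδ₁ _ (hz _ hu.1)) (hcurve 0 h00 hδ₁ _ (hz _ hu'.1)) (hstart _) (hstart _)
    simp only [hend u hu, hend u' hu'] at h1
    rw [dist_eq_norm, dist_eq_norm]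
    exact h1
  have hwf : ∀ u ∈ S, ENNReal.ofReal (Ψ.fiberDensity g ρ (f u)) ≤
      ENNReal.ofReal (1 + Cw * (2 * (L * e) * s)) * ENNReal.ofReal (Ψ.fiberDensity g ρ u) := by
    intro u hu
    have hfu : f u ∈ B := Metric.ball_subset_closedBall (hθT _ hu.1).1.2
    have h1 := hL.norm_sub_le heI hs.1 hLs (hcurve e heI he₁ _ (hz _ hu.1))
      (hcurve 0 h00 hδ₁ _ (hz _ hu.1)) (hstart _) (t := s) ⟨hs.1, le_rfl⟩
    simp only [hend u hu] at h1
    have hpos := Ψ.fiberDensity_pos g hρ (hRt (hSB u hu))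
    have h2 : 0 ≤ 1 + Cw * (2 * (L * e) * s) := by
      have := he.1
      have := hs.1
      positivity
    rw [← ENNReal.ofReal_mul h2]
    refine ENNReal.ofReal_le_ofReal ((hw u (hSB u hu) _ hfu).trans ?_)
    gcongr
    rw [norm_sub_rev]
    exact h1
  have : (volume : Measure (Euc m × Euc (n - m))).IsAddHaarMeasure :=
    Measure.prod.instIsAddHaarMeasure volume volume
  rw [himg]
  refine (lintegral_image_le_of_lipschitzOnWith volume (measurableSet_symm_preimage Ψ hEm) hflip
    hinj ENNReal.ofReal_ne_top hwf).trans ?_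
  rw [← mul_assoc]
  gcongr
  have hKe : (K : ℝ≥0∞) ≤ ENNReal.ofReal (Real.exp (4 * (L + 1) * e * s)) := by
    rw [← ENNReal.ofReal_coe_nnreal]
    refine ENNReal.ofReal_le_ofReal ?_
    have := Real.add_one_le_exp (4 * (L + 1) * e * s)
    change 1 + 4 * (L + 1) * e * s ≤ _
    linarith
  calc (K : ℝ≥0∞) ^ N * ENNReal.ofReal (1 + Cw * (2 * (L * e) * s))
      ≤ ENNReal.ofReal (Real.exp (4 * (L + 1) * e * s)) ^ N *
        ENNReal.ofReal (Real.exp (Cw * (2 * (L * e) * s))) := by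
        gcongr
        have := Real.add_one_le_exp (Cw * (2 * (L * e) * s))
        linarith
    _ = ENNReal.ofReal (Real.exp ((N * (4 * (L + 1)) + Cw * (2 * L)) * e * s)) := by
        rw [← ENNReal.ofReal_pow (Real.exp_pos _).le, ← Real.exp_nat_mul,
          ← ENNReal.ofReal_mul (Real.exp_pos _).le, ← Real.exp_add]
        congr 2
        ring

end Distortion
end Averaging

namespace Averaging

/-! ### Distortion on compact sets and over long times -/

section GlobalDistortion

variable {n m : ℕ} {M : Type*} [TopologicalSpace M] [ChartedSpace (Euc n) M]
  {X : ℝ → (x : M) → TangentSpace (𝓡 n) x} {ε₀ : ℝ}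
  [MeasurableSpace M] [BorelSpace M] {μ : Measure M} (φ : GlobalFlow X (Icc 0 ε₀))

/-- Local bounds for the distortion of a measure by a family of flows, over short times, give
global ones on a compact set. -/
theorem GlobalFlow.exists_distortion_of_local {K : Set M} (hK : IsCompact K)
    (hloc : ∀ x ∈ K, ∃ O : Set M, IsOpen O ∧ x ∈ O ∧ ∃ C ≥ 0, ∃ ε₁ > 0, ∀ e ∈ Ioc 0 ε₀, e < ε₁ →
      ∃ s₀ > 0, ∀ s ∈ Icc 0 s₀, ∀ E ⊆ O, MeasurableSet E →
        μ (φ.toFun e s ⁻¹' E) ≤ ENNReal.ofReal (Real.exp (C * e * s)) * μ E) :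
    ∃ C ≥ 0, ∃ ε₁ > 0, ∀ e ∈ Ioc 0 ε₀, e < ε₁ →
      ∃ s₀ > 0, ∀ s ∈ Icc 0 s₀, ∀ E ⊆ K, MeasurableSet E →
        μ (φ.toFun e s ⁻¹' E) ≤ ENNReal.ofReal (Real.exp (C * e * s)) * μ E := by
  -- The claim is strengthened to an open neighbourhood of `K`, so that for a union of two sets `E`
  -- can be split measurably by one of the neighbourhoods.
  suffices hmain : ∃ O, K ⊆ O ∧ IsOpen O ∧ ∃ C ≥ 0, ∃ ε₁ > 0, ∀ e ∈ Ioc 0 ε₀, e < ε₁ →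
      ∃ s₀ > 0, ∀ s ∈ Icc 0 s₀, ∀ E ⊆ O, MeasurableSet E →
        μ (φ.toFun e s ⁻¹' E) ≤ ENNReal.ofReal (Real.exp (C * e * s)) * μ E by
    obtain ⟨O, hKO, -, C, hC, ε₁, hε₁, h1⟩ := hmain
    refine ⟨C, hC, ε₁, hε₁, fun e he hee => ?_⟩
    obtain ⟨s₀, hs₀, h2⟩ := h1 e he hee
    exact ⟨s₀, hs₀, fun s hs E hE => h2 s hs E (hE.trans hKO)⟩
  refine hK.induction_on (p := fun A => ∃ O, A ⊆ O ∧ IsOpen O ∧ ∃ C ≥ 0, ∃ ε₁ > 0,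
      ∀ e ∈ Ioc 0 ε₀, e < ε₁ → ∃ s₀ > 0, ∀ s ∈ Icc 0 s₀, ∀ E ⊆ O, MeasurableSet E →
        μ (φ.toFun e s ⁻¹' E) ≤ ENNReal.ofReal (Real.exp (C * e * s)) * μ E) ?_ ?_ ?_ ?_
  · refine ⟨∅, Subset.rfl, isOpen_empty, 0, le_rfl, 1, one_pos, fun e he hee => ⟨1, one_pos, ?_⟩⟩
    intro s hs E hE _
    rw [subset_empty_iff.1 hE]
    simp
  · rintro A A' hAA' ⟨O, hO, h1⟩
    exact ⟨O, hAA'.trans hO, h1⟩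
  · rintro A A' ⟨O, hAO, hO, C, hC, ε₁, hε₁, h1⟩ ⟨O', hAO', hO', C', hC', ε₁', hε₁', h1'⟩
    refine ⟨O ∪ O', union_subset_union hAO hAO', hO.union hO', max C C', le_max_of_le_left hC,
      min ε₁ ε₁', lt_min hε₁ hε₁', fun e he hee => ?_⟩
    obtain ⟨s₀, hs₀, h2⟩ := h1 e he (hee.trans_le (min_le_left _ _))
    obtain ⟨s₀', hs₀', h2'⟩ := h1' e he (hee.trans_le (min_le_right _ _))
    refine ⟨min s₀ s₀', lt_min hs₀ hs₀', fun s hs E hE hEm => ?_⟩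
    have he0 := he.1
    have hs0 := hs.1
    have h3 := h2 s ⟨hs.1, hs.2.trans (min_le_left _ _)⟩ (E ∩ O) inter_subset_right
      (hEm.inter hO.measurableSet)
    have h3' := h2' s ⟨hs.1, hs.2.trans (min_le_right _ _)⟩ (E \ O)
      (fun x hx => (hE hx.1).resolve_left hx.2) (hEm.diff hO.measurableSet)
    have hCm : C ≤ max C C' := le_max_left _ _
    have hCm' : C' ≤ max C C' := le_max_right _ _
    calc μ (φ.toFun e s ⁻¹' E)
        ≤ μ (φ.toFun e s ⁻¹' (E ∩ O)) + μ (φ.toFun e s ⁻¹' (E \ O)) := by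
          rw [← inter_union_sdiff E O, preimage_union, inter_union_sdiff]
          exact measure_union_le _ _
      _ ≤ ENNReal.ofReal (Real.exp (max C C' * e * s)) * μ (E ∩ O) +
          ENNReal.ofReal (Real.exp (max C C' * e * s)) * μ (E \ O) :=
          add_le_add (h3.trans (by gcongr)) (h3'.trans (by gcongr))
      _ = _ := by rw [← mul_add, measure_inter_add_sdiff _ hO.measurableSet]
  · intro x hx
    obtain ⟨O, hO, hxO, h1⟩ := hloc x hx
    exact ⟨O, mem_nhdsWithin_of_mem_nhds (hO.mem_nhds hxO), O, Subset.rfl, hO, h1⟩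

/-- Iteration of the bounds over short times, along the orbits that stay in `K`. -/
theorem GlobalFlow.measure_le_of_short_time {K : Set M} {C e s₀ : ℝ}
    (hKm : MeasurableSet K) (he : e ∈ Icc 0 ε₀) (hs₀ : 0 < s₀)
    (hshort : ∀ s ∈ Icc 0 s₀, ∀ E ⊆ K, MeasurableSet E →
        μ (φ.toFun e s ⁻¹' E) ≤ ENNReal.ofReal (Real.exp (C * e * s)) * μ E)
    {t : ℝ} (ht : 0 ≤ t) {E : Set M} (hEm : MeasurableSet E) :
    μ {z | (∀ u ∈ Icc 0 t, φ.toFun e u z ∈ K) ∧ φ.toFun e t z ∈ E} ≤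
      ENNReal.ofReal (Real.exp (C * e * t)) * μ E := by
  obtain ⟨k, hk⟩ := exists_nat_gt (t / s₀)
  have hk0 : (0 : ℝ) < k := lt_of_le_of_lt (by positivity) hk
  set s := t / k with hs
  have hsI : s ∈ Icc 0 s₀ := by
    refine ⟨by positivity, ?_⟩
    rw [hs, div_le_iff₀ hk0]
    rw [div_lt_iff₀ hs₀] at hk
    linarith
  have hmeas : ∀ u : ℝ, Measurable (φ.toFun e u) := fun u =>
    (φ.homeomorph he u).continuous.measurable
  -- The orbit is required to be in `K` only at the multiples of `s`. This makes the sets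
  -- measurable, nested under the time `s` map, and contained in `K`, where the one-step bound
  -- applies.
  set G : ℕ → Set M := fun j => {z | (∀ i ≤ j, φ.toFun e (i * s) z ∈ K) ∧ φ.toFun e (j * s) z ∈ E}
    with hG
  have hGm : ∀ j, MeasurableSet (G j) := by
    intro j
    have : G j = (⋂ i ∈ Iic j, φ.toFun e (i * s) ⁻¹' K) ∩ φ.toFun e (j * s) ⁻¹' E := by
      ext z
      simp [hG]
    rw [this]
    exact (MeasurableSet.biInter (Set.to_countable _) fun i _ => hmeas _ hKm).inter (hmeas _ hEm)
  have hGK : ∀ j, G j ⊆ K := by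
    intro j z hz
    have := hz.1 0 (Nat.zero_le j)
    rwa [Nat.cast_zero, zero_mul, φ.map_zero e he] at this
  have hind : ∀ j, μ (G j) ≤ ENNReal.ofReal (Real.exp (C * e * (j * s))) * μ E := by
    intro j
    induction j with
    | zero =>
      have : G 0 ⊆ E := by
        intro z hz
        have := hz.2
        rwa [Nat.cast_zero, zero_mul, φ.map_zero e he] at this
      simpa using measure_mono this
    | succ j ih =>
      have hsub : G (j + 1) ⊆ φ.toFun e s ⁻¹' G j := by
        intro z hz
        have hadd : ∀ i : ℕ, φ.toFun e (i * s) (φ.toFun e s z) =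
            φ.toFun e ((i + 1 : ℕ) * s) z := by
          intro i
          rw [← φ.map_add e he]
          congr 1
          push_cast
          ring
        refine ⟨fun i hi => ?_, ?_⟩
        · rw [hadd]
          exact hz.1 (i + 1) (by omega)
        · rw [hadd]
          exact hz.2
      calc μ (G (j + 1)) ≤ μ (φ.toFun e s ⁻¹' G j) := measure_mono hsub
        _ ≤ ENNReal.ofReal (Real.exp (C * e * s)) * μ (G j) := hshort s hsI _ (hGK j) (hGm j)
        _ ≤ ENNReal.ofReal (Real.exp (C * e * s)) *
            (ENNReal.ofReal (Real.exp (C * e * (j * s))) * μ E) := by gcongr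
        _ = _ := by
          rw [← mul_assoc, ← ENNReal.ofReal_mul (Real.exp_pos _).le, ← Real.exp_add]
          congr 3
          push_cast
          ring
  have hks : k * s = t := by rw [hs]; field_simp
  have h1 := hind k
  rw [hks] at h1
  refine (measure_mono ?_).trans h1
  rintro z ⟨h2, h3⟩
  refine ⟨fun i hi => h2 _ ⟨by have := hsI.1; positivity, ?_⟩, by rwa [hks]⟩
  calc (i : ℝ) * s ≤ k * s := by have := hsI.1; gcongr
    _ = t := hks

end GlobalDistortion
end Averaging

namespace Averaging

/-! ### The mean ergodic theorem for flows -/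

section Ergodic

variable {M : Type*} [TopologicalSpace M] {ψ : ℝ → M → M} {F : M → ℝ} {C : ℝ}

/-- The integral of `F` along the orbits of `ψ` up to time `T`. -/
noncomputable def orbitIntegral {E : Type*} [NormedAddCommGroup E] [NormedSpace ℝ E]
    (ψ : ℝ → M → M) (F : M → E) (T : ℝ) (x : M) : E :=
  ∫ u in (0 : ℝ)..T, F (ψ u x)

section

variable {E : Type*} [NormedAddCommGroup E] [NormedSpace ℝ E] {F : M → E}

theorem continuous_orbitIntegral [FirstCountableTopology M] [LocallyCompactSpace M]
    (hψ : Continuous (fun p : ℝ × M => ψ p.1 p.2)) (hF : Continuous F) (T : ℝ) :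
    Continuous (orbitIntegral ψ F T) := by
  refine intervalIntegral.continuous_parametric_intervalIntegral_of_continuous'
    (f := fun x u => F (ψ u x)) ?_ 0 T
  exact hF.comp (hψ.comp continuous_swap)

omit [TopologicalSpace M] in
theorem norm_orbitIntegral_le (hC : ∀ x, ‖F x‖ ≤ C) (T : ℝ) (x : M) :
    ‖orbitIntegral ψ F T x‖ ≤ C * |T| := by
  simpa [orbitIntegral] using intervalIntegral.norm_integral_le_of_norm_le_const (a := 0) (b := T)
    (fun u _ => hC (ψ u x))

theorem orbitIntegral_add (hψ : Continuous (fun p : ℝ × M => ψ p.1 p.2)) (hF : Continuous F)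
    (hadd : ∀ s t x, ψ (s + t) x = ψ t (ψ s x)) (s t : ℝ) (x : M) :
    orbitIntegral ψ F (s + t) x = orbitIntegral ψ F s x + orbitIntegral ψ F t (ψ s x) := by
  have hint : ∀ a b, IntervalIntegrable (fun u => F (ψ u x)) volume a b := fun a b =>
    (hF.comp (hψ.comp (Continuous.prodMk continuous_id continuous_const))).intervalIntegrable a b
  simp only [orbitIntegral, ← hadd]
  rw [intervalIntegral.integral_comp_add_left (fun u => F (ψ u x)), add_zero,
    intervalIntegral.integral_add_adjacent_intervals (hint _ _) (hint _ _)]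

end

variable [FirstCountableTopology M] [LocallyCompactSpace M] [MeasurableSpace M] [BorelSpace M]
  [SecondCountableTopology M]
  {μ : Measure M} [IsFiniteMeasure μ]

omit [FirstCountableTopology M] [LocallyCompactSpace M] in
-- Fubini and invariance: at each time the space integral is that of `F`.
theorem integral_orbitIntegral_eq_zero (hψ : Continuous (fun p : ℝ × M => ψ p.1 p.2))
    (hF : Continuous F) (hC : ∀ x, ‖F x‖ ≤ C) (hpres : ∀ t, MeasurePreserving (ψ t) μ μ)
    (hF0 : ∫ x, F x ∂μ = 0) (T : ℝ) : ∫ x, orbitIntegral ψ F T x ∂μ = 0 := by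
  simp only [orbitIntegral]
  rw [← intervalIntegral_integral_swap]
  · have : ∀ u, ∫ x, F (ψ u x) ∂μ = 0 := fun u => by
      rw [← hF0, ← integral_map (hpres u).measurable.aemeasurable
        (by rw [(hpres u).map_eq]; exact hF.measurable.aestronglyMeasurable), (hpres u).map_eq]
    simp [this]
  · have : IsFiniteMeasure ((volume : Measure ℝ).restrict (uIoc 0 T)) :=
      ⟨by rw [Measure.restrict_apply_univ, uIoc]; exact measure_Ioc_lt_top⟩
    refine Integrable.of_bound (C := C) ?_ (.of_forall fun p => hC _)
    exact (hF.comp hψ).measurable.aestronglyMeasurable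

/-- The mean ergodic theorem for a flow, in `L¹`. -/
theorem tendsto_lintegral_orbitIntegral (hψ : Continuous (fun p : ℝ × M => ψ p.1 p.2))
    (hadd : ∀ s t x, ψ (s + t) x = ψ t (ψ s x)) (hzero : ∀ x, ψ 0 x = x)
    (hF : Continuous F) (hC : ∀ x, ‖F x‖ ≤ C) (hpres : ∀ t, MeasurePreserving (ψ t) μ μ)
    (herg : ∀ A : Set M, MeasurableSet A → (∀ t x, ψ t x ∈ A ↔ x ∈ A) → μ A = 0 ∨ μ Aᶜ = 0)
    (hF0 : ∫ x, F x ∂μ = 0) :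
    Tendsto (fun N : ℕ => ∫⁻ x, ‖(N : ℝ)⁻¹ • orbitIntegral ψ F N x‖ₑ ∂μ) atTop (𝓝 0) := by
  set a := orbitIntegral ψ F with ha
  have hac : ∀ T, Continuous (a T) := continuous_orbitIntegral hψ hF
  have hmem : ∀ T, MemLp (a T) 2 μ := fun T =>
    MemLp.of_bound (hac T).measurable.aestronglyMeasurable (C * |T|)
      (.of_forall (norm_orbitIntegral_le hC T))
  have hmem' : ∀ N : ℕ, MemLp (fun x => (N : ℝ)⁻¹ • a N x) 2 μ := fun N =>
    (hmem N).const_smul (N : ℝ)⁻¹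
  -- The Koopman operator of the time one map. The Birkhoff sums of the integral over unit time are
  -- the integrals over time `N`, so von Neumann's theorem gives an `L²` limit `G`; ergodicity of
  -- the whole flow must show that `G` vanishes.
  set V : Lp ℝ 2 μ →ₗᵢ[ℝ] Lp ℝ 2 μ := Lp.compMeasurePreservingₗᵢ ℝ (ψ 1) (hpres 1) with hV
  have hVapp : ∀ (f : M → ℝ) (hf : MemLp f 2 μ),
      V hf.toLp = (hf.comp_measurePreserving (hpres 1)).toLp := fun f hf =>
    Lp.toLp_compMeasurePreserving hf (hpres 1)
  have hit : ∀ k : ℕ, V^[k] (hmem 1).toLp =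
      ((hmem 1).comp_measurePreserving (hpres k)).toLp := by
    intro k
    induction k with
    | zero =>
      simp only [Function.iterate_zero, id_eq]
      refine (MemLp.toLp_eq_toLp_iff _ _).2 (.of_forall fun x => ?_)
      simp [hzero]
    | succ k ih =>
      rw [Function.iterate_succ_apply', ih, hVapp]
      refine (MemLp.toLp_eq_toLp_iff _ _).2 (.of_forall fun x => ?_)
      simp only [Function.comp_apply]
      rw [← hadd, add_comm, Nat.cast_succ]
  have hsum : ∀ N : ℕ, ∑ k ∈ Finset.range N, V^[k] (hmem 1).toLp = (hmem N).toLp := by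
    intro N
    induction N with
    | zero =>
      rw [Finset.sum_range_zero, ← MemLp.toLp_zero (MemLp.zero' (p := 2) (μ := μ))]
      refine (MemLp.toLp_eq_toLp_iff _ _).2 (.of_forall fun x => ?_)
      simp [ha, orbitIntegral]
    | succ N ih =>
      rw [Finset.sum_range_succ, ih, hit, ← MemLp.toLp_add]
      refine (MemLp.toLp_eq_toLp_iff _ _).2 (.of_forall fun x => ?_)
      simp only [Pi.add_apply, Function.comp_apply, Nat.cast_succ]
      exact (orbitIntegral_add hψ hF hadd N 1 x).symm
  have hbirk : ∀ N : ℕ, birkhoffAverage ℝ V.toContinuousLinearMap _root_.id N (hmem 1).toLp =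
      (hmem' N).toLp := by
    intro N
    have h1 : birkhoffAverage ℝ V.toContinuousLinearMap _root_.id N (hmem 1).toLp =
      (N : ℝ)⁻¹ • ∑ k ∈ Finset.range N, V^[k] (hmem 1).toLp := rfl
    rw [h1, hsum, ← MemLp.toLp_const_smul]
    rfl
  have hlim := V.toContinuousLinearMap.tendsto_birkhoffAverage_orthogonalProjection
    V.norm_toContinuousLinearMap_le (hmem 1).toLp
  set G : Lp ℝ 2 μ := ((V.toContinuousLinearMap.eqLocus
    (1 : Lp ℝ 2 μ →L[ℝ] Lp ℝ 2 μ)).orthogonalProjectionOnto (hmem 1).toLp : Lp ℝ 2 μ) with hG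
  simp only [hbirk] at hlim
  have hlim2 : Tendsto (fun N : ℕ => eLpNorm ((fun x => (N : ℝ)⁻¹ • a N x) - ⇑G) 2 μ) atTop
      (𝓝 0) := by
    have := (Lp.tendsto_Lp_iff_tendsto_eLpNorm' _ _).1 hlim
    refine this.congr fun N => eLpNorm_congr_ae ?_
    exact (hmem' N).coeFn_toLp.sub (ae_eq_refl _)
  have hlim1 : Tendsto (fun N : ℕ => eLpNorm ((fun x => (N : ℝ)⁻¹ • a N x) - ⇑G) 1 μ) atTop
      (𝓝 0) := by
    have h1 : Tendsto (fun N : ℕ => eLpNorm ((fun x => (N : ℝ)⁻¹ • a N x) - ⇑G) 2 μ *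
        μ univ ^ (1 / (1 : ℝ≥0∞).toReal - 1 / (2 : ℝ≥0∞).toReal)) atTop (𝓝 (0 *
        μ univ ^ (1 / (1 : ℝ≥0∞).toReal - 1 / (2 : ℝ≥0∞).toReal))) := by
      refine ENNReal.Tendsto.mul_const hlim2 (Or.inr ?_)
      refine ENNReal.rpow_ne_top_of_nonneg (by norm_num) (measure_ne_top μ _)
    rw [zero_mul] at h1
    refine tendsto_of_tendsto_of_tendsto_of_le_of_le tendsto_const_nhds h1 (fun _ => zero_le)
      fun N => ?_
    exact eLpNorm_le_eLpNorm_mul_rpow_measure_univ (by norm_num)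
      ((hmem' N).aestronglyMeasurable.sub (Lp.aestronglyMeasurable G))
  have hGi : Integrable G μ := (Lp.memLp G).integrable (by norm_num)
  have hG0 : ∫ x, G x ∂μ = 0 := by
    have h1 := tendsto_integral_of_L1' (μ := μ) (G : M → ℝ) hGi.aestronglyMeasurable
      (.of_forall fun N : ℕ => (hmem' N).integrable (by norm_num)) hlim1
    have h2 : ∀ N : ℕ, ∫ x, (N : ℝ)⁻¹ • a N x ∂μ = 0 := fun N => by
      rw [integral_smul, integral_orbitIntegral_eq_zero hψ hF hC hpres hF0, smul_zero]
    simp only [h2] at h1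
    exact (tendsto_nhds_unique h1 tendsto_const_nhds)
  obtain ⟨ns, hns, hae⟩ := (tendstoInMeasure_of_tendsto_eLpNorm two_ne_zero
    (fun N => (hmem' N).aestronglyMeasurable) (Lp.aestronglyMeasurable G)
    hlim2).exists_seq_tendsto_ae
  -- the invariant set where the upper limit is positive
  set u : ℕ → M → ℝ := fun k x => ((ns k : ℕ) : ℝ)⁻¹ • a (ns k) x with hu
  set A : Set M := {x | ∃ q : ℚ, 0 < q ∧ ∃ᶠ k in atTop, (q : ℝ) < u k x} with hA
  have hAm : MeasurableSet A := by
    have : A = ⋃ q : {q : ℚ // 0 < q}, ⋂ i : ℕ, ⋃ j : {j : ℕ // i ≤ j}, {x | (q : ℝ) < u j x} := by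
      ext x
      simp [hA, frequently_atTop]
    rw [this]
    refine .iUnion fun q => .iInter fun i => .iUnion fun j => ?_
    exact measurableSet_lt measurable_const ((hac (ns j)).measurable.const_smul (ns j : ℝ)⁻¹)
  -- Starting at `ψ t x` instead of `x` changes the integral by at most `2 * C * |t|`, which
  -- disappears after division by `ns k`. The invariance thus holds for every point and every real
  -- time, as the ergodicity hypothesis demands.
  have hAimp : ∀ t x, x ∈ A → ψ t x ∈ A := by
    rintro t x ⟨q, hq, hfr⟩
    refine ⟨q / 2, by positivity, ?_⟩
    have hdiff : Tendsto (fun k => 2 * C * |t| * ((ns k : ℕ) : ℝ)⁻¹) atTop (𝓝 0) := by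
      have := ((tendsto_natCast_atTop_atTop (R := ℝ)).comp hns.tendsto_atTop).inv_tendsto_atTop
      simpa using this.const_mul (2 * C * |t|)
    have hev : ∀ᶠ k in atTop, 2 * C * |t| * ((ns k : ℕ) : ℝ)⁻¹ < (q : ℝ) / 2 :=
      hdiff.eventually (gt_mem_nhds (by positivity))
    refine (hfr.and_eventually hev).mono fun k hk => ?_
    obtain ⟨h1, h2⟩ := hk
    have h3 := orbitIntegral_add hψ hF hadd t (ns k) x
    have h4 := orbitIntegral_add hψ hF hadd (ns k) t x
    rw [add_comm] at h4
    have h5 : a (ns k) (ψ t x) = a (ns k) x +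
        (orbitIntegral ψ F t (ψ (ns k) x) - orbitIntegral ψ F t x) := by
      rw [ha]
      linarith
    have h6 := norm_orbitIntegral_le (ψ := ψ) hC t (ψ (ns k) x)
    have h7 := norm_orbitIntegral_le (ψ := ψ) hC t x
    rw [Real.norm_eq_abs] at h6 h7
    have h8 : -(2 * C * |t|) ≤ orbitIntegral ψ F t (ψ (ns k) x) - orbitIntegral ψ F t x := by
      linarith [neg_abs_le (orbitIntegral ψ F t (ψ (ns k) x)), le_abs_self (orbitIntegral ψ F t x)]
    have h9 : 0 ≤ ((ns k : ℕ) : ℝ)⁻¹ := by positivity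
    simp only [hu, smul_eq_mul] at h1 ⊢
    rw [h5, mul_add]
    push_cast
    nlinarith [mul_le_mul_of_nonneg_left h8 h9]
  have hAinv : ∀ t x, ψ t x ∈ A ↔ x ∈ A := by
    refine fun t x => ⟨fun hx => ?_, hAimp t x⟩
    have := hAimp (-t) _ hx
    rwa [← hadd, add_neg_cancel, hzero] at this
  have hAG : ∀ᵐ x ∂μ, x ∈ A ↔ 0 < G x := by
    filter_upwards [hae] with x hx
    constructor
    · rintro ⟨q, hq, hfr⟩
      have : (q : ℝ) ≤ G x := by
        by_contra hcon
        push Not at hcon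
        exact hfr ((hx.eventually (gt_mem_nhds hcon)).mono fun k hk => not_lt.2 hk.le)
      exact lt_of_lt_of_le (by exact_mod_cast hq) this
    · intro hpos
      obtain ⟨q, hq0, hqG⟩ := exists_rat_btwn hpos
      exact ⟨q, by exact_mod_cast hq0, (hx.eventually (lt_mem_nhds hqG)).frequently⟩
  -- By ergodicity `G` has a constant sign almost everywhere, and its integral is zero.
  have hGz : (G : M → ℝ) =ᵐ[μ] 0 := by
    rcases herg A hAm hAinv with h1 | h1
    · have h2 : ∀ᵐ x ∂μ, G x ≤ 0 := by
        filter_upwards [hAG, measure_eq_zero_iff_ae_notMem.1 h1] with x hx hxA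
        exact not_lt.1 fun hpos => hxA (hx.2 hpos)
      have h3 := (integral_eq_zero_iff_of_nonneg_ae (f := fun x => -G x)
        (h2.mono fun x hx => neg_nonneg.2 hx) hGi.neg).1 (by rw [integral_neg, hG0, neg_zero])
      filter_upwards [h3] with x hx
      simpa using hx
    · have h2 : ∀ᵐ x ∂μ, 0 ≤ G x := by
        filter_upwards [hAG, measure_eq_zero_iff_ae_notMem.1 h1] with x hx hxA
        exact (hx.1 (not_not.1 hxA)).le
      exact (integral_eq_zero_iff_of_nonneg_ae h2 hGi).1 hG0
  refine hlim1.congr fun N => ?_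
  rw [eLpNorm_one_eq_lintegral_enorm]
  refine lintegral_congr_ae ?_
  filter_upwards [hGz] with x hx
  simp [hx]

end Ergodic
end Averaging

namespace Averaging

/-! ### Cutting off the fields by a function of `h` -/

section Cutoff

variable {n m d : ℕ} {M : Type*} [TopologicalSpace M] [ChartedSpace (Euc n) M]
  {h : M → Euc m} {Z : ℝ → (x : M) → TangentSpace (𝓡 n) x} {ε₀ : ℝ} {q : Euc m → ℝ}

/-- The fields `Z e`, multiplied by a function of `h`. -/
noncomputable def cutoffField (q : Euc m → ℝ) (h : M → Euc m) (Z : ℝ → (x : M) → TangentSpace (𝓡 n) x) (e : ℝ)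
    (x : M) : TangentSpace (𝓡 n) x :=
  q (h x) • Z e x

variable [IsManifold (𝓡 n) ∞ M]

theorem contMDiffOn_cutoffField {S : Set ℝ} (hq : ContDiff ℝ 1 q)
    (hh : ContMDiff (𝓡 n) (𝓡 m) 2 h)
    (hZ : ContMDiffOn ((𝓡 n).prod 𝓘(ℝ, ℝ)) (𝓡 n).tangent 1
      (fun p : M × ℝ => (⟨p.1, Z p.2 p.1⟩ : TangentBundle (𝓡 n) M)) (univ ×ˢ S)) :
    ContMDiffOn ((𝓡 n).prod 𝓘(ℝ, ℝ)) (𝓡 n).tangent 1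
      (fun p : M × ℝ => (⟨p.1, cutoffField q h Z p.2 p.1⟩ : TangentBundle (𝓡 n) M))
      (univ ×ˢ S) := by
  have : IsManifold (𝓡 n) 1 M := IsManifold.of_le (n := ∞) (by norm_cast)
  intro p₀ hp₀
  have h1 := hZ p₀ hp₀
  rw [Bundle.contMDiffWithinAt_totalSpace] at h1 ⊢
  refine ⟨h1.1, ?_⟩
  have hqh : ContMDiff ((𝓡 n).prod 𝓘(ℝ, ℝ)) 𝓘(ℝ, ℝ) 1 (fun p : M × ℝ => q (h p.1)) :=
    (hq.contMDiff.comp (hh.of_le (by norm_num))).comp contMDiff_fst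
  have hf : ContMDiffWithinAt ((𝓡 n).prod 𝓘(ℝ, ℝ)) 𝓘(ℝ, ℝ) 1 (fun p : M × ℝ => q (h p.1))
      (univ ×ˢ S) p₀ := (hqh p₀).contMDiffWithinAt
  set e := trivializationAt (Euc n) (TangentSpace (𝓡 n) : M → Type _) p₀.1 with he
  have hb : p₀.1 ∈ e.baseSet := FiberBundle.mem_baseSet_trivializationAt' p₀.1
  refine (hf.smul h1.2).congr_of_eventuallyEq ?_ ?_
  · have hn : Prod.fst ⁻¹' e.baseSet ∈ 𝓝 p₀ :=
      continuous_fst.continuousAt.preimage_mem_nhds (e.open_baseSet.mem_nhds hb)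
    filter_upwards [mem_nhdsWithin_of_mem_nhds hn] with p hp
    exact (e.linear ℝ hp).2 (q (h p.1)) (Z p.2 p.1)
  · exact (e.linear ℝ hb).2 (q (h p₀.1)) (Z p₀.2 p₀.1)

/-- `paramDeriv` would be zero where the derivative fails to exist. Existence follows by reading the
family in a chart, where it is `C¹`, and returning to the fixed tangent space at `x` by a linear
map. -/
theorem hasDerivWithinAt_paramDeriv
    (hch : ∀ x : M, ∃ Ψ : AdaptedChart n d h, x ∈ Ψ.chart.source)
    (hZ : ContMDiffOn ((𝓡 n).prod 𝓘(ℝ, ℝ)) (𝓡 n).tangent 1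
      (fun p : M × ℝ => (⟨p.1, Z p.2 p.1⟩ : TangentBundle (𝓡 n) M)) (univ ×ˢ Icc 0 ε₀))
    (x : M) {e : ℝ} (he : e ∈ Icc 0 ε₀) :
    HasDerivWithinAt (F := Euc n) (fun e => Z e x) (paramDeriv ε₀ Z e x) (Icc 0 ε₀) e := by
  obtain ⟨Ψ, hΨ⟩ := hch x
  have h1 : ContDiffOn ℝ 1 (fun e => Ψ.field Z (Ψ.chart x, e)) (Icc 0 ε₀) :=
    (Ψ.contDiffOn_field hZ).comp (contDiff_const.prodMk contDiff_id).contDiffOn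
      (fun e he => ⟨Ψ.chart.map_source hΨ, he⟩)
  let L : Euc m × Euc d →L[ℝ] Euc n :=
    mfderiv 𝓘(ℝ, Euc m × Euc d) (𝓡 n) Ψ.chart.symm (Ψ.chart x)
  have h2 : DifferentiableWithinAt ℝ (fun e => L (Ψ.field Z (Ψ.chart x, e))) (Icc 0 ε₀) e :=
    L.differentiableAt.comp_differentiableWithinAt e ((h1.differentiableOn one_ne_zero) e he)
  have h3 : (fun e => L (Ψ.field Z (Ψ.chart x, e))) = fun e => (Z e x : Euc n) := by
    funext e
    rw [Ψ.field_apply e hΨ]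
    exact Ψ.mfderiv_symm_chartField (Z e) hΨ
  rw [h3] at h2
  exact h2.hasDerivWithinAt

theorem hasDerivWithinAt_cutoffField
    (hch : ∀ x : M, ∃ Ψ : AdaptedChart n d h, x ∈ Ψ.chart.source)
    (hZ : ContMDiffOn ((𝓡 n).prod 𝓘(ℝ, ℝ)) (𝓡 n).tangent 1
      (fun p : M × ℝ => (⟨p.1, Z p.2 p.1⟩ : TangentBundle (𝓡 n) M)) (univ ×ˢ Icc 0 ε₀))
    (x : M) {e : ℝ} (he : e ∈ Icc 0 ε₀) :
    HasDerivWithinAt (F := Euc n) (fun e => cutoffField q h Z e x)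
      (cutoffField q h (paramDeriv ε₀ Z) e x) (Icc 0 ε₀) e :=
  HasDerivWithinAt.const_smul (q (h x)) (hasDerivWithinAt_paramDeriv hch hZ x he)

end Cutoff

/-! ### The first integrals and the cut-off flow -/

section FirstIntegral

variable {n m d : ℕ} {M : Type*} [TopologicalSpace M] [ChartedSpace (Euc n) M]
  {h : M → Euc m} {q : Euc m → ℝ} [IsManifold (𝓡 n) ∞ M] [T2Space M]

/-- The infinitesimal form of conservation, obtained by differentiating along a short integral
curve; unlike the hypothesis on orbits, it passes to the cut-off field. -/
theorem mfderiv_eq_zero_of_flowMap {X : (x : M) → TangentSpace (𝓡 n) x}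
    (hh : ContMDiff (𝓡 n) (𝓡 m) 2 h)
    (hX : ContMDiff (𝓡 n) (𝓡 n).tangent 1 (fun x => (⟨x, X x⟩ : TangentBundle (𝓡 n) M)))
    {F : Type*} [NormedAddCommGroup F] [NormedSpace ℝ F]
    (hlip : ∀ x, LipschitzInChartAt F X x)
    (hint : ∀ (t : ℝ) (x : M), h (flowMap X t x) = h x) (x : M) :
    chartField h X x = 0 := by
  have : IsManifold (𝓡 n) 1 M := IsManifold.of_le (n := ∞) (by norm_cast)
  obtain ⟨γ, h0, hγ⟩ := exists_isMIntegralCurveAt_of_contMDiffAt_boundaryless (t₀ := 0)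
    (hX x)
  obtain ⟨ε, hε, hγε⟩ := isMIntegralCurveAt_iff'.1 hγ
  have h1 : ∀ t ∈ Metric.ball (0 : ℝ) ε, h (γ t) = h x := by
    intro t ht
    have hsub : uIcc 0 t ⊆ Metric.ball (0 : ℝ) ε := by
      rw [Real.ball_eq_Ioo] at ht ⊢
      exact ordConnected_Ioo.uIcc_subset (by constructor <;> linarith) ht
    rw [← flowMap_eq h0 (hγε.mono hsub) (fun s _ => hlip (γ s)), hint]
  have h2 := hasDerivWithinAt_comp_of_isMIntegralCurveOn hγε (Metric.mem_ball_self hε)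
    (ψ := h) ((hh (γ 0)).mdifferentiableAt (by norm_num))
  have h3 := h2.hasDerivAt (Metric.ball_mem_nhds 0 hε)
  have h4 : HasDerivAt (h ∘ γ) 0 0 := by
    refine (hasDerivAt_const 0 (h x)).congr_of_eventuallyEq ?_
    filter_upwards [Metric.ball_mem_nhds 0 hε] with t ht using h1 t ht
  have h5 := h3.unique h4
  rwa [h0] at h5

variable {Z : ℝ → (x : M) → TangentSpace (𝓡 n) x} {ε₀ : ℝ}
  (φ : GlobalFlow (cutoffField q h Z) (Icc 0 ε₀))

omit [IsManifold (𝓡 n) ∞ M] [T2Space M] in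
theorem chartField_cutoffField (e : ℝ) (x : M) :
    chartField h (cutoffField q h Z e) x = q (h x) • chartField h (Z e) x :=
  (mfderiv (𝓡 n) (𝓡 m) h x).map_smul (q (h x)) (Z e x)

omit [IsManifold (𝓡 n) ∞ M] [T2Space M] in
theorem GlobalFlow.hasDerivAt_comp (hh : ContMDiff (𝓡 n) (𝓡 m) 2 h) {e : ℝ} (he : e ∈ Icc 0 ε₀)
    (x : M) (t : ℝ) : HasDerivAt (fun t => h (φ.toFun e t x))
      (q (h (φ.toFun e t x)) • chartField h (Z e) (φ.toFun e t x)) t := by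
  rw [← chartField_cutoffField]
  have h1 := hasDerivWithinAt_comp_of_isMIntegralCurveOn (s := univ) (t := t) (ψ := h)
    ((φ.isMIntegralCurve e he x).isMIntegralCurveOn _) (mem_univ _)
    ((hh (φ.toFun e t x)).mdifferentiableAt (by norm_num))
  exact h1.hasDerivAt univ_mem

omit [IsManifold (𝓡 n) ∞ M] [T2Space M] in
theorem GlobalFlow.comp_eq (hε₀ : 0 ≤ ε₀) (hh : ContMDiff (𝓡 n) (𝓡 m) 2 h)
    (hZ0 : ∀ x, chartField h (Z 0) x = 0) (t : ℝ) (x : M) : h (φ.toFun 0 t x) = h x := by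
  have h00 : (0 : ℝ) ∈ Icc 0 ε₀ := ⟨le_rfl, hε₀⟩
  have h1 : ∀ t, HasDerivAt (fun t => h (φ.toFun 0 t x)) 0 t := fun t => by
    have := φ.hasDerivAt_comp hh h00 x t
    rwa [hZ0, smul_zero] at this
  have h2 := is_const_of_deriv_eq_zero (fun t => (h1 t).differentiableAt)
    (fun t => (h1 t).deriv) t 0
  simpa only [φ.map_zero 0 h00] using h2

omit [IsManifold (𝓡 n) ∞ M] in
/-- The flow of the unperturbed cut-off field is the original one up to a change of the speed that
depends on the level set only. -/
theorem GlobalFlow.eq_flowMap (hε₀ : 0 ≤ ε₀) (hh : ContMDiff (𝓡 n) (𝓡 m) 2 h)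
    {F : Type*} [NormedAddCommGroup F] [NormedSpace ℝ F]
    (hlip : ∀ x, LipschitzInChartAt F (Z 0) x)
    (hlip' : ∀ x, LipschitzInChartAt F (cutoffField q h Z 0) x)
    (hZ0 : ∀ x, chartField h (Z 0) x = 0) (t : ℝ) (x : M) :
    φ.toFun 0 t x = flowMap (Z 0) (q (h x) * t) x := by
  have h00 : (0 : ℝ) ∈ Icc 0 ε₀ := ⟨le_rfl, hε₀⟩
  rcases eq_or_ne (q (h x)) 0 with hq | hq
  · rw [hq, zero_mul, flowMap_zero]
    have h1 : cutoffField q h Z 0 x = 0 := by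
      rw [cutoffField, hq]
      exact zero_smul ℝ (Z 0 x)
    have h2 := eqOn_uIcc_of_isMIntegralCurveOn (t := t) (fun s _ => hlip' _)
      ((φ.isMIntegralCurve 0 h00 x).isMIntegralCurveOn _)
      ((isMIntegralCurve_const h1).isMIntegralCurveOn _) (φ.map_zero 0 h00 x)
    exact h2 right_mem_uIcc
  · have h1 := (φ.isMIntegralCurve 0 h00 x).comp_mul (q (h x))⁻¹
    -- The factor `q ∘ h` is constant along the orbit because `h` is, so a linear change of time
    -- removes it.
    have h2 : IsMIntegralCurve (fun s => φ.toFun 0 (s * (q (h x))⁻¹) x) (Z 0) := by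
      intro s
      have h3 := h1 s
      refine h3.congr_mfderiv ?_
      congr 1
      change (q (h x))⁻¹ • (q (h (φ.toFun 0 (s * (q (h x))⁻¹) x)) •
        Z 0 (φ.toFun 0 (s * (q (h x))⁻¹) x)) = _
      rw [φ.comp_eq hε₀ hh hZ0]
      exact inv_smul_smul₀ hq (Z 0 _)
    rw [flowMap_eq (γ := fun s => φ.toFun 0 (s * (q (h x))⁻¹) x) (by simp [φ.map_zero 0 h00])
      (h2.isMIntegralCurveOn _) (fun s _ => hlip _)]
    congr 1
    field_simp

end FirstIntegral
end Averaging

namespace Averaging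

theorem measurable_enorm_orbitIntegral {E M : Type*} [NormedAddCommGroup E] [NormedSpace ℝ E]
    [TopologicalSpace M] [FirstCountableTopology M] [LocallyCompactSpace M] [MeasurableSpace M]
    [OpensMeasurableSpace M] {ψ : ℝ → M → M} {F : M → E}
    (hψ : Continuous (fun p : ℝ × M => ψ p.1 p.2)) (hF : Continuous F) (a T : ℝ) :
    Measurable fun x => ‖a • orbitIntegral ψ F T x‖ₑ := by
  have h1 : Continuous fun x => a • orbitIntegral ψ F T x :=
    continuous_const.smul (continuous_orbitIntegral hψ hF T)
  exact h1.enorm.measurable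

/-! ### Time averages on almost every level set -/

section ErgodicVector

variable {m : ℕ} {M : Type*} [TopologicalSpace M] [FirstCountableTopology M] [LocallyCompactSpace M]
  [SecondCountableTopology M] [MeasurableSpace M] [BorelSpace M] {ψ : ℝ → M → M}
  {F : M → Euc m} {C : ℝ} {μ : Measure M} [IsFiniteMeasure μ]

theorem tendsto_lintegral_orbitIntegral_euclidean (hψ : Continuous (fun p : ℝ × M => ψ p.1 p.2))
    (hadd : ∀ s t x, ψ (s + t) x = ψ t (ψ s x)) (hzero : ∀ x, ψ 0 x = x)
    (hF : Continuous F) (hC : ∀ x, ‖F x‖ ≤ C) (hmp : ∀ t, MeasurePreserving (ψ t) μ μ)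
    (herg : ∀ A : Set M, MeasurableSet A → (∀ t x, ψ t x ∈ A ↔ x ∈ A) → μ A = 0 ∨ μ Aᶜ = 0)
    (hF0 : ∫ x, F x ∂μ = 0) :
    Tendsto (fun N : ℕ => ∫⁻ x, ‖(N : ℝ)⁻¹ • orbitIntegral ψ F N x‖ₑ ∂μ) atTop (𝓝 0) := by
  have hFi : ∀ i, Continuous fun x => F x i := fun i => by fun_prop
  have hint : Integrable F μ := .of_bound hF.measurable.aestronglyMeasurable C (.of_forall hC)
  have hcomp : ∀ i : Fin m, Tendsto
      (fun N : ℕ => ∫⁻ x, ‖(N : ℝ)⁻¹ • orbitIntegral ψ (fun x => F x i) N x‖ₑ ∂μ) atTop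
      (𝓝 0) := by
    intro i
    refine tendsto_lintegral_orbitIntegral hψ hadd hzero (hFi i) (C := C)
      (fun x => (PiLp.norm_apply_le (F x) i).trans (hC x)) hmp
      herg ?_
    have h1 := (EuclideanSpace.proj (𝕜 := ℝ) i).integral_comp_comm hint
    rw [hF0, map_zero] at h1
    exact h1
  have hsum := tendsto_finsetSum Finset.univ fun i _ => hcomp i
  rw [Finset.sum_const_zero] at hsum
  refine tendsto_of_tendsto_of_tendsto_of_le_of_le tendsto_const_nhds hsum
    (fun _ => zero_le) fun N => ?_
  have hle : ∀ x, ‖(N : ℝ)⁻¹ • orbitIntegral ψ F N x‖ₑ ≤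
      ∑ i, ‖(N : ℝ)⁻¹ • orbitIntegral ψ (fun x => F x i) N x‖ₑ := by
    intro x
    have h2 : ∀ i, orbitIntegral ψ (fun x => F x i) N x = orbitIntegral ψ F N x i := by
      intro i
      have hi : IntervalIntegrable (fun u => F (ψ u x)) volume 0 N :=
        (hF.comp (hψ.comp (Continuous.prodMk_left x))).intervalIntegrable _ _
      exact (EuclideanSpace.proj (𝕜 := ℝ) i).intervalIntegral_comp_comm hi
    simp only [h2]
    have h3 : ∀ v : Euc m, ‖v‖ₑ ≤ ∑ i, ‖v i‖ₑ := by
      intro v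
      have h4 : v = ∑ i, EuclideanSpace.single i (v i) := by
        ext j
        simp
      conv_lhs => rw [h4]
      refine (enorm_sum_le _ _).trans (Finset.sum_le_sum fun i _ => ?_)
      rw [← ofReal_norm, ← ofReal_norm, PiLp.norm_single]
    exact h3 ((N : ℝ)⁻¹ • orbitIntegral ψ F N x)
  have hm : ∀ i, Measurable fun x => ‖(N : ℝ)⁻¹ • orbitIntegral ψ (fun x => F x i) N x‖ₑ :=
    fun i => measurable_enorm_orbitIntegral hψ (hFi i) _ N
  refine (lintegral_mono hle).trans_eq ?_
  rw [lintegral_finsetSum _ fun i _ => hm i]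

end ErgodicVector

/-! ### Invariance and time averages for the integrated measure -/

section Invariance

variable {n m : ℕ} {M : Type*} [TopologicalSpace M] [ChartedSpace (Euc n) M]
  [IsManifold (𝓡 n) ∞ M] [MeasurableSpace M] [BorelSpace M]
  (g : Bundle.ContMDiffRiemannianMetric (𝓡 n) ∞ (EuclideanSpace ℝ (Fin n))
      (fun x : M => TangentSpace (𝓡 n) x))
  {h : M → Euc m} {ρ : M → ℝ} {q : Euc m → ℝ} {X : (x : M) → TangentSpace (𝓡 n) x}
  {ψ : ℝ → M → M} {U V : Set (Euc m)}

theorem fiberMeasure_inter (hh : Continuous h) (c : Euc m) (A : Set M) :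
    fiberMeasure g h ρ c (A ∩ h ⁻¹' {c}) = fiberMeasure g h ρ c A :=
  measure_inter_conull (fiberMeasure_compl g hh ρ c)

/-- A flow that differs from one that preserves the measures on the level sets by a change of the
speed that depends on the level set only preserves these measures. -/
theorem fiberMeasure_preimage_of_eq_flowMap (hh : Continuous h)
    (hψ : ∀ t x, ψ t x = flowMap X (q (h x) * t) x) {c : Euc m}
    (hpres : Preserves (flowMap X) (fiberMeasure g h ρ c)) (t : ℝ) {A : Set M}
    (hA : MeasurableSet A) : fiberMeasure g h ρ c (ψ t ⁻¹' A) = fiberMeasure g h ρ c A := by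
  rw [← hpres (q c * t) A hA, ← fiberMeasure_inter g hh, ← fiberMeasure_inter g hh c
    (flowMap X (q c * t) ⁻¹' A)]
  congr 1
  ext x
  refine and_congr_left fun (hx : h x = c) => ?_
  rw [mem_preimage, mem_preimage, hψ, hx]

variable [T2Space M] [SecondCountableTopology M]

omit [T2Space M] in
theorem totalMeasure_preimage
    (hh : ContMDiff (𝓡 n) (𝓡 m) 2 h)
    (hindep : ∀ x : M, Function.Surjective (mfderiv (𝓡 n) (𝓡 m) h x))
    (hρc : ContMDiff (𝓡 n) 𝓘(ℝ, ℝ) 1 ρ) (hρ : ∀ x, 0 < ρ x) (hU : MeasurableSet U)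
    {f : M → M} (hf : Measurable f)
    (hpres : ∀ c ∈ U, ∀ A, MeasurableSet A →
      fiberMeasure g h ρ c (f ⁻¹' A) = fiberMeasure g h ρ c A)
    {A : Set M} (hA : MeasurableSet A) :
    totalMeasure g h ρ U (f ⁻¹' A) = totalMeasure g h ρ U A := by
  rw [totalMeasure_apply g hh hindep hρc hρ U (hf hA), totalMeasure_apply g hh hindep hρc hρ U hA]
  exact setLIntegral_congr_fun hU fun c hc => hpres c hc A hA

omit [T2Space M] in
theorem totalMeasure_restrict
    (hh : ContMDiff (𝓡 n) (𝓡 m) 2 h)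
    (hindep : ∀ x : M, Function.Surjective (mfderiv (𝓡 n) (𝓡 m) h x))
    (hρc : ContMDiff (𝓡 n) 𝓘(ℝ, ℝ) 1 ρ) (hρ : ∀ x, 0 < ρ x) (hV : MeasurableSet V)
    (hVU : V ⊆ U) :
    (totalMeasure g h ρ U).restrict (h ⁻¹' V) = totalMeasure g h ρ V := by
  ext A hA
  have hm : MeasurableSet (h ⁻¹' V) := hh.continuous.measurable hV
  rw [Measure.restrict_apply hA, totalMeasure_apply g hh hindep hρc hρ U (hA.inter hm),
    totalMeasure_apply g hh hindep hρc hρ V hA]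
  conv_rhs => rw [← inter_eq_left.2 hVU, ← setLIntegral_indicator hV]
  congr 1
  funext c
  by_cases hc : c ∈ V
  · rw [indicator_of_mem hc, ← fiberMeasure_inter g hh.continuous c A,
      ← fiberMeasure_inter g hh.continuous]
    congr 1
    ext x
    exact and_congr_left fun (hx : h x = c) => and_iff_left (by rwa [mem_preimage, hx])
  · rw [indicator_of_notMem hc, ← fiberMeasure_inter g hh.continuous]
    convert measure_empty (μ := fiberMeasure g h ρ c)
    refine eq_empty_of_forall_notMem fun x hx => hc ?_
    have h1 : h x = c := hx.2
    exact h1 ▸ hx.1.2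

omit [T2Space M] in
theorem isFiniteMeasure_totalMeasure
    (hh : ContMDiff (𝓡 n) (𝓡 m) 2 h)
    (hindep : ∀ x : M, Function.Surjective (mfderiv (𝓡 n) (𝓡 m) h x))
    (hρc : ContMDiff (𝓡 n) 𝓘(ℝ, ℝ) 1 ρ) (hρ : ∀ x, 0 < ρ x) (hV : IsCompact V) {b : ℝ}
    (hfin : ∀ c ∈ V, IsFiniteMeasure (fiberMeasure g h ρ c))
    (hb : ∀ c ∈ V, (fiberMeasure g h ρ c).real univ ≤ b) :
    IsFiniteMeasure (totalMeasure g h ρ V) := by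
  refine ⟨?_⟩
  rw [totalMeasure_apply g hh hindep hρc hρ V .univ]
  calc ∫⁻ c in V, fiberMeasure g h ρ c univ ≤ ∫⁻ _ in V, ENNReal.ofReal b := by
        refine setLIntegral_mono' hV.measurableSet fun c hc => ?_
        have := hfin c hc
        rw [← ENNReal.ofReal_toReal (measure_ne_top (fiberMeasure g h ρ c) univ)]
        exact ENNReal.ofReal_le_ofReal (hb c hc)
    _ < ⊤ := by
        rw [setLIntegral_const]
        exact ENNReal.mul_lt_top ENNReal.ofReal_lt_top hV.measure_lt_top

/-- Ergodicity on almost every level set gives the convergence of the time averages in the mean,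
also for the measure on a union of level sets. -/
theorem tendsto_lintegral_totalMeasure_orbitIntegral
    (hh : ContMDiff (𝓡 n) (𝓡 m) 2 h)
    (hindep : ∀ x : M, Function.Surjective (mfderiv (𝓡 n) (𝓡 m) h x))
    (hρc : ContMDiff (𝓡 n) 𝓘(ℝ, ℝ) 1 ρ) (hρ : ∀ x, 0 < ρ x) (hV : IsCompact V) {b : ℝ}
    (hfin : ∀ c ∈ V, IsFiniteMeasure (fiberMeasure g h ρ c))
    (hb : ∀ c ∈ V, (fiberMeasure g h ρ c).real univ ≤ b)
    (hψ : Continuous (fun p : ℝ × M => ψ p.1 p.2))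
    (hadd : ∀ s t x, ψ (s + t) x = ψ t (ψ s x)) (hzero : ∀ x, ψ 0 x = x)
    (hpres : ∀ c ∈ V, ∀ t A, MeasurableSet A →
      fiberMeasure g h ρ c (ψ t ⁻¹' A) = fiberMeasure g h ρ c A)
    (herg : ∀ᵐ c : Euc m, c ∈ V → IsErgodicOn ψ (h ⁻¹' {c}) (fiberMeasure g h ρ c))
    {F : M → Euc m} (hF : Continuous F) {C : ℝ} (hC : ∀ x, ‖F x‖ ≤ C)
    (hF0 : ∀ c ∈ V, ∫ x, F x ∂(fiberMeasure g h ρ c) = 0) :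
    Tendsto (fun N : ℕ => ∫⁻ x, ‖(N : ℝ)⁻¹ • orbitIntegral ψ F N x‖ₑ ∂(totalMeasure g h ρ V))
      atTop (𝓝 0) := by
  have : LocallyCompactSpace M := ChartedSpace.locallyCompactSpace (Euc n) M
  have hmeas := measurable_fiberMeasure g hh hindep hρc hρ
  have hFm : ∀ N : ℕ, Measurable fun x => ‖(N : ℝ)⁻¹ • orbitIntegral ψ F N x‖ₑ := fun N =>
    measurable_enorm_orbitIntegral hψ hF _ N
  have hN1 : ∀ (N : ℕ) x, ‖(N : ℝ)⁻¹ • orbitIntegral ψ F N x‖ₑ ≤ ENNReal.ofReal C := by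
    intro N x
    rw [← ofReal_norm]
    refine ENNReal.ofReal_le_ofReal ?_
    have hC0 : 0 ≤ C := (norm_nonneg _).trans (hC x)
    have h1 := norm_orbitIntegral_le (ψ := ψ) hC N x
    rw [norm_smul, norm_inv, Real.norm_natCast]
    rw [Nat.abs_cast] at h1
    rcases N.eq_zero_or_pos with h0 | h0
    · simpa [h0] using hC0
    · have : (0 : ℝ) < N := by exact_mod_cast h0
      rw [inv_mul_le_iff₀ this]
      linarith
  have hbind : ∀ N : ℕ, ∫⁻ x, ‖(N : ℝ)⁻¹ • orbitIntegral ψ F N x‖ₑ ∂(totalMeasure g h ρ V) =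
      ∫⁻ c in V, ∫⁻ x, ‖(N : ℝ)⁻¹ • orbitIntegral ψ F N x‖ₑ ∂(fiberMeasure g h ρ c) := fun N =>
    Measure.lintegral_bind hmeas.aemeasurable (hFm N).aemeasurable
  simp only [hbind]
  rw [← lintegral_zero (μ := volume.restrict V)]
  -- Each time average is bounded by `C` and each fiber has mass at most `b`, so the convergence on
  -- almost every fiber can be integrated over the compact set `V`.
  refine tendsto_lintegral_of_dominated_convergence (fun _ => ENNReal.ofReal C * ENNReal.ofReal b)
    (fun N => (Measure.measurable_lintegral (hFm N)).comp hmeas) (fun N => ?_) ?_ ?_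
  · rw [EventuallyLE, ae_restrict_iff' hV.measurableSet]
    refine .of_forall fun c hc => ?_
    have := hfin c hc
    calc _ ≤ ∫⁻ x, ENNReal.ofReal C ∂(fiberMeasure g h ρ c) := lintegral_mono (hN1 N)
      _ = ENNReal.ofReal C * fiberMeasure g h ρ c univ := lintegral_const _
      _ ≤ _ := by
        gcongr
        rw [← ENNReal.ofReal_toReal (measure_ne_top (fiberMeasure g h ρ c) univ)]
        exact ENNReal.ofReal_le_ofReal (hb c hc)
  · rw [setLIntegral_const]
    exact (ENNReal.mul_lt_top (ENNReal.mul_lt_top ENNReal.ofReal_lt_top ENNReal.ofReal_lt_top)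
      hV.measure_lt_top).ne
  · rw [ae_restrict_iff' hV.measurableSet]
    filter_upwards [herg] with c hce hc
    have := hfin c hc
    set μ := fiberMeasure g h ρ c with hμ
    have hmp : ∀ t, MeasurePreserving (ψ t) μ μ := fun t =>
      have hm : Measurable (ψ t) := (hψ.comp (Continuous.prodMk_right t)).measurable
      ⟨hm, by ext A hA; rw [Measure.map_apply hm hA, hpres c hc t A hA]⟩
    exact tendsto_lintegral_orbitIntegral_euclidean hψ hadd hzero hF hC hmp
      (fun A hA hinv => hce hc A hA fun t x _ => hinv t x) (hF0 c hc)

end Invariance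
end Averaging

namespace Averaging

/-! ### Continuity of fixed-time averages in the parameter -/

section Parameter

variable {n m : ℕ} {M : Type*} [TopologicalSpace M] [ChartedSpace (Euc n) M]
  {X : ℝ → (x : M) → TangentSpace (𝓡 n) x} {ε₀ : ℝ}

omit [TopologicalSpace M] in
theorem enorm_smul_orbitIntegral_le {E : Type*} [NormedAddCommGroup E] [NormedSpace ℝ E]
    {ψ : ℝ → M → M} {F : M → E} {C : ℝ} (hC : ∀ x, ‖F x‖ ≤ C) (a T : ℝ) (x : M) :
    ‖a • orbitIntegral ψ F T x‖ₑ ≤ ENNReal.ofReal (|a| * (C * |T|)) := by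
  rw [← ofReal_norm, norm_smul, Real.norm_eq_abs]
  exact ENNReal.ofReal_le_ofReal
    (mul_le_mul_of_nonneg_left (norm_orbitIntegral_le hC T x) (abs_nonneg a))

theorem GlobalFlow.tendsto_lintegral_orbitIntegral [FirstCountableTopology M]
    [LocallyCompactSpace M] [MeasurableSpace M] [BorelSpace M]
    (φ : GlobalFlow X (Icc 0 ε₀)) (hε₀ : 0 ≤ ε₀)
    {F : M → Euc m} (hF : Continuous F) {C : ℝ} (hC : ∀ x, ‖F x‖ ≤ C) (μ : Measure M)
    [IsFiniteMeasure μ] (a T : ℝ) :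
    Tendsto (fun e => ∫⁻ x, ‖a • orbitIntegral (φ.toFun e) F T x‖ₑ ∂μ) (𝓝[Icc 0 ε₀] 0)
      (𝓝 (∫⁻ x, ‖a • orbitIntegral (φ.toFun 0) F T x‖ₑ ∂μ)) := by
  have h0 : (0 : ℝ) ∈ Icc 0 ε₀ := ⟨le_rfl, hε₀⟩
  refine tendsto_lintegral_filter_of_dominated_convergence
    (fun _ => ENNReal.ofReal (|a| * (C * |T|))) ?_
    (.of_forall fun e => .of_forall fun x => enorm_smul_orbitIntegral_le hC a T x) ?_ ?_
  · filter_upwards [self_mem_nhdsWithin] with e he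
    exact measurable_enorm_orbitIntegral (φ.continuous he) hF a T
  · rw [lintegral_const]
    exact (ENNReal.mul_lt_top ENNReal.ofReal_lt_top (measure_lt_top μ univ)).ne
  · refine .of_forall fun x => ?_
    have h1 : Tendsto (fun e => orbitIntegral (φ.toFun e) F T x) (𝓝[Icc 0 ε₀] 0)
        (𝓝 (orbitIntegral (φ.toFun 0) F T x)) := by
      refine intervalIntegral.tendsto_integral_filter_of_dominated_convergence (fun _ => C) ?_
        (.of_forall fun e => .of_forall fun u _ => hC _) intervalIntegrable_const
        (.of_forall fun u _ => ?_)
      · filter_upwards [self_mem_nhdsWithin] with e he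
        exact (hF.comp ((φ.continuous he).comp (Continuous.prodMk_left x))).aestronglyMeasurable
      · have h2 : ContinuousOn (fun e => φ.toFun e u x) (Icc 0 ε₀) :=
          φ.continuousOn.comp (f := fun e : ℝ => (e, u, x)) (by fun_prop)
            fun e he => ⟨he, mem_univ _⟩
        exact (hF.tendsto _).comp (h2 0 h0)
    exact (continuous_enorm.tendsto _).comp (h1.const_smul a)

end Parameter

/-! ### Identifying the stopped paths with integral curves -/

section Confinement

variable {k : ℕ} {N : Type*} [TopologicalSpace N] [ChartedSpace (EuclideanSpace ℝ (Fin k)) N]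
  [T2Space N] {F : Type*} [NormedAddCommGroup F] [NormedSpace ℝ F]
  {X X' : (x : N) → TangentSpace (𝓡 k) x}

/-- If the flow of `X` stays in a closed set `S`, then it is given by the integral curves of any
field that agrees with `X` near `S`. -/
theorem flowMap_eq_of_forall_mem {W S : Set N} (hW : IsOpen W) (hS : IsClosed S) (hSW : S ⊆ W)
    (hX : ∀ y ∈ W, LipschitzInChartAt F X y) (hXX' : ∀ y ∈ W, X' y = X y)
    {γ : ℝ → N} {t : ℝ} {x : N} (h0 : γ 0 = x) (hγ : IsMIntegralCurveOn γ X' (Icc 0 t))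
    (hx : x ∈ S) (hmem : ∀ u ∈ Ico 0 t, flowMap X u x ∈ S) :
    ∀ u ∈ Icc 0 t, γ u ∈ S ∧ flowMap X u x = γ u := by
  have hflow : ∀ u ∈ Icc 0 t, (∀ s ∈ Icc 0 u, γ s ∈ W) → flowMap X u x = γ u := by
    intro u hu hs
    refine flowMap_eq (F := F) h0 (fun s hs' => ?_) fun s hs' => ?_
    all_goals rw [uIcc_of_le hu.1] at hs'
    · rw [uIcc_of_le hu.1, ← hXX' _ (hs s hs')]
      exact (hγ s ⟨hs'.1, hs'.2.trans hu.2⟩).mono (Icc_subset_Icc_right hu.2)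
    · exact hX _ (hs s hs')
  have hcl : ∀ u ∈ Icc 0 t, (∀ s ∈ Ico 0 u, γ s ∈ S) → γ u ∈ S := by
    intro u hu hs
    rcases hu.1.eq_or_lt with h | h
    · rwa [← h, h0]
    · have h1 : Tendsto γ (𝓝[<] u) (𝓝 (γ u)) := by
        have h2 := hγ.continuousOn u hu
        refine h2.mono_left ?_
        rw [← nhdsWithin_Ico_eq_nhdsLT h]
        exact nhdsWithin_mono u (fun s hs => ⟨hs.1, hs.2.le.trans hu.2⟩)
      refine hS.mem_of_tendsto h1 ?_
      rw [← nhdsWithin_Ico_eq_nhdsLT h]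
      exact eventually_mem_nhdsWithin.mono hs
  -- At the first time `u₀` at which `γ` is outside of `W`, the curve agrees with the flow of `X` at
  -- all earlier times, hence was in `S`; as `S` is closed, `γ u₀` is in `S` and so in `W`, a
  -- contradiction. Since `hmem` omits the final time, closedness is used there too.
  have hall : ∀ u ∈ Icc 0 t, γ u ∈ W := by
    by_contra! hcon
    set B := Icc 0 t ∩ γ ⁻¹' Wᶜ with hB
    have hBc : IsCompact B :=
      isCompact_Icc.of_isClosed_subset
        (hγ.continuousOn.preimage_isClosed_of_isClosed isClosed_Icc hW.isClosed_compl)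
        inter_subset_left
    obtain ⟨u, hu⟩ := hcon
    obtain ⟨u₀, hu₀, hmin⟩ := hBc.exists_isLeast ⟨u, hu.1, hu.2⟩
    have hbefore : ∀ s ∈ Ico 0 u₀, γ s ∈ W := fun s hs => by
      by_contra h
      exact hs.2.not_ge (hmin ⟨⟨hs.1, hs.2.le.trans hu₀.1.2⟩, h⟩)
    refine hu₀.2 (hSW (hcl u₀ hu₀.1 fun s hs => ?_))
    have hst : s ∈ Ico 0 t := ⟨hs.1, hs.2.trans_le hu₀.1.2⟩
    rw [← hflow s ⟨hst.1, hst.2.le⟩ fun s' hs' => hbefore s' ⟨hs'.1, hs'.2.trans_lt hs.2⟩]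
    exact hmem s hst
  have hfl : ∀ u ∈ Icc 0 t, flowMap X u x = γ u := fun u hu =>
    hflow u hu fun s hs => hall s ⟨hs.1, hs.2.trans hu.2⟩
  refine fun u hu => ⟨hcl u hu fun s hs => ?_, hfl u hu⟩
  have hst : s ∈ Ico 0 t := ⟨hs.1, hs.2.trans_le hu.2⟩
  rw [← hfl s ⟨hst.1, hst.2.le⟩]
  exact hmem s hst

theorem lipschitzInChartAt_of_lipschitzOnWith {f : Euc k → Euc k} {K : NNReal} {W : Set (Euc k)}
    (hW : IsOpen W) (hf : LipschitzOnWith K f W) {y : Euc k} (hy : y ∈ W) :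
    LipschitzInChartAt (N := Euc k) (I := 𝓡 k) (Euc k) f y := by
  refine ⟨W, id, f, K, hW, hy, fun y _ => mdifferentiableAt_id, injOn_id W, by rwa [image_id],
    fun y _ => ?_⟩
  exact congrArg (fun L => L (f y)) (mfderiv_id (I := 𝓡 k) (x := y))

theorem isMIntegralCurveOn_of_hasDerivWithinAt {f : Euc k → Euc k} {γ : ℝ → Euc k} {s : Set ℝ}
    (hγ : ∀ t ∈ s, HasDerivWithinAt γ (f (γ t)) s t) :
    IsMIntegralCurveOn (M := Euc k) (I := 𝓡 k) γ f s := fun t ht =>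
  hasMFDerivWithinAt_iff_hasFDerivWithinAt.2 (hγ t ht).hasFDerivWithinAt

end Confinement

/-! ### Extension of the averaged field and stability of its solutions -/

section ODE

variable {m : ℕ}

/-- The components are extended as real Lipschitz functions and truncated at the bound valid on `V`,
which keeps the Lipschitz constant. The extended equation is solvable on every bounded interval. -/
theorem LipschitzOnWith.exists_bounded_extension {f : Euc m → Euc m} {K : NNReal}
    {V : Set (Euc m)} (hV : IsCompact V) (hf : LipschitzOnWith K f V) :
    ∃ (L B : NNReal) (f' : Euc m → Euc m), LipschitzWith L f' ∧ (∀ x, ‖f' x‖ ≤ B) ∧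
      EqOn f f' V := by
  obtain ⟨B, hB⟩ := hV.exists_bound_of_continuousOn hf.continuousOn
  have hfi : ∀ i, LipschitzOnWith K (fun x => f x i) V := fun i =>
    LipschitzOnWith.of_dist_le_mul fun x hx y hy =>
      (PiLp.dist_apply_le (f x) (f y) i).trans (hf.dist_le_mul x hx y hy)
  choose g hg hfg using fun i => (hfi i).extend_real
  have hB' : ∀ x ∈ V, ∀ i, |f x i| ≤ |B| := fun x hx i =>
    ((PiLp.norm_apply_le (f x) i).trans (hB x hx)).trans (le_abs_self B)
  set G : Euc m → Fin m → ℝ := fun x i => max (-|B|) (min |B| (g i x)) with hG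
  have hGl : LipschitzWith K G := by
    refine LipschitzWith.of_dist_le_mul fun x y => (dist_pi_le_iff (by positivity)).2 fun i => ?_
    exact (((hg i).const_min |B|).const_max (-|B|)).dist_le_mul x y
  have hGb : ∀ x, dist (G x) 0 ≤ |B| := fun x =>
    (dist_pi_le_iff (abs_nonneg B)).2 fun i => by
      rw [Pi.zero_apply, Real.dist_eq, sub_zero, abs_le]
      exact ⟨le_max_left _ _, max_le (neg_le_self (abs_nonneg B)) (min_le_left _ _)⟩
  obtain ⟨c, hlp⟩ : ∃ c, LipschitzWith c (WithLp.toLp 2 : (Fin m → ℝ) → Euc m) :=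
    ⟨_, PiLp.lipschitzWith_toLp 2 (fun _ : Fin m => ℝ)⟩
  refine ⟨c * K, c * ⟨|B|, abs_nonneg B⟩, fun x => WithLp.toLp 2 (G x),
    hlp.comp hGl, fun x => ?_, fun x hx => ?_⟩
  · rw [← dist_zero_right]
    exact (hlp.dist_le_mul (G x) 0).trans (mul_le_mul_of_nonneg_left (hGb x) (NNReal.coe_nonneg _))
  · ext i
    have h1 := abs_le.1 (hB' x hx i)
    change f x i = max (-|B|) (min |B| (g i x))
    rw [← hfg i hx, min_eq_right h1.2, max_eq_right h1.1]

theorem exists_hasDerivWithinAt_of_lipschitzWith {f : Euc m → Euc m} {L B : NNReal}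
    (hf : LipschitzWith L f) (hB : ∀ x, ‖f x‖ ≤ B) {T : ℝ} (hT : 0 ≤ T) (x : Euc m) :
    ∃ b : ℝ → Euc m, b 0 = x ∧ ∀ t ∈ Icc 0 T, HasDerivWithinAt b (f (b t)) (Icc 0 T) t := by
  have h1 : IsPicardLindelof (fun _ => f) (⟨0, le_rfl, hT⟩ : Icc 0 T) x (B * ⟨T, hT⟩) 0 B L :=
    .of_time_independent (fun x _ => hB x) hf.lipschitzOnWith (by simp [hT]; rfl)
  exact h1.exists_eq_forall_mem_Icc_hasDerivWithinAt₀

/-- Averaging for paths: `a` follows the solution `b` of `b' = H(b)` if `a' - H(a)` is, up to a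
small error, the derivative of a small function. -/
theorem exists_norm_sub_lt_of_averaged {H : Euc m → Euc m} {L : NNReal} (hH : LipschitzWith L H)
    {T δ : ℝ} (hT : 0 ≤ T) (hδ : 0 < δ) :
    ∃ κ > 0, ∀ (S : ℝ) (a b p a' p' : ℝ → Euc m), S ≤ T →
      (∀ t ∈ Icc 0 S, HasDerivWithinAt a (a' t) (Icc 0 S) t) →
      (∀ t ∈ Icc 0 S, HasDerivWithinAt p (p' t) (Icc 0 S) t) →
      (∀ t ∈ Icc 0 S, HasDerivWithinAt b (H (b t)) (Icc 0 S) t) →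
      a 0 = b 0 → p 0 = 0 → (∀ t ∈ Icc 0 S, ‖a' t - p' t - H (a t)‖ ≤ κ) →
      (∀ t ∈ Icc 0 S, ‖p t‖ ≤ κ) → ∀ t ∈ Icc 0 S, ‖a t - b t‖ < δ := by
  -- A nonzero constant avoids the degenerate case of the Gronwall bound.
  set K : NNReal := L + 1 with hK
  have hKL : LipschitzWith K H := hH.weaken le_self_add
  have hK0 : (0 : ℝ) < K := by rw [hK]; positivity
  set G : ℝ := (Real.exp (K * T) - 1) / K with hG
  have hG0 : 0 ≤ G := div_nonneg (sub_nonneg.2 (Real.one_le_exp (by positivity))) hK0.le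
  have hA : 0 < (1 + K) * G + 1 := by positivity
  -- The curve `a - p` solves the equation up to the error `κ + K * κ`, so it is within `κ * (1 + K)
  -- * G` of `b`. Adding back `p` gives `κ * ((1 + K) * G + 1) = δ / 2`.
  refine ⟨δ / (2 * ((1 + K) * G + 1)), by positivity, ?_⟩
  set κ := δ / (2 * ((1 + K) * G + 1)) with hκ
  intro S a b p a' p' hST ha hp hb h0 hp0 hη hpκ t ht
  have hright : ∀ {f : ℝ → Euc m} {v : Euc m} {t : ℝ}, t ∈ Ico 0 S →
      HasDerivWithinAt f v (Icc 0 S) t → HasDerivWithinAt f v (Ici t) t := by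
    intro f v t ht hf
    refine (hf.mono (Icc_subset_Icc_left ht.1)).mono_of_mem_nhdsWithin ?_
    exact Icc_mem_nhdsGE ht.2
  have h1 := dist_le_of_approx_trajectories_ODE (v := fun _ => H) (K := K) (a := 0) (b := S)
    (f := fun t => a t - p t) (f' := fun t => a' t - p' t) (g := b) (g' := fun t => H (b t))
    (εf := κ + K * κ) (εg := 0) (δ := 0) (fun _ => hKL)
    (fun t ht => ((ha t ht).sub (hp t ht)).continuousWithinAt)
    (fun t ht => hright ht ((ha t ⟨ht.1, ht.2.le⟩).sub (hp t ⟨ht.1, ht.2.le⟩)))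
    (fun t ht => ?_) (fun t ht => (hb t ht).continuousWithinAt)
    (fun t ht => hright ht (hb t ⟨ht.1, ht.2.le⟩)) (fun t ht => by simp) (by simp [h0, hp0]) t ht
  · simp only [gronwallBound_of_K_ne_0 hK0.ne', sub_zero, add_zero, zero_mul, zero_add] at h1
    have hκ0 : 0 < κ := by positivity
    have h2 : (κ + K * κ) / K * (Real.exp (K * t) - 1) ≤ κ * ((1 + K) * G) := by
      have : Real.exp (K * t) ≤ Real.exp (K * T) := by
        apply Real.exp_le_exp.2
        gcongr
        exact ht.2.trans hST
      calc (κ + K * κ) / K * (Real.exp (K * t) - 1)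
          ≤ (κ + K * κ) / K * (Real.exp (K * T) - 1) := by gcongr
        _ = _ := by rw [hG]; ring
    have h3 : κ * ((1 + K) * G) + κ = δ / 2 := by
      rw [hκ]
      field_simp
    calc ‖a t - b t‖ = ‖(a t - p t - b t) + p t‖ := by congr 1; abel
      _ ≤ ‖a t - p t - b t‖ + ‖p t‖ := norm_add_le _ _
      _ ≤ κ * ((1 + K) * G) + κ :=
        add_le_add ((dist_eq_norm (a t - p t) (b t) ▸ h1).trans h2) (hpκ t ht)
      _ < δ := by linarith
  · have ht' : t ∈ Icc 0 S := ⟨ht.1, ht.2.le⟩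
    have h2 : ‖H (a t) - H (a t - p t)‖ ≤ K * κ := by
      refine (hKL.norm_sub_le _ _).trans ?_
      rw [sub_sub_cancel]
      exact mul_le_mul_of_nonneg_left (hpκ t ht') hK0.le
    rw [dist_eq_norm]
    calc ‖a' t - p' t - H (a t - p t)‖
        = ‖(a' t - p' t - H (a t)) + (H (a t) - H (a t - p t))‖ := by congr 1; abel
      _ ≤ _ := (norm_add_le _ _).trans (add_le_add (hη t ht') h2)

end ODE
end Averaging

namespace Averaging

/-! ### The drift of the slow variables -/

section Drift

variable {n m d : ℕ} {M : Type*} [TopologicalSpace M] [ChartedSpace (Euc n) M]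
  [IsManifold (𝓡 n) ∞ M] {h : M → Euc m} {Z : ℝ → (x : M) → TangentSpace (𝓡 n) x} {ε₀ : ℝ}

theorem contMDiffOn_chartField {W : ℝ → (x : M) → TangentSpace (𝓡 n) x} {S : Set ℝ}
    (hh : ContMDiff (𝓡 n) (𝓡 m) 2 h)
    (hW : ContMDiffOn ((𝓡 n).prod 𝓘(ℝ, ℝ)) (𝓡 n).tangent 1
      (fun p : M × ℝ => (⟨p.1, W p.2 p.1⟩ : TangentBundle (𝓡 n) M)) (univ ×ˢ S)) :
    ContMDiffOn ((𝓡 n).prod 𝓘(ℝ, ℝ)) (𝓡 m) 1 (fun p : M × ℝ => chartField h (W p.2) p.1)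
      (univ ×ˢ S) := by
  have : IsManifold (𝓡 n) 1 M := IsManifold.of_le (n := ∞) (by norm_cast)
  exact contMDiffOn_mfderiv_apply_vectorSpace (f := h) (b := Prod.fst)
    (W := fun p : M × ℝ => W p.2 p.1) isOpen_univ hh.contMDiffOn (mapsTo_univ _ _) hW

theorem contMDiff_slowDrift (hε₀ : 0 ≤ ε₀) (hh : ContMDiff (𝓡 n) (𝓡 m) 2 h)
    (hZ' : ContMDiffOn ((𝓡 n).prod 𝓘(ℝ, ℝ)) (𝓡 n).tangent 1
      (fun p : M × ℝ => (⟨p.1, paramDeriv ε₀ Z p.2 p.1⟩ : TangentBundle (𝓡 n) M))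
      (univ ×ˢ Icc 0 ε₀)) :
    ContMDiff (𝓡 n) (𝓡 m) 1 (slowDrift ε₀ Z h) := by
  rw [← contMDiffOn_univ]
  exact (contMDiffOn_chartField hh hZ').comp
    (contMDiff_id.prodMk (contMDiff_const (c := (0 : ℝ)))).contMDiffOn
    fun x _ => ⟨mem_univ _, le_rfl, hε₀⟩

/-- The rate of change of `h` along `Z e` is `e` times the drift, up to an error of smaller order,
uniformly on compact sets. -/
theorem eventually_norm_chartField_sub_slowDrift_le (hε₀ : 0 < ε₀)
    (hch : ∀ x : M, ∃ Ψ : AdaptedChart n d h, x ∈ Ψ.chart.source)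
    (hh : ContMDiff (𝓡 n) (𝓡 m) 2 h)
    (hZ : ContMDiffOn ((𝓡 n).prod 𝓘(ℝ, ℝ)) (𝓡 n).tangent 1
      (fun p : M × ℝ => (⟨p.1, Z p.2 p.1⟩ : TangentBundle (𝓡 n) M)) (univ ×ˢ Icc 0 ε₀))
    (hZ' : ContMDiffOn ((𝓡 n).prod 𝓘(ℝ, ℝ)) (𝓡 n).tangent 1
      (fun p : M × ℝ => (⟨p.1, paramDeriv ε₀ Z p.2 p.1⟩ : TangentBundle (𝓡 n) M))
      (univ ×ˢ Icc 0 ε₀))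
    (hZ0 : ∀ x, chartField h (Z 0) x = 0) {K : Set M} (hK : IsCompact K) {η : ℝ} (hη : 0 < η) :
    ∀ᶠ e in 𝓝[>] (0 : ℝ), ∀ y ∈ K,
      ‖e⁻¹ • chartField h (Z e) y - slowDrift ε₀ Z h y‖ ≤ η := by
  set f' : ℝ → M → Euc m := fun e y => chartField h (paramDeriv ε₀ Z e) y with hf'
  have hcont : ContinuousOn (fun p : M × ℝ => f' p.2 p.1) (univ ×ˢ Icc 0 ε₀) :=
    (contMDiffOn_chartField hh hZ').continuousOn
  have h00 : (0 : ℝ) ∈ Icc 0 ε₀ := ⟨le_rfl, hε₀.le⟩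
  have hunif : ∀ᶠ e in 𝓝 (0 : ℝ), ∀ y ∈ K, e ∈ Icc 0 ε₀ → ‖f' e y - f' 0 y‖ ≤ η := by
    refine hK.eventually_forall_of_forall_eventually
      (P := fun e y => e ∈ Icc 0 ε₀ → ‖f' e y - f' 0 y‖ ≤ η) fun y _ => ?_
    have h1 : ContinuousOn (fun p : ℝ × M => ‖f' p.1 p.2 - f' 0 p.2‖) (Icc 0 ε₀ ×ˢ univ) := by
      refine (ContinuousOn.sub ?_ ?_).norm
      · exact hcont.comp continuous_swap.continuousOn fun p hp => ⟨hp.2, hp.1⟩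
      · exact hcont.comp (f := fun p : ℝ × M => (p.2, (0 : ℝ))) (by fun_prop)
          fun p _ => ⟨mem_univ _, h00⟩
    have h2 := h1 (0, y) ⟨h00, mem_univ _⟩
    have h3 : ∀ᶠ p in 𝓝[Icc 0 ε₀ ×ˢ univ] ((0 : ℝ), y), ‖f' p.1 p.2 - f' 0 p.2‖ < η :=
      h2.eventually_lt_const (by simpa using hη)
    filter_upwards [eventually_nhdsWithin_iff.1 h3] with p hp hp1
    exact (hp ⟨hp1, mem_univ _⟩).le
  obtain ⟨ε₁, hε₁, hball⟩ := Metric.eventually_nhds_iff.1 hunif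
  filter_upwards [Ioo_mem_nhdsGT (lt_min hε₀ hε₁)] with e he y hy
  have he0 : 0 < e := he.1
  have hsub : Icc 0 e ⊆ Icc 0 ε₀ := Icc_subset_Icc_right (he.2.le.trans (min_le_left _ _))
  let L : Euc n →L[ℝ] Euc m := mfderiv (𝓡 n) (𝓡 m) h y
  -- The function vanishes at `s = 0` since `h` is conserved by `Z 0`, and its derivative is at most
  -- `η`; the mean value inequality gives the bound `η * e`.
  have hderiv : ∀ s ∈ Icc 0 e, HasDerivWithinAt (fun s => chartField h (Z s) y - s • f' 0 y)
      (f' s y - f' 0 y) (Icc 0 e) s := by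
    intro s hs
    have h1 : HasDerivWithinAt (fun s => L (Z s y)) (L (paramDeriv ε₀ Z s y)) (Icc 0 ε₀) s :=
      L.hasFDerivAt.comp_hasDerivWithinAt s (hasDerivWithinAt_paramDeriv hch hZ y (hsub hs))
    have h2 : HasDerivWithinAt (fun s : ℝ => s • f' 0 y) (f' 0 y) (Icc 0 e) s := by
      simpa using (hasDerivWithinAt_id s (Icc 0 e)).smul_const (f' 0 y)
    exact (h1.mono hsub).sub h2
  have h1 := norm_image_sub_le_of_norm_deriv_le_segment' hderiv
    (fun s hs => hball (y := s) (by
      rw [dist_zero_right, Real.norm_eq_abs, abs_of_nonneg hs.1]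
      exact hs.2.trans (he.2.trans_le (min_le_right _ _))) y hy (hsub ⟨hs.1, hs.2.le⟩))
    e ⟨he0.le, le_rfl⟩
  rw [hZ0, zero_smul, sub_zero, sub_zero, sub_zero] at h1
  have h2 : e⁻¹ • chartField h (Z e) y - slowDrift ε₀ Z h y =
      e⁻¹ • (chartField h (Z e) y - e • f' 0 y) := by
    rw [smul_sub, inv_smul_smul₀ he0.ne']
    rfl
  rw [h2, norm_smul, norm_inv, Real.norm_eq_abs, abs_of_pos he0, inv_mul_le_iff₀ he0, mul_comm]
  exact h1

end Drift

/-! ### Division of the orbits into blocks -/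

section Blocks

variable {n m : ℕ} {M : Type*} [TopologicalSpace M] [ChartedSpace (Euc n) M]
  {X : ℝ → (x : M) → TangentSpace (𝓡 n) x} {ε₀ : ℝ} (φ : GlobalFlow X (Icc 0 ε₀)) {K : Set M}
  {e : ℝ} {F : M → Euc m}

/-- The points whose orbit stays in `K` up to time `t`. -/
def GlobalFlow.stayingSet (e : ℝ) (K : Set M) (t : ℝ) : Set M :=
  {z | ∀ u ∈ Icc 0 t, φ.toFun e u z ∈ K}

theorem GlobalFlow.isClosed_stayingSet (he : e ∈ Icc 0 ε₀) (hK : IsClosed K) (t : ℝ) :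
    IsClosed (φ.stayingSet e K t) := by
  simp only [stayingSet, ofPred_forall]
  exact isClosed_biInter fun u _ =>
    hK.preimage ((φ.continuous he).comp (Continuous.prodMk_right u))

/-- The sum of the lengths of the integrals of `F` over successive blocks of length `N` of an
orbit, as long as the orbit stays in `K`. -/
noncomputable def GlobalFlow.blockSum (e : ℝ) (K : Set M) (F : M → Euc m) (N : ℝ) (J : ℕ) (z : M) :
    ℝ≥0∞ :=
  ∑ k ∈ Finset.range J, (φ.stayingSet e K (k * N)).indicator
    (fun z => ‖orbitIntegral (φ.toFun e) F N (φ.toFun e (k * N) z)‖ₑ) z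

theorem GlobalFlow.orbitIntegral_mul (he : e ∈ Icc 0 ε₀) (hF : Continuous F) (N : ℝ) (j : ℕ)
    (z : M) : orbitIntegral (φ.toFun e) F (j * N) z =
      ∑ k ∈ Finset.range j, orbitIntegral (φ.toFun e) F N (φ.toFun e (k * N) z) := by
  induction j with
  | zero => simp [orbitIntegral]
  | succ j ih =>
    rw [Finset.sum_range_succ, ← ih, ← orbitIntegral_add (φ.continuous he) hF (φ.map_add e he)]
    push_cast
    ring_nf

/-- Whole blocks are bounded by the sum, and a remainder of length at most `N` is left. The right
side does not depend on `t`, which is what controls the supremum over all times. -/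
theorem GlobalFlow.enorm_orbitIntegral_le_blockSum (he : e ∈ Icc 0 ε₀) (hF : Continuous F)
    {C : ℝ} (hC : ∀ x, ‖F x‖ ≤ C) {N : ℝ} (hN : 0 < N) {J : ℕ} {t : ℝ} (ht : 0 ≤ t)
    (hJ : ⌊t / N⌋₊ ≤ J) {z : M} (hz : z ∈ φ.stayingSet e K t) :
    ‖orbitIntegral (φ.toFun e) F t z‖ₑ ≤ φ.blockSum e K F N J z + ENNReal.ofReal (C * N) := by
  set j := ⌊t / N⌋₊ with hj
  have h1 : (j : ℝ) * N ≤ t := (le_div_iff₀ hN).1 (Nat.floor_le (by positivity))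
  have h2 : t - j * N ≤ N := by
    have := (div_lt_iff₀ hN).1 (Nat.lt_floor_add_one (t / N))
    rw [← hj] at this
    linarith
  have h3 : orbitIntegral (φ.toFun e) F t z = orbitIntegral (φ.toFun e) F (j * N) z +
      orbitIntegral (φ.toFun e) F (t - j * N) (φ.toFun e (j * N) z) := by
    rw [← orbitIntegral_add (φ.continuous he) hF (φ.map_add e he), add_sub_cancel]
  rw [h3, φ.orbitIntegral_mul he hF]
  refine (enorm_add_le _ _).trans (add_le_add ?_ ?_)
  · calc _ ≤ ∑ k ∈ Finset.range j, ‖orbitIntegral (φ.toFun e) F N (φ.toFun e (k * N) z)‖ₑ :=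
          enorm_sum_le _ _
      _ = ∑ k ∈ Finset.range j, (φ.stayingSet e K (k * N)).indicator
            (fun z => ‖orbitIntegral (φ.toFun e) F N (φ.toFun e (k * N) z)‖ₑ) z := by
          refine Finset.sum_congr rfl fun k hk => ?_
          rw [indicator_of_mem]
          refine fun u hu => hz u ⟨hu.1, hu.2.trans (le_trans ?_ h1)⟩
          have : (k : ℝ) ≤ j := by exact_mod_cast (Finset.mem_range.1 hk).le
          gcongr
      _ ≤ φ.blockSum e K F N J z :=
          Finset.sum_le_sum_of_subset (Finset.range_subset_range.2 hJ)
  · rw [← ofReal_norm]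
    refine ENNReal.ofReal_le_ofReal ((norm_orbitIntegral_le hC _ _).trans ?_)
    rw [abs_of_nonneg (by linarith)]
    exact mul_le_mul_of_nonneg_left h2 ((norm_nonneg _).trans (hC z))

variable [MeasurableSpace M] [BorelSpace M] {μ : Measure M}

/-- The image under the flow of the measure on the staying set is dominated by the distortion factor
times the measure itself. -/
theorem GlobalFlow.lintegral_indicator_stayingSet_le {C s₀ : ℝ} (hK : IsClosed K)
    (he : e ∈ Icc 0 ε₀) (hs₀ : 0 < s₀)
    (hshort : ∀ s ∈ Icc 0 s₀, ∀ E ⊆ K, MeasurableSet E →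
        μ (φ.toFun e s ⁻¹' E) ≤ ENNReal.ofReal (Real.exp (C * e * s)) * μ E)
    {t : ℝ} (ht : 0 ≤ t) {f : M → ℝ≥0∞} (hf : Measurable f) :
    ∫⁻ z, (φ.stayingSet e K t).indicator (fun z => f (φ.toFun e t z)) z ∂μ ≤
      ENNReal.ofReal (Real.exp (C * e * t)) * ∫⁻ z, f z ∂μ := by
  have hGm : MeasurableSet (φ.stayingSet e K t) :=
    (φ.isClosed_stayingSet he hK t).measurableSet
  have hm : Measurable (φ.toFun e t) :=
    ((φ.continuous he).comp (Continuous.prodMk_right t)).measurable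
  have hle : (μ.restrict (φ.stayingSet e K t)).map (φ.toFun e t) ≤
      ENNReal.ofReal (Real.exp (C * e * t)) • μ := by
    refine Measure.le_iff.2 fun E hE => ?_
    rw [Measure.map_apply hm hE, Measure.restrict_apply (hm hE), inter_comm]
    exact φ.measure_le_of_short_time hK.measurableSet he hs₀ hshort ht hE
  rw [lintegral_indicator hGm, ← lintegral_map hf hm, ← smul_eq_mul, ← lintegral_smul_measure]
  exact lintegral_mono' hle le_rfl

theorem GlobalFlow.measurable_blockSum [FirstCountableTopology M] [LocallyCompactSpace M]
    (he : e ∈ Icc 0 ε₀) (hK : IsClosed K) (hF : Continuous F) (N : ℝ) (J : ℕ) :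
    Measurable (φ.blockSum e K F N J) := by
  refine Finset.measurable_sum _ fun k _ => Measurable.indicator ?_
    (φ.isClosed_stayingSet he hK _).measurableSet
  have h1 := (continuous_orbitIntegral (φ.continuous he) hF N).comp
    ((φ.continuous he).comp (Continuous.prodMk_right (k * N)))
  exact h1.enorm.measurable

/-- Every block starts at a time of at most `T / e`, so its distortion factor is at most `exp (C *
T)`, uniformly in `e`, and all blocks reduce to the first one. -/
theorem GlobalFlow.lintegral_blockSum_le [FirstCountableTopology M] [LocallyCompactSpace M]
    {C s₀ : ℝ} (hC : 0 ≤ C) (hK : IsClosed K)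
    (he : e ∈ Icc 0 ε₀) (hs₀ : 0 < s₀)
    (hshort : ∀ s ∈ Icc 0 s₀, ∀ E ⊆ K, MeasurableSet E →
        μ (φ.toFun e s ⁻¹' E) ≤ ENNReal.ofReal (Real.exp (C * e * s)) * μ E)
    (hF : Continuous F) {N T : ℝ} (hN : 0 < N) {J : ℕ} (hJ : e * (J * N) ≤ T) :
    ∫⁻ z, φ.blockSum e K F N J z ∂μ ≤
      J * (ENNReal.ofReal (Real.exp (C * T)) * ∫⁻ z, ‖orbitIntegral (φ.toFun e) F N z‖ₑ ∂μ) := by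
  have hFm : Measurable fun z => ‖orbitIntegral (φ.toFun e) F N z‖ₑ :=
    (continuous_orbitIntegral (φ.continuous he) hF N).enorm.measurable
  have hm : ∀ k : ℕ, Measurable ((φ.stayingSet e K (k * N)).indicator
      (fun z => ‖orbitIntegral (φ.toFun e) F N (φ.toFun e (k * N) z)‖ₑ)) := fun k => by
    refine Measurable.indicator ?_ (φ.isClosed_stayingSet he hK _).measurableSet
    exact hFm.comp ((φ.continuous he).comp (Continuous.prodMk_right (k * N))).measurable
  simp only [blockSum]
  rw [lintegral_finsetSum _ fun k _ => hm k]
  calc _ ≤ ∑ k ∈ Finset.range J, (ENNReal.ofReal (Real.exp (C * T)) *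
        ∫⁻ z, ‖orbitIntegral (φ.toFun e) F N z‖ₑ ∂μ) := by
        refine Finset.sum_le_sum fun k hk => ?_
        refine (φ.lintegral_indicator_stayingSet_le hK he hs₀ hshort (by positivity) hFm).trans ?_
        refine mul_le_mul_left (ENNReal.ofReal_le_ofReal (Real.exp_le_exp.2 ?_)) _
        rw [mul_assoc]
        refine mul_le_mul_of_nonneg_left (le_trans ?_ hJ) hC
        have : (k : ℝ) ≤ J := by exact_mod_cast (Finset.mem_range.1 hk).le
        have := he.1
        gcongr
    _ = _ := by rw [Finset.sum_const, Finset.card_range, nsmul_eq_mul]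

end Blocks
end Averaging

namespace Averaging

/-! ### Large deviation forces a large fluctuation integral -/

section Paths

variable {n m : ℕ} {M : Type*} [TopologicalSpace M] [ChartedSpace (Euc n) M]
  {h : M → Euc m} {Z : ℝ → (x : M) → TangentSpace (𝓡 n) x} {ε₀ : ℝ} {q : Euc m → ℝ}
  (φ : GlobalFlow (cutoffField q h Z) (Icc 0 ε₀))
  {H : Euc m → Euc m} {F : M → Euc m} {V : Set (Euc m)} {e : ℝ}

theorem GlobalFlow.hasDerivAt_slow (hh : ContMDiff (𝓡 n) (𝓡 m) 2 h) (he : e ∈ Icc 0 ε₀)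
    (z : M) (t : ℝ) : HasDerivAt (fun t => h (φ.toFun e (t / e) z))
      (e⁻¹ • (q (h (φ.toFun e (t / e) z)) • chartField h (Z e) (φ.toFun e (t / e) z))) t := by
  have h1 : HasDerivAt (fun t : ℝ => t / e) e⁻¹ t := by
    simpa using (hasDerivAt_id t).div_const e
  exact (φ.hasDerivAt_comp hh he z (t / e)).scomp t h1

theorem GlobalFlow.hasDerivAt_smul_orbitIntegral (hF : Continuous F) (he : e ∈ Icc 0 ε₀)
    (he0 : e ≠ 0) (z : M) (t : ℝ) :
    HasDerivAt (fun t => e • orbitIntegral (φ.toFun e) F (t / e) z)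
      (F (φ.toFun e (t / e) z)) t := by
  have h1 : HasDerivAt (fun t : ℝ => t / e) e⁻¹ t := by
    simpa using (hasDerivAt_id t).div_const e
  have hc : Continuous fun u => F (φ.toFun e u z) :=
    hF.comp ((φ.continuous he).comp (Continuous.prodMk_left z))
  have h2 : HasDerivAt (fun s => orbitIntegral (φ.toFun e) F s z) (F (φ.toFun e (t / e) z))
      (t / e) := (hc.integral_hasStrictDerivAt 0 (t / e)).hasDerivAt
  have h3 := (h2.scomp t h1).const_smul e
  rwa [smul_inv_smul₀ he0] at h3

/-- If the fluctuation integral stays small up to the stopping time, the averaging lemma for paths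
keeps the deviation below `δ`. The cut-off flow and the extended averaged field replace the original
objects, with which they agree as long as both paths are in `V`. -/
theorem GlobalFlow.exists_lt_norm_smul_orbitIntegral [T2Space M] {r₁ : ℝ} {c₀ : Euc m}
    {Ha : Euc m → Euc m} {L B : NNReal} (hH : LipschitzWith L H) (hB : ∀ x, ‖H x‖ ≤ B)
    (hh : ContMDiff (𝓡 n) (𝓡 m) 2 h)
    (hV : IsClosed V) (hVr : V ⊆ Metric.ball c₀ r₁) (hq : ∀ c ∈ Metric.ball c₀ r₁, q c = 1)
    (hHa : ∀ c ∈ Metric.ball c₀ r₁, H c = Ha c)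
    (hF : Continuous F) (hFV : ∀ z, h z ∈ V → F z = slowDrift ε₀ Z h z - H (h z))
    {G : Type*} [NormedAddCommGroup G] [NormedSpace ℝ G]
    (hlip : ∀ e ∈ Icc 0 ε₀, ∀ x, LipschitzInChartAt G (Z e) x)
    {T δ : ℝ} (hT : 0 ≤ T) (hδ : 0 < δ) :
    ∃ κ > 0, ∀ e ∈ Ioc 0 ε₀,
      (∀ y ∈ h ⁻¹' V, ‖e⁻¹ • chartField h (Z e) y - slowDrift ε₀ Z h y‖ ≤ κ) →
      ∀ z : M, ENNReal.ofReal δ ≤ supDeviation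
        (min (T : EReal) (stoppingTime V (fun τ => flowMap (N := Euc m) Ha τ (h z))
          (slowPath Z h e z)))
        (fun τ => flowMap (N := Euc m) Ha τ (h z)) (slowPath Z h e z) →
      h z ∈ V ∧ ∃ t ∈ Icc 0 T, z ∈ φ.stayingSet e (h ⁻¹' V) (t / e) ∧
        κ < ‖e • orbitIntegral (φ.toFun e) F (t / e) z‖ := by
  obtain ⟨κ, hκ, hav⟩ := exists_norm_sub_lt_of_averaged hH hT (half_pos hδ)
  refine ⟨κ, hκ, fun e he hdrift z hz => ?_⟩
  have he' : e ∈ Icc 0 ε₀ := ⟨he.1.le, he.2⟩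
  have hlt : ENNReal.ofReal (δ / 2) < ENNReal.ofReal δ :=
    (ENNReal.ofReal_lt_ofReal_iff hδ).2 (half_lt_self hδ)
  -- The supremum need not be attained; halving `δ` provides an actual time `τ` with a large
  -- deviation. At times strictly before `τ` both paths are in `V`, while at `τ` itself this is not
  -- yet known.
  obtain ⟨τ, hτ⟩ := lt_iSup_iff.1 (hlt.trans_le hz)
  obtain ⟨⟨hτ0, hτS⟩, hdev⟩ := lt_iSup_iff.1 hτ
  have hτT : τ ≤ T := EReal.coe_le_coe_iff.1 (hτS.trans (min_le_left _ _))
  have hbefore : ∀ σ ∈ Ico 0 τ, flowMap (N := Euc m) Ha σ (h z) ∈ V ∧ slowPath Z h e z σ ∈ V := by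
    intro σ hσ
    by_contra hcon
    have h1 : stoppingTime V (fun τ => flowMap (N := Euc m) Ha τ (h z)) (slowPath Z h e z) ≤ σ :=
      iInf₂_le σ ⟨hσ.1, by tauto⟩
    exact hσ.2.not_ge (EReal.coe_le_coe_iff.1 ((hτS.trans (min_le_right _ _)).trans h1))
  have hHa0 : flowMap (N := Euc m) Ha 0 (h z) = h z := flowMap_zero (N := Euc m) (h z)
  -- If `h z` were outside of `V`, then `τ` would be zero, where the two paths agree.
  have hzV : h z ∈ V := by
    by_contra hcon
    have h1 : ¬ 0 < τ := fun h0 => by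
      have h2 := (hbefore 0 ⟨le_rfl, h0⟩).1
      rw [hHa0] at h2
      exact hcon h2
    have h2 : τ = 0 := le_antisymm (not_lt.1 h1) hτ0
    simp [h2, slowPath, flowMap_zero, hHa0] at hdev
  refine ⟨hzV, ?_⟩
  have hslow := flowMap_eq_of_forall_mem (F := G) (X := Z e) (X' := cutoffField q h Z e)
    (W := h ⁻¹' Metric.ball c₀ r₁) (S := h ⁻¹' V) (γ := fun t => φ.toFun e t z) (t := τ / e)
    (Metric.isOpen_ball.preimage hh.continuous) (hV.preimage hh.continuous)
    (preimage_mono hVr) (fun y _ => hlip e he' y)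
    (fun y hy => by rw [cutoffField, hq _ hy]; exact one_smul ℝ (Z e y)) (φ.map_zero e he' z)
    ((φ.isMIntegralCurve e he' z).isMIntegralCurveOn _) hzV (fun u hu => by
      have h1 := (hbefore (u * e) ⟨mul_nonneg hu.1 he.1.le, (lt_div_iff₀ he.1).1 hu.2⟩).2
      rwa [slowPath, mul_div_assoc, div_self he.1.ne', mul_one] at h1)
  obtain ⟨b, hb0, hb⟩ := exists_hasDerivWithinAt_of_lipschitzWith hH hB hτ0 (h z)
  have haver := flowMap_eq_of_forall_mem (F := Euc m) (N := Euc m) (X := Ha) (X' := H)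
    Metric.isOpen_ball hV hVr
    (fun y hy => lipschitzInChartAt_of_lipschitzOnWith Metric.isOpen_ball
      (fun c hc c' hc' => by rw [← hHa c hc, ← hHa c' hc']; exact hH c c') hy) hHa hb0
    (isMIntegralCurveOn_of_hasDerivWithinAt hb) hzV (fun u hu => (hbefore u hu).1)
  have hstay : ∀ t ∈ Icc 0 τ, t / e ∈ Icc 0 (τ / e) := fun t ht =>
    ⟨div_nonneg ht.1 he.1.le, div_le_div_of_nonneg_right ht.2 he.1.le⟩
  by_contra! hcon
  have hfin := hav τ (fun t => h (φ.toFun e (t / e) z)) b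
    (fun t => e • orbitIntegral (φ.toFun e) F (t / e) z) _ _ hτT
    (fun t _ => (φ.hasDerivAt_slow hh he' z t).hasDerivWithinAt)
    (fun t _ => (φ.hasDerivAt_smul_orbitIntegral hF he' he.1.ne' z t).hasDerivWithinAt)
    hb (by simp [hb0, φ.map_zero e he']) (by simp [orbitIntegral])
    (fun t ht => ?_) (fun t ht => ?_) τ ⟨hτ0, le_rfl⟩
  · have hd : edist (slowPath Z h e z τ) (flowMap (N := Euc m) Ha τ (h z)) =
        ENNReal.ofReal ‖h (φ.toFun e (τ / e) z) - b τ‖ := by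
      rw [slowPath, (hslow _ (hstay τ ⟨hτ0, le_rfl⟩)).2, (haver τ ⟨hτ0, le_rfl⟩).2,
        edist_dist, dist_eq_norm]
    rw [hd] at hdev
    exact (ENNReal.lt_ofReal_iff_toReal_lt ENNReal.ofReal_ne_top |>.1 hdev).not_ge
      (by rw [ENNReal.toReal_ofReal (half_pos hδ).le]; exact hfin.le)
  · have hy : h (φ.toFun e (t / e) z) ∈ V := (hslow _ (hstay t ht)).1
    rw [hq _ (hVr hy), one_smul, hFV _ hy]
    convert hdrift _ hy using 2
    abel
  · exact hcon t ⟨ht.1, ht.2.trans hτT⟩ fun u hu =>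
      (hslow u ⟨hu.1, hu.2.trans (hstay t ht).2⟩).1

end Paths

/-! ### Markov's inequality for the block sums -/

section Exceptional

variable {n m : ℕ} {M : Type*} [TopologicalSpace M] [ChartedSpace (Euc n) M]
  {X : ℝ → (x : M) → TangentSpace (𝓡 n) x} {ε₀ : ℝ} (φ : GlobalFlow X (Icc 0 ε₀)) {K : Set M}
  {e : ℝ} {F : M → Euc m}

/-- For small `e` the incomplete last block contributes at most `κ / 2`, so the complete blocks must
account for the other half. -/
theorem GlobalFlow.le_blockSum_of_lt_norm (he : e ∈ Icc 0 ε₀) (he0 : 0 < e)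
    (hF : Continuous F) {C : ℝ} (hC : ∀ x, ‖F x‖ ≤ C) {N : ℝ} (hN : 0 < N) {T t κ : ℝ}
    (hκ : 0 < κ) (ht : t ∈ Icc 0 T) (heN : e * (C * N) ≤ κ / 2) {z : M}
    (hz : z ∈ φ.stayingSet e K (t / e)) (hlt : κ < ‖e • orbitIntegral (φ.toFun e) F (t / e) z‖) :
    ENNReal.ofReal (κ / 2) ≤ ENNReal.ofReal e * φ.blockSum e K F N ⌊T / e / N⌋₊ z := by
  have hC0 : 0 ≤ C := (norm_nonneg _).trans (hC z)
  have h1 := φ.enorm_orbitIntegral_le_blockSum he hF hC hN (div_nonneg ht.1 he0.le)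
    (J := ⌊T / e / N⌋₊) (Nat.floor_le_floor (by have := ht.2; gcongr)) hz
  have h2 : ENNReal.ofReal κ ≤ ENNReal.ofReal e * φ.blockSum e K F N ⌊T / e / N⌋₊ z +
      ENNReal.ofReal (κ / 2) := by
    calc ENNReal.ofReal κ ≤ ENNReal.ofReal ‖e • orbitIntegral (φ.toFun e) F (t / e) z‖ :=
          ENNReal.ofReal_le_ofReal hlt.le
      _ = ENNReal.ofReal e * ‖orbitIntegral (φ.toFun e) F (t / e) z‖ₑ := by
          rw [norm_smul, Real.norm_eq_abs, abs_of_pos he0, ENNReal.ofReal_mul he0.le, ofReal_norm]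
      _ ≤ ENNReal.ofReal e * (φ.blockSum e K F N ⌊T / e / N⌋₊ z + ENNReal.ofReal (C * N)) := by
          gcongr
      _ ≤ _ := by
          rw [mul_add, ← ENNReal.ofReal_mul he0.le]
          gcongr
  have h3 : ENNReal.ofReal κ = ENNReal.ofReal (κ / 2) + ENNReal.ofReal (κ / 2) := by
    rw [← ENNReal.ofReal_add (half_pos hκ).le (half_pos hκ).le, add_halves]
  rw [h3] at h2
  exact (ENNReal.add_le_add_iff_right ENNReal.ofReal_ne_top).1 h2

/-- The number `J` of blocks satisfies `e * (J * N) ≤ T`, so the factor `e` cancels the growth of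
their number, and the bound involves `e` only through the average over one block. -/
theorem GlobalFlow.measure_le_blockSum_le [MeasurableSpace M] [BorelSpace M] {μ : Measure M}
    [FirstCountableTopology M] [LocallyCompactSpace M]
    {C s₀ : ℝ} (hC : 0 ≤ C) (hK : IsClosed K)
    (he : e ∈ Icc 0 ε₀) (he0 : 0 < e) (hs₀ : 0 < s₀)
    (hshort : ∀ s ∈ Icc 0 s₀, ∀ E ⊆ K, MeasurableSet E →
        μ (φ.toFun e s ⁻¹' E) ≤ ENNReal.ofReal (Real.exp (C * e * s)) * μ E)
    (hF : Continuous F) {N T κ : ℝ} (hN : 0 < N) (hT : 0 ≤ T) (hκ : 0 < κ) :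
    μ {z | ENNReal.ofReal κ ≤ ENNReal.ofReal e * φ.blockSum e K F N ⌊T / e / N⌋₊ z} ≤
      ENNReal.ofReal T * ENNReal.ofReal (Real.exp (C * T)) / ENNReal.ofReal κ *
        ∫⁻ z, ‖N⁻¹ • orbitIntegral (φ.toFun e) F N z‖ₑ ∂μ := by
  set J := ⌊T / e / N⌋₊ with hJ
  have hJT : e * (J * N) ≤ T := by
    have h1 : (J : ℝ) ≤ T / e / N := Nat.floor_le (by positivity)
    calc e * (J * N) ≤ e * (T / e / N * N) := by gcongr
      _ = T := by field_simp
  have hbm := φ.measurable_blockSum he hK hF N J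
  have hIm : Measurable fun z => ‖N⁻¹ • orbitIntegral (φ.toFun e) F N z‖ₑ :=
    measurable_enorm_orbitIntegral (φ.continuous he) hF _ N
  have hI : ∫⁻ z, ‖orbitIntegral (φ.toFun e) F N z‖ₑ ∂μ =
      ENNReal.ofReal N * ∫⁻ z, ‖N⁻¹ • orbitIntegral (φ.toFun e) F N z‖ₑ ∂μ := by
    rw [← lintegral_const_mul _ hIm]
    congr 1
    funext z
    rw [← ofReal_norm, ← ofReal_norm, ← ENNReal.ofReal_mul hN.le, norm_smul, norm_inv,
      Real.norm_eq_abs, abs_of_pos hN, mul_inv_cancel_left₀ hN.ne']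
  set I := ∫⁻ z, ‖N⁻¹ • orbitIntegral (φ.toFun e) F N z‖ₑ ∂μ with hIdef
  have h1 : ∫⁻ z, ENNReal.ofReal e * φ.blockSum e K F N J z ∂μ ≤
      ENNReal.ofReal T * ENNReal.ofReal (Real.exp (C * T)) * I := by
    rw [lintegral_const_mul _ hbm]
    calc _ ≤ ENNReal.ofReal e * (J * (ENNReal.ofReal (Real.exp (C * T)) *
          (ENNReal.ofReal N * I))) := by
          rw [← hI]
          exact mul_le_mul_right (φ.lintegral_blockSum_le hC hK he hs₀ hshort hF hN hJT) _
      _ = ENNReal.ofReal (e * (J * N)) * ENNReal.ofReal (Real.exp (C * T)) * I := by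
          rw [ENNReal.ofReal_mul he0.le, ENNReal.ofReal_mul (Nat.cast_nonneg J),
            ENNReal.ofReal_natCast]
          ring
      _ ≤ _ := by gcongr
  refine (meas_ge_le_lintegral_div (hbm.const_mul _).aemeasurable
    (ENNReal.ofReal_pos.2 hκ).ne' ENNReal.ofReal_ne_top).trans ?_
  rw [ENNReal.div_eq_inv_mul, ENNReal.div_eq_inv_mul, mul_assoc]
  exact mul_le_mul_right h1 _

end Exceptional
end Averaging

namespace Averaging

/-! ### Proof of the averaging theorem -/

section Main

variable {n m : ℕ} {M : Type*} [TopologicalSpace M] [ChartedSpace (Euc n) M]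
  [IsManifold (𝓡 n) ∞ M] [MeasurableSpace M] [BorelSpace M] [T2Space M]
  [SecondCountableTopology M]
  (g : Bundle.ContMDiffRiemannianMetric (𝓡 n) ∞ (EuclideanSpace ℝ (Fin n))
      (fun x : M => TangentSpace (𝓡 n) x))
  {h : M → Euc m} {ρ : M → ℝ} {Z : ℝ → (x : M) → TangentSpace (𝓡 n) x} {ε₀ : ℝ}
  {q : Euc m → ℝ} {U V : Set (Euc m)} {F : M → Euc m}

/-- The exceptional sets of the averaging theorem have small measure. -/
theorem GlobalFlow.eventually_riemannianVolume_le (φ : GlobalFlow (cutoffField q h Z) (Icc 0 ε₀))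
    (hε₀ : 0 < ε₀)
    (hh : ContMDiff (𝓡 n) (𝓡 m) 2 h)
    (hindep : ∀ x : M, Function.Surjective (mfderiv (𝓡 n) (𝓡 m) h x))
    (hρc : ContMDiff (𝓡 n) 𝓘(ℝ, ℝ) 1 ρ) (hρ : ∀ x, 0 < ρ x)
    (hX : ContMDiffOn ((𝓡 n).prod 𝓘(ℝ, ℝ)) (𝓡 n).tangent 1
      (fun p : M × ℝ => (⟨p.1, cutoffField q h Z p.2 p.1⟩ : TangentBundle (𝓡 n) M))
      (univ ×ˢ Icc 0 ε₀))
    (hY : ContMDiffOn ((𝓡 n).prod 𝓘(ℝ, ℝ)) (𝓡 n).tangent 1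
      (fun p : M × ℝ => (⟨p.1, cutoffField q h (paramDeriv ε₀ Z) p.2 p.1⟩ :
        TangentBundle (𝓡 n) M)) (univ ×ˢ Icc 0 ε₀))
    (hXY : ∀ x, ∀ e ∈ Icc 0 ε₀, HasDerivWithinAt (F := Euc n)
      (fun e => cutoffField q h Z e x) (cutoffField q h (paramDeriv ε₀ Z) e x) (Icc 0 ε₀) e)
    (hU : IsOpen U) (hV : IsCompact V) (hVU : V ⊆ U) (hK : IsCompact (h ⁻¹' V))
    (hne : ∀ c ∈ V, (h ⁻¹' {c}).Nonempty)
    (hpres : ∀ c ∈ U, ∀ t A, MeasurableSet A →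
      fiberMeasure g h ρ c (φ.toFun 0 t ⁻¹' A) = fiberMeasure g h ρ c A)
    (herg : ∀ᵐ c : Euc m, c ∈ V → IsErgodicOn (φ.toFun 0) (h ⁻¹' {c}) (fiberMeasure g h ρ c))
    (hF : Continuous F) {C : ℝ} (hC : ∀ x, ‖F x‖ ≤ C)
    (hF0 : ∀ c ∈ V, ∫ x, F x ∂(fiberMeasure g h ρ c) = 0)
    {T κ : ℝ} (hT : 0 ≤ T) (hκ : 0 < κ) {θ : ℝ≥0∞} (hθ : 0 < θ) :
    ∀ᶠ e in 𝓝[>] (0 : ℝ), riemannianVolume g {z | h z ∈ V ∧ ∃ t ∈ Icc 0 T,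
      z ∈ φ.stayingSet e (h ⁻¹' V) (t / e) ∧
        κ < ‖e • orbitIntegral (φ.toFun e) F (t / e) z‖} ≤ θ := by
  have : LocallyCompactSpace M := ChartedSpace.locallyCompactSpace (Euc n) M
  have h00 : (0 : ℝ) ∈ Icc 0 ε₀ := ⟨le_rfl, hε₀.le⟩
  obtain ⟨hfin, a, b, -, -, -, hb, -⟩ :=
    exists_fiberMeasure_real_bounds g hh hindep hρc hρ hV hK hne
  have hb' : ∀ c ∈ V, (fiberMeasure g h ρ c).real univ ≤ b := fun c hc => (hb c hc).2
  have := isFiniteMeasure_totalMeasure g hh hindep hρc hρ hV hfin hb'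
  have hrestr := totalMeasure_restrict g hh hindep hρc hρ hV.measurableSet hVU
  have hcl : IsClosed (h ⁻¹' V) := hV.isClosed.preimage hh.continuous
  obtain ⟨C₀, hC₀, hvol⟩ :=
    exists_riemannianVolume_le_totalMeasure g hh hindep hρc hρ hU hK (preimage_mono hVU)
  obtain ⟨D, hD, ε₁, hε₁, hdist⟩ := φ.exists_distortion_of_local hK fun x hx =>
    exists_local_distortion g hh hindep hρc hρ hε₀ hX hY hXY φ hU
      (fun t A hA => totalMeasure_preimage g hh hindep hρc hρ hU.measurableSet
        ((φ.continuous h00).comp (Continuous.prodMk_right t)).measurable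
        (fun c hc A hA => hpres c hc t A hA) hA) (hVU hx)
  -- All constants are collected before `N` is chosen; `B` depends on neither `N` nor `e`.
  set B : ℝ≥0∞ := C₀ *
    (ENNReal.ofReal T * ENNReal.ofReal (Real.exp (D * T)) / ENNReal.ofReal (κ / 2)) with hB
  have hBtop : B ≠ ⊤ := ENNReal.mul_ne_top hC₀ (ENNReal.div_lt_top
    (ENNReal.mul_ne_top ENNReal.ofReal_ne_top ENNReal.ofReal_ne_top)
    (ENNReal.ofReal_pos.2 (half_pos hκ)).ne').ne
  have h1 := tendsto_lintegral_totalMeasure_orbitIntegral g hh hindep hρc hρ hV hfin hb'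
    (φ.continuous h00) (φ.map_add 0 h00) (φ.map_zero 0 h00) (fun c hc => hpres c (hVU hc)) herg
    hF hC hF0
  have h2 := ENNReal.Tendsto.const_mul h1 (Or.inr hBtop)
  rw [mul_zero] at h2
  -- The order of the limits matters: `N` is fixed by the unperturbed flow, and only then does `e`
  -- tend to zero.
  obtain ⟨N, hN, hNpos⟩ := ((h2.eventually_lt_const hθ).and (eventually_gt_atTop 0)).exists
  have hN0 : (0 : ℝ) < N := by exact_mod_cast hNpos
  have h3 := (ENNReal.Tendsto.const_mul (φ.tendsto_lintegral_orbitIntegral hε₀.le hF hC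
    (totalMeasure g h ρ V) (N : ℝ)⁻¹ N) (Or.inr hBtop)).eventually_lt_const hN
  have h4 : ∀ᶠ e in 𝓝[>] (0 : ℝ), e ∈ Ioc 0 ε₀ ∧ B * ∫⁻ x,
      ‖(N : ℝ)⁻¹ • orbitIntegral (φ.toFun e) F N x‖ₑ ∂(totalMeasure g h ρ V) < θ := by
    refine Filter.Eventually.and (Ioc_mem_nhdsGT hε₀) ?_
    · rw [← nhdsWithin_Ioc_eq_nhdsGT hε₀]
      exact h3.filter_mono (nhdsWithin_mono _ Ioc_subset_Icc_self)
  have h5 : ∀ᶠ e in 𝓝[>] (0 : ℝ), e * (C * N) < κ / 2 := by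
    have : Tendsto (fun e : ℝ => e * (C * N)) (𝓝 0) (𝓝 (0 * (C * N))) :=
      (continuous_id.mul continuous_const).tendsto 0
    rw [zero_mul] at this
    exact (this.eventually_lt_const (half_pos hκ)).filter_mono nhdsWithin_le_nhds
  filter_upwards [h4, h5, Ioo_mem_nhdsGT hε₁] with e he heN heε₁
  obtain ⟨s₀, hs₀, hshort⟩ := hdist e he.1 heε₁.2
  have he' : e ∈ Icc 0 ε₀ := ⟨he.1.1.le, he.1.2⟩
  have hshort' : ∀ s ∈ Icc 0 s₀, ∀ E ⊆ h ⁻¹' V, MeasurableSet E →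
      totalMeasure g h ρ V (φ.toFun e s ⁻¹' E) ≤
        ENNReal.ofReal (Real.exp (D * e * s)) * totalMeasure g h ρ V E := by
    intro s hs E hEK hE
    rw [← hrestr, Measure.restrict_eq_self _ hEK]
    exact (Measure.restrict_apply_le _ _).trans (hshort s hs E hEK hE)
  set A := {z | ENNReal.ofReal (κ / 2) ≤
    ENNReal.ofReal e * φ.blockSum e (h ⁻¹' V) F N ⌊T / e / N⌋₊ z} with hA
  have hAm : MeasurableSet A := measurableSet_le measurable_const
    ((φ.measurable_blockSum he' hcl hF N _).const_mul _)
  have hAE := φ.measure_le_blockSum_le (μ := totalMeasure g h ρ V) hD hcl he' he.1.1 hs₀ hshort' hF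
    hN0 hT (half_pos hκ)
  calc _ ≤ riemannianVolume g (A ∩ h ⁻¹' V) := by
        refine measure_mono fun z ⟨hz, t, ht, hst, hlt⟩ => ⟨?_, hz⟩
        exact φ.le_blockSum_of_lt_norm he' he.1.1 hF hC hN0 hκ ht heN.le hst hlt
    _ ≤ C₀ * totalMeasure g h ρ U (A ∩ h ⁻¹' V) :=
        hvol _ inter_subset_right (hAm.inter hcl.measurableSet)
    _ = C₀ * totalMeasure g h ρ V A := by rw [← hrestr, Measure.restrict_apply hAm]
    _ ≤ C₀ * (ENNReal.ofReal T * ENNReal.ofReal (Real.exp (D * T)) / ENNReal.ofReal (κ / 2) *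
        ∫⁻ x, ‖(N : ℝ)⁻¹ • orbitIntegral (φ.toFun e) F N x‖ₑ ∂(totalMeasure g h ρ V)) := by
        gcongr
    _ ≤ θ := by
        rw [← mul_assoc]
        exact he.2.le

omit [T2Space M] [SecondCountableTopology M] in
theorem integral_sub_averagedField_eq_zero (hh : Continuous h) {H : Euc m → Euc m} {c : Euc m}
    [IsFiniteMeasure (fiberMeasure g h ρ c)] (hq : q c = 1)
    (hH : H c = averagedField g ε₀ Z h ρ c) :
    ∫ x, q (h x) • (slowDrift ε₀ Z h x - H (h x)) ∂(fiberMeasure g h ρ c) = 0 := by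
  rw [← integral_sub_average (fiberMeasure g h ρ c) (slowDrift ε₀ Z h)]
  refine integral_congr_ae ?_
  have h1 : ∀ᵐ x ∂(fiberMeasure g h ρ c), h x = c := fiberMeasure_compl g hh ρ c
  filter_upwards [h1] with x hx
  rw [hx, hq, one_smul, hH]
  rfl

omit [IsManifold (𝓡 n) ∞ M] [BorelSpace M] [T2Space M] [SecondCountableTopology M] in
theorem isErgodicOn_of_eq_flowMap {X : (x : M) → TangentSpace (𝓡 n) x} {ψ : ℝ → M → M}
    (hψ : ∀ t x, ψ t x = flowMap X (q (h x) * t) x) {c : Euc m} (hq : q c = 1) {μ : Measure M}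
    (herg : IsErgodicOn (flowMap X) (h ⁻¹' {c}) μ) : IsErgodicOn ψ (h ⁻¹' {c}) μ := by
  refine fun A hA hinv => herg A hA fun t x hx => ?_
  have hx' : h x = c := hx
  rw [← hinv t x hx, hψ, hx', hq, one_mul]

theorem averaging_of_nonempty [Nonempty M] (hε₀ : 0 < ε₀)
    (hZ : ContMDiffOn ((𝓡 n).prod 𝓘(ℝ, ℝ)) (𝓡 n).tangent 1
      (fun p : M × ℝ => (⟨p.1, Z p.2 p.1⟩ : TangentBundle (𝓡 n) M)) (univ ×ˢ Icc 0 ε₀))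
    (hZ' : ContMDiffOn ((𝓡 n).prod 𝓘(ℝ, ℝ)) (𝓡 n).tangent 1
      (fun p : M × ℝ => (⟨p.1, paramDeriv ε₀ Z p.2 p.1⟩ : TangentBundle (𝓡 n) M))
      (univ ×ˢ Icc 0 ε₀))
    (hh : ContMDiff (𝓡 n) (𝓡 m) 2 h)
    (hindep : ∀ x : M, Function.Surjective (mfderiv (𝓡 n) (𝓡 m) h x))
    (hint : ∀ (t : ℝ) (x : M), h (flowMap (Z 0) t x) = h x)
    {c₀ : Euc m} {r : ℝ} (hr : 0 < r)
    (hcompact : ∀ c ∈ Metric.ball c₀ r, IsCompact (h ⁻¹' {c}) ∧ (h ⁻¹' {c}).Nonempty)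
    (hρc : ContMDiff (𝓡 n) 𝓘(ℝ, ℝ) 1 ρ) (hρ : ∀ x, 0 < ρ x)
    (hpres : ∀ c ∈ Metric.ball c₀ r, Preserves (flowMap (Z 0)) (fiberMeasure g h ρ c))
    (herg : ∀ᵐ c : Euc m, c ∈ Metric.ball c₀ r →
      IsErgodicOn (flowMap (Z 0)) (h ⁻¹' {c}) (fiberMeasure g h ρ c))
    (hV : IsCompact V) (hVU : V ⊆ Metric.ball c₀ r)
    {T δ : ℝ} (hT : 0 ≤ T) (hδ : 0 < δ) :
    Tendsto (fun ε : ℝ => riemannianVolume g {z : M | h z ∈ Metric.ball c₀ r ∧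
        ENNReal.ofReal δ ≤ supDeviation (min (T : EReal) (stoppingTime V
            (averagedPath g ε₀ Z h ρ z) (slowPath Z h ε z)))
          (averagedPath g ε₀ Z h ρ z) (slowPath Z h ε z)}) (𝓝[>] (0 : ℝ)) (𝓝 0) := by
  have : IsManifold (𝓡 n) 1 M := IsManifold.of_le (n := ∞) (by norm_cast)
  have hmn : m ≤ n := le_of_surjective_mfderiv hindep
  have h00 : (0 : ℝ) ∈ Icc 0 ε₀ := ⟨le_rfl, hε₀.le⟩
  have hch : ∀ x : M, ∃ Ψ : AdaptedChart n (n - m) h, x ∈ Ψ.chart.source := fun x =>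
    exists_adaptedChart (by omega) hh x (hindep x)
  have hlip : ∀ e ∈ Icc 0 ε₀, ∀ x, LipschitzInChartAt (Euc m × Euc (n - m)) (Z e) x := by
    intro e he x
    obtain ⟨Ψ, hΨ⟩ := hch x
    exact lipschitzInChartAt_of_contMDiffOn Ψ hZ he hΨ
  have hproper : ∀ W : Set (Euc m), IsCompact W → W ⊆ Metric.ball c₀ r → IsCompact (h ⁻¹' W) :=
    fun W hW hWU => isCompact_preimage hh.continuous hW fun c hc =>
      exists_precompact_preimage_nhds g hh hindep hρc hρ (hlip 0 h00) hint Metric.isOpen_ball herg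
        (hWU hc) (hcompact c (hWU hc)).1 (hcompact c (hWU hc)).2
  -- Radii `r₁ < r₂ < r`: `V` lies in the ball of radius `r₁`, on which the cut-off is one, and the
  -- cut-off vanishes outside radius `r₂`. By properness the cut-off fields then have compact
  -- support.
  obtain ⟨r₁, hr₁, hVr⟩ := exists_pos_lt_subset_ball hr hV.isClosed hVU
  obtain ⟨r₂, hr₂, hr₂r⟩ := exists_between hr₁.2
  let q : ContDiffBump c₀ := ⟨r₁, r₂, hr₁.1, hr₂⟩
  have hq1 : ∀ c ∈ Metric.closedBall c₀ r₁, q c = 1 := fun c hc => q.one_of_mem_closedBall hc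
  have hsub₁ : Metric.closedBall c₀ r₁ ⊆ Metric.ball c₀ r := Metric.closedBall_subset_ball hr₁.2
  have hK₂ : IsCompact (h ⁻¹' Metric.closedBall c₀ r₂) :=
    hproper _ (isCompact_closedBall c₀ r₂) (Metric.closedBall_subset_ball hr₂r)
  have hqK : ∀ x ∉ h ⁻¹' Metric.closedBall c₀ r₂, q (h x) = 0 := fun x hx =>
    q.zero_of_le_dist (not_le.1 hx).le
  have hX := contMDiffOn_cutoffField (q := q) q.contDiff hh hZ
  have hY := contMDiffOn_cutoffField (q := q) q.contDiff hh hZ'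
  obtain ⟨φ⟩ := nonempty_globalFlow hch hX hK₂ fun e _ x hx => by
    rw [cutoffField, hqK x hx]
    exact zero_smul ℝ (Z e x)
  have hlip' : ∀ x, LipschitzInChartAt (Euc m × Euc (n - m)) (cutoffField q h Z 0) x := by
    intro x
    obtain ⟨Ψ, hΨ⟩ := hch x
    exact lipschitzInChartAt_of_contMDiffOn Ψ hX h00 hΨ
  have hZsec : ContMDiff (𝓡 n) (𝓡 n).tangent 1
      (fun x => (⟨x, Z 0 x⟩ : TangentBundle (𝓡 n) M)) := by
    rw [← contMDiffOn_univ]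
    exact hZ.comp (contMDiff_id.prodMk (contMDiff_const (c := (0 : ℝ)))).contMDiffOn
      fun x _ => ⟨mem_univ _, h00⟩
  have hZ0 := mfderiv_eq_zero_of_flowMap hh hZsec (hlip 0 h00) hint
  have hφ := φ.eq_flowMap hε₀.le hh (hlip 0 h00) hlip' hZ0
  have hV₁ : IsCompact (h ⁻¹' Metric.closedBall c₀ r₁) :=
    hproper _ (isCompact_closedBall c₀ r₁) hsub₁
  have hdrift := contMDiff_slowDrift hε₀.le hh hZ'
  obtain ⟨K, hK⟩ := exists_lipschitzOnWith_average g hh hindep hρc hρ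
    (isCompact_closedBall c₀ r₁) hV₁ (fun c hc => (hcompact c (hsub₁ hc)).2) hdrift
  -- The averaged field is known to be Lipschitz only over a compact set of levels; it is extended
  -- from the closed ball, on whose interior it defines the averaged path near `V`.
  obtain ⟨L, B, H, hHl, hHb, hH⟩ :=
    LipschitzOnWith.exists_bounded_extension (isCompact_closedBall c₀ r₁) hK
  set F : M → Euc m := fun x => q (h x) • (slowDrift ε₀ Z h x - H (h x)) with hF
  have hFc : Continuous F := (q.continuous.comp hh.continuous).smul
    (hdrift.continuous.sub (hHl.continuous.comp hh.continuous))
  obtain ⟨C, hC⟩ := hFc.bounded_above_of_compact_support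
    (HasCompactSupport.intro hK₂ fun x hx => by rw [hF]; simp only [hqK x hx, zero_smul])
  have hVc : V ⊆ Metric.closedBall c₀ r₁ := hVr.trans Metric.ball_subset_closedBall
  have hKV := hproper V hV hVU
  have hfin := (exists_fiberMeasure_real_bounds g hh hindep hρc hρ hV hKV
    fun c hc => (hcompact c (hVU hc)).2).1
  have hF0 : ∀ c ∈ V, ∫ x, F x ∂(fiberMeasure g h ρ c) = 0 := fun c hc => by
    have := hfin c hc
    exact integral_sub_averagedField_eq_zero g hh.continuous (hq1 c (hVc hc)) (hH (hVc hc)).symm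
  obtain ⟨κ, hκ, hbad⟩ := φ.exists_lt_norm_smul_orbitIntegral (F := F)
    (Ha := averagedField g ε₀ Z h ρ) hHl hHb hh hV.isClosed hVr
    (fun c hc => hq1 c (Metric.ball_subset_closedBall hc))
    (fun c hc => (hH (Metric.ball_subset_closedBall hc)).symm) hFc
    (fun z hz => by rw [hF]; simp only [hq1 _ (hVc hz), one_smul]) hlip hT hδ
  refine ENNReal.tendsto_nhds_zero.2 fun θ hθ => ?_
  have hsmall := φ.eventually_riemannianVolume_le g hε₀ hh hindep hρc hρ hX hY
    (fun x e he => hasDerivWithinAt_cutoffField hch hZ x he) Metric.isOpen_ball hV hVU hKV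
    (fun c hc => (hcompact c (hVU hc)).2)
    (fun c hc t A hA => fiberMeasure_preimage_of_eq_flowMap g hh.continuous hφ (hpres c hc) t hA)
    (by
      filter_upwards [herg] with c hc hcV
      exact isErgodicOn_of_eq_flowMap hφ (hq1 c (hVc hcV)) (hc (hVU hcV)))
    hFc hC hF0 hT hκ hθ
  filter_upwards [hsmall, Ioc_mem_nhdsGT hε₀, eventually_norm_chartField_sub_slowDrift_le hε₀ hch
    hh hZ hZ' hZ0 hKV hκ] with e he heε hed
  exact (measure_mono fun z hz => hbad e heε hed z hz.2).trans he

end Main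
end Averaging

theorem mainTheorem5 {n m : ℕ} {M : Type*} [TopologicalSpace M]
    [ChartedSpace (EuclideanSpace ℝ (Fin n)) M] [IsManifold (𝓡 n) ∞ M]
    [T2Space M] [SecondCountableTopology M] [MeasurableSpace M] [BorelSpace M]
    -- the Riemannian metric
    (g : Bundle.ContMDiffRiemannianMetric (𝓡 n) ∞ (EuclideanSpace ℝ (Fin n))
      (fun x : M => TangentSpace (𝓡 n) x))
    -- the family of vector fields; `Z` and `∂Z/∂ε` are `C¹` on `M × [0, ε₀]`
    (ε₀ : ℝ) (hε₀ : 0 < ε₀) (Z : ℝ → (x : M) → TangentSpace (𝓡 n) x)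
    (hZ : ContMDiffOn ((𝓡 n).prod 𝓘(ℝ, ℝ)) (𝓡 n).tangent 1
      (fun p : M × ℝ => (⟨p.1, Z p.2 p.1⟩ : TangentBundle (𝓡 n) M)) (univ ×ˢ Icc 0 ε₀))
    (hZ' : ContMDiffOn ((𝓡 n).prod 𝓘(ℝ, ℝ)) (𝓡 n).tangent 1
      (fun p : M × ℝ => (⟨p.1, Averaging.paramDeriv ε₀ Z p.2 p.1⟩ : TangentBundle (𝓡 n) M))
      (univ ×ˢ Icc 0 ε₀))
    -- `m` independent `C²` first integrals of the unperturbed flow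
    (h : M → EuclideanSpace ℝ (Fin m)) (hh : ContMDiff (𝓡 n) (𝓡 m) 2 h)
    (hindep : ∀ x : M, Function.Surjective (mfderiv (𝓡 n) (𝓡 m) h x))
    (hint : ∀ (t : ℝ) (x : M), h (Averaging.flowMap (Z 0) t x) = h x)
    -- the open ball `U`, over which the level sets are compact (and nonempty)
    (c₀ : EuclideanSpace ℝ (Fin m)) (r : ℝ)
    (hcompact : ∀ c ∈ Metric.ball c₀ r, IsCompact (h ⁻¹' {c}) ∧ (h ⁻¹' {c}).Nonempty)
    -- preservation of smooth measures
    (ρ : M → ℝ) (hρ : ContMDiff (𝓡 n) 𝓘(ℝ, ℝ) 1 ρ) (hρ_pos : ∀ x, 0 < ρ x)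
    (hpres : ∀ c ∈ Metric.ball c₀ r,
      Averaging.Preserves (Averaging.flowMap (Z 0)) (Averaging.fiberMeasure g h ρ c))
    -- ergodicity on almost every level set
    (herg : ∀ᵐ c : EuclideanSpace ℝ (Fin m), c ∈ Metric.ball c₀ r →
      Averaging.IsErgodicOn (Averaging.flowMap (Z 0)) (h ⁻¹' {c})
        (Averaging.fiberMeasure g h ρ c))
    (V : Set (EuclideanSpace ℝ (Fin m))) (hV : IsCompact V) (hVU : V ⊆ Metric.ball c₀ r)
    (T : ℝ) (hT : 0 < T) (δ : ℝ) (hδ : 0 < δ) :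
    Tendsto
      (fun ε : ℝ => Averaging.riemannianVolume g
        {z : M | h z ∈ Metric.ball c₀ r ∧
          ENNReal.ofReal δ ≤ Averaging.supDeviation
            (min (T : EReal) (Averaging.stoppingTime V
              (Averaging.averagedPath g ε₀ Z h ρ z) (Averaging.slowPath Z h ε z)))
            (Averaging.averagedPath g ε₀ Z h ρ z) (Averaging.slowPath Z h ε z)})
      (𝓝[>] (0 : ℝ)) (𝓝 0) := by
  rcases isEmpty_or_nonempty M with hM | hM
  -- The degenerate cases of an empty manifold and of an empty ball leave nothing to measure.
  · simp [Set.eq_empty_of_isEmpty]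
  rcases le_or_gt r 0 with hr | hr
  · simp [Metric.ball_eq_empty.2 hr]
  exact Averaging.averaging_of_nonempty g hε₀ hZ hZ' hh hindep hint hr hcompact hρ hρ_pos hpres
    herg hV hVU hT.le hδ
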